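/- **Conventions.** Let $K$ be a number field. At each place $v$ let $|\cdot|_v$ be the standard modulus if $v$ is infinite and $|x|_v=N\mathfrak p^{-\operatorname{ord}_{\mathfrak p}(x)}$ if $v$ corresponds to the prime $\mathfrak p$; let $K_v$ be the completion and $E_v=K_v\otimes_K E$ for a $K$-vector space $E$. A *rigid adelic space* over $K$ is a finite-dimensional $K$-vector space $E$ with a norm $\|\cdot\|_v$ on $E_v$ for every place $v$, such that every $E_v$ has an orthonormal $K_v$-basis $(e_i)$, meaning $\|\sum x_ie_i\|_v=(\sum|x_i|_v^2)^{1/2}$ if $v$ is infinite and $\|\sum x_ie_i\|_v=\max|x_i|_v$ if $v$ is finite, and some $K$-basis of $E$ is orthonormal at all but finitely many places. (Equivalently, the norms come from an $\mathcal O_K$-lattice in $E$ and positive definite quadratic or Hermitian forms at the infinite places.) Subspaces carry the restricted norms, quotients the quotient norms, the dual $E^\vee=\operatorname{Hom}_K(E,K)$ the operator norms, and $E\times F$ the norms $(\|x\|_v^2+\|y\|_v^2)^{1/2}$ for $v$ infinite and $\max(\|x\|_v,\|y\|_v)$ for $v$ finite. If $K$ is a CM field with complex conjugation $a\mapsto\overline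 a$, the conjugate dual $\overline{E^\vee}$ is $E^\vee$ with the scalar multiplication $a\star\varphi=\overline a\,\varphi$; its norm at $v$ is the norm of $E^\vee$ at $\overline v$, transported along the canonical map $K_v\otimes_K\overline{E^\vee}\to K_{\overline v}\otimes_K E^\vee$, $\lambda\otimes\varphi\mapsto\overline\lambda\otimes\varphi$. The height of $E$ is $H(E)=\bigl(\prod_v|\det_{e_v}(b)|_v^{\epsilon_v}\bigr)^{1/[K:\mathbb Q]}$, where $b$ is any $K$-basis of $E$, $\det_{e_v}$ is the determinant relative to an orthonormal basis of $E_v$, and $\epsilon_v=2$ if $v$ is complex, $1$ otherwise; for $E\ne0$ the reduced height is $H_r(E)=H(E)^{1/\dim E}$. The destabilizing subspace of $E\neq 0$ is the largest among the nonzero subspaces $F\subseteq E$ of minimal $H_r(F)$. The *GS-filtration* (Grayson–Stuhler filtration) of $E$ is the flag $\{0\}=E_0\subset E_1\subset\dots\subset E_\ell=E$ such that $E_i/E_{i-1}$ is the destabilizing subspace of $E/E_{i-1}$ for $1\le i\le\ell$. A *similarity* $\sigma:E\to F$ of rigid adelic spaces is a $K$-linear map such that for every $v$ there is $\lambda_v>0$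 with $\|\sigma_v(x)\|_v=\lambda_v\|x\|_v$ for all $x\in E_v$, and $\lambda_v=1$ for all but finitely many $v$. A rigid adelic space $E$ is *isodual* if there is a similarity $\sigma:E\to E^\vee$ and, when $K$ is a CM field, *anti-isodual* if there is a similarity $\sigma:E\to\overline{E^\vee}$. In both cases put $b_\sigma(x,y)=\sigma(x)(y)$. In the isodual case $(E,\sigma)$ is of orthogonal type if $b_\sigma$ is symmetric and of symplectic type if $b_\sigma$ is alternating; in the anti-isodual case it is of unitary type if $b_\sigma$ is Hermitian. For $F\subseteq E$ let $F^\perp=\{\varphi\in E^\vee:\varphi(F)=0\}$; $F$ is *totally isotropic* if $b_\sigma(x,y)=0$ for all $x,y\in F$, and *coisotropic* if $F$ contains every $y\in E$ with $b_\sigma(x,y)=0$ for all $x\in F$. **Proposition.** Let $(E,\sigma)$ be either isodual of orthogonal or symplectic type over a number field $K$, or anti-isodual of unitary type over a CM field $K$, and let $\{0\}=E_0\subset E_1\subset\dots\subset E_\ell=E$ be its GS-filtration. Then: 1. $\sigma E_i=E_{\ell-i}^\perp$ for every $0\le i\le\ell$; 2. $E_i$ is totally isotropic with respect to $b_\sigma$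 if $i\le\ell/2$, and coisotropic if $i\ge\ell/2$; 3. if $i\le\ell/2$, the quotient $E_{\ell-i}/E_i$ is again isodual (respectively, anti-isodual); 4. if $0\le i\le j\le\ell/2$, the product $E_j/E_i\times E_{\ell-i}/E_{\ell-j}$ is again isodual (respectively, anti-isodual). -/

import Mathlib

open scoped TensorProduct NumberField
open Module IsDedekindDomain

noncomputable section

namespace RigidAdelic

/-! ### Norms on one completion

`K` is a field, `L` a normed field containing it (later: the completion of a number field at a
place), `V` a `K`-vector space, and `V_L = L ⊗[K] V` is its localisation. -/

section Local

variable {K : Type*} [Field K] (L : Type*) [NormedField L] [Algebra K L]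
variable {V : Type*} [AddCommGroup V] [Module K V] {W : Type*} [AddCommGroup W] [Module K W]

/-- Restriction to `F_L` of a norm on `V_L`. -/
def restrictNorm (N : L ⊗[K] V → ℝ) (F : Submodule K V) : L ⊗[K] F → ℝ :=
  fun x => N (F.subtype.baseChange L x)

/-- The quotient norm on `(V / F)_L`. -/
def quotientNorm (N : L ⊗[K] V → ℝ) (F : Submodule K V) : L ⊗[K] (V ⧸ F) → ℝ :=
  fun y => sInf {r : ℝ | ∃ x : L ⊗[K] V, F.mkQ.baseChange L x = y ∧ N x = r}

/-- The action of `(Hom_K(V, K))_L` on `V_L` by `L`-linear forms: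
`(μ ⊗ φ) (l ⊗ x) = μ * l * φ x`. -/
def evalDual : L ⊗[K] Dual K V →ₗ[L] L ⊗[K] V →ₗ[L] L :=
  LinearMap.liftBaseChange L
    { toFun := fun φ => LinearMap.liftBaseChange L ((Algebra.linearMap K L).comp φ)
      map_add' := fun φ ψ => by ext x; simp
      map_smul' := fun a φ => by ext x; simp [Algebra.smul_def] }

/-- The operator norm on `(Hom_K(V, K))_L` (the quotient is `0 / 0 = 0` for `x = 0`). -/
def dualNorm (N : L ⊗[K] V → ℝ) : L ⊗[K] Dual K V → ℝ :=
  fun φ => ⨆ x : L ⊗[K] V, ‖evalDual L φ x‖ / N x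

/-- `e` is an orthonormal basis of `V_L` in the Euclidean or Hermitian sense:
`‖∑ x_i e_i‖ = (∑ |x_i|²)^(1/2)`. -/
def IsOrthonormalArch {n : ℕ} (N : L ⊗[K] V → ℝ) (e : Basis (Fin n) L (L ⊗[K] V)) : Prop :=
  ∀ x, N x = √(∑ i, ‖e.repr x i‖ ^ 2)

/-- `e` is an orthonormal basis of `V_L` in the ultrametric sense: `‖∑ x_i e_i‖ = max |x_i|`. -/
def IsOrthonormalUltra {n : ℕ} (N : L ⊗[K] V → ℝ) (e : Basis (Fin n) L (L ⊗[K] V)) : Prop :=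
  ∀ x, N x = ⨆ i, ‖e.repr x i‖

open Classical in
/-- The absolute value of the determinant of a `K`-basis `b` of `V` with respect to a basis of
`V_L` satisfying `P` (in the applications, an orthonormal basis; the absolute value does not depend
on which one). The value is `1` if there is no such basis. -/
def absDet {n : ℕ} (P : Basis (Fin n) L (L ⊗[K] V) → Prop) (b : Basis (Fin n) K V) : ℝ :=
  if h : ∃ e, P e then ‖h.choose.det (fun i => (1 : L) ⊗ₜ[K] b i)‖ else 1

end Local

/-! ### Rigid adelic spaces over a number field -/

variable (K : Type*) [Field K] [NumberField K]

/-- A family of functions (local norms) on all the completions `V_v = K_v ⊗[K] V` of a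
`K`-vector space. The completions carry Mathlib's normalised absolute values:
the standard modulus at infinite places and `|x| = N(𝔭)^(-ord_𝔭 x)` at finite places. -/
structure AdelicSpace (V : Type*) [AddCommGroup V] [Module K V] where
  /-- The norm at an infinite place. -/
  inf : ∀ v : NumberField.InfinitePlace K, v.Completion ⊗[K] V → ℝ
  /-- The norm at a finite place. -/
  fin : ∀ v : HeightOneSpectrum (𝓞 K), v.adicCompletion K ⊗[K] V → ℝ

namespace AdelicSpace

variable {K} {V : Type*} [AddCommGroup V] [Module K V] {W : Type*} [AddCommGroup W] [Module K W]

/-- `X` is a rigid adelic space: every local norm admits an orthonormal basis (so it comes from a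
positive definite quadratic or Hermitian form at an infinite place and from a lattice at a finite
place), and some `K`-basis of `V` is orthonormal at all but finitely many places. -/
structure IsRigid (X : AdelicSpace K V) : Prop where
  exists_inf : ∀ v, ∃ e : Basis (Fin (finrank K V)) v.Completion (v.Completion ⊗[K] V),
    IsOrthonormalArch v.Completion (X.inf v) e
  exists_fin : ∀ v,
    ∃ e : Basis (Fin (finrank K V)) (v.adicCompletion K) (v.adicCompletion K ⊗[K] V),
    IsOrthonormalUltra (v.adicCompletion K) (X.fin v) e
  almost_all : ∃ b : Basis (Fin (finrank K V)) K V,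
    {v : HeightOneSpectrum (𝓞 K) | ¬ IsOrthonormalUltra (v.adicCompletion K) (X.fin v)
      (Algebra.TensorProduct.basis (v.adicCompletion K) b)}.Finite

/-- The structure induced on a subspace. -/
def sub (X : AdelicSpace K V) (F : Submodule K V) : AdelicSpace K F where
  inf v := restrictNorm v.Completion (X.inf v) F
  fin v := restrictNorm (v.adicCompletion K) (X.fin v) F

/-- The structure induced on a quotient. -/
def quotient (X : AdelicSpace K V) (F : Submodule K V) : AdelicSpace K (V ⧸ F) where
  inf v := quotientNorm v.Completion (X.inf v) F
  fin v := quotientNorm (v.adicCompletion K) (X.fin v) F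

/-- The subquotient `G / F` for subspaces `F ⊆ G`. -/
def subquotient (X : AdelicSpace K V) (F G : Submodule K V) :
    AdelicSpace K (G ⧸ F.submoduleOf G) :=
  (X.sub G).quotient (F.submoduleOf G)

/-- The dual space, with operator norms. -/
def dual (X : AdelicSpace K V) : AdelicSpace K (Dual K V) where
  inf v := dualNorm v.Completion (X.inf v)
  fin v := dualNorm (v.adicCompletion K) (X.fin v)

/-- The direct product: `(‖x‖² + ‖y‖²)^(1/2)` at infinite places, `max ‖x‖ ‖y‖` at finite ones. -/
def prod (X : AdelicSpace K V) (Y : AdelicSpace K W) : AdelicSpace K (V × W) where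
  inf v z := √(X.inf v ((LinearMap.fst K V W).baseChange v.Completion z) ^ 2 +
    Y.inf v ((LinearMap.snd K V W).baseChange v.Completion z) ^ 2)
  fin v z := max (X.fin v ((LinearMap.fst K V W).baseChange (v.adicCompletion K) z))
    (Y.fin v ((LinearMap.snd K V W).baseChange (v.adicCompletion K) z))

/-- The normalised height `H(V) = (∏_v |det_{e_v} b|_v^{e_v})^(1/[K:ℚ])`, where `b` is a `K`-basis
of `V`, the determinant is relative to an orthonormal basis `e_v` of `V_v`, and the exponent is `2`
at complex places and `1` elsewhere.
If the finite norms come from the lattice `⨁ 𝔞_i b_i`, then `α_i b_i` is an orthonormal basis at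
`v` when `α_i` generates `𝔞_i` there, so the product over the finite places is `N(∏ 𝔞_i)`; at an
infinite place `|det_{e_v} b|² = det (h_v(b_i, b_j))`. By the product formula the result
does not depend on `b`. -/
def height [Module.Finite K V] (X : AdelicSpace K V) : ℝ :=
  ((∏ v : NumberField.InfinitePlace K,
      absDet v.Completion (IsOrthonormalArch v.Completion (X.inf v)) (finBasis K V) ^ v.mult) *
    ∏ᶠ v : HeightOneSpectrum (𝓞 K),
      absDet (v.adicCompletion K) (IsOrthonormalUltra (v.adicCompletion K) (X.fin v))
        (finBasis K V)) ^ (1 / (finrank ℚ K : ℝ))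

/-- The reduced height `H_r(V) = H(V)^(1 / dim V)`. -/
def reducedHeight [Module.Finite K V] (X : AdelicSpace K V) : ℝ :=
  X.height ^ (1 / (finrank K V : ℝ))

/-- `D` is the destabilizing subspace: a nonzero subspace of minimal reduced height that contains
every other such subspace. -/
structure IsDestabilizing [Module.Finite K V] (X : AdelicSpace K V) (D : Submodule K V) :
    Prop where
  ne_bot : D ≠ ⊥
  minimal : ∀ F : Submodule K V, F ≠ ⊥ → (X.sub D).reducedHeight ≤ (X.sub F).reducedHeight
  maximum : ∀ F : Submodule K V, F ≠ ⊥ →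
    (X.sub F).reducedHeight = (X.sub D).reducedHeight → F ≤ D

/-- `0 = E 0 ⊆ E 1 ⊆ ⋯ ⊆ E ℓ = V` is the Grayson–Stuhler filtration: `E (i + 1) / E i` is the
destabilizing subspace of `V / E i` for `i < ℓ`. The values `E i` for `ℓ < i` are irrelevant. -/
structure IsGSFiltration [Module.Finite K V] (X : AdelicSpace K V) (ℓ : ℕ)
    (E : ℕ → Submodule K V) : Prop where
  zero : E 0 = ⊥
  length : E ℓ = ⊤
  le_succ : ∀ i < ℓ, E i ≤ E (i + 1)
  destabilizing : ∀ i < ℓ,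
    (X.quotient (E i)).IsDestabilizing ((E (i + 1)).map (E i).mkQ)

/-- `σ` is a similarity: each of its localisations multiplies the norm by a positive constant,
which is `1` at all but finitely many places. -/
def IsSimilarity (X : AdelicSpace K V) (Y : AdelicSpace K W) (σ : V →ₗ[K] W) : Prop :=
  (∀ v : NumberField.InfinitePlace K, ∃ r : ℝ, 0 < r ∧
    ∀ x, Y.inf v (σ.baseChange v.Completion x) = r * X.inf v x) ∧
  ∃ r : HeightOneSpectrum (𝓞 K) → ℝ, (∀ v, 0 < r v) ∧ {v | r v ≠ 1}.Finite ∧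
    ∀ v x, Y.fin v (σ.baseChange (v.adicCompletion K) x) = r v * X.fin v x

/-- `X` is an isodual rigid adelic space. -/
def IsIsodual (X : AdelicSpace K V) : Prop :=
  X.IsRigid ∧ ∃ σ : V →ₗ[K] Dual K V, X.IsSimilarity X.dual σ

end AdelicSpace

/-! ### Conjugate spaces over a CM field -/

section CM

theorem denseRange_inf {K : Type*} [Field K] (v : NumberField.InfinitePlace K) :
    DenseRange (algebraMap K v.Completion) := by
  have h := (NumberField.InfinitePlace.Completion.denseRange_coe v).comp
    (WithAbs.equiv v.1).symm.surjective.denseRange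
    (NumberField.InfinitePlace.Completion.continuous_coe v)
  exact h

/-- Extension by continuity of a field homomorphism `c` that carries the absolute value of `L`
to that of `L'`, to a homomorphism from the completion `L` to the complete field `L'`. -/
def extendHom {K : Type*} [Field K] (c : K →+* K) (L L' : Type*) [NormedField L] [NormedField L']
    [CompleteSpace L'] [Algebra K L] [Algebra K L'] (hd : DenseRange (algebraMap K L))
    (hc : ∀ x, ‖algebraMap K L' (c x)‖ = ‖algebraMap K L x‖) : L →+* L' :=
  letI : NormedField K := NormedField.induced K L (algebraMap K L) (algebraMap K L).injective
  IsDenseInducing.extendRingHom (i := algebraMap K L) (f := (algebraMap K L').comp c)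
    (Isometry.isUniformInducing (AddMonoidHomClass.isometry_of_norm _ fun _ => rfl)) hd
    (Isometry.uniformContinuous (AddMonoidHomClass.isometry_of_norm _ hc))

theorem extendHom_algebraMap {K : Type*} [Field K] (c : K →+* K) (L L' : Type*) [NormedField L]
    [NormedField L'] [CompleteSpace L'] [Algebra K L] [Algebra K L']
    (hd : DenseRange (algebraMap K L))
    (hc : ∀ x, ‖algebraMap K L' (c x)‖ = ‖algebraMap K L x‖) (a : K) :
    extendHom c L L' hd hc (algebraMap K L a) = algebraMap K L' (c a) := by
  let _ : NormedField K := NormedField.induced K L (algebraMap K L) (algebraMap K L).injective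
  have hi : IsUniformInducing (algebraMap K L) :=
    Isometry.isUniformInducing (AddMonoidHomClass.isometry_of_norm _ fun _ => rfl)
  have hf : UniformContinuous ((algebraMap K L').comp c) :=
    Isometry.uniformContinuous (AddMonoidHomClass.isometry_of_norm _ hc)
  exact (hi.isDenseInducing hd).extend_eq hf.continuous a

variable [NumberField.IsCMField K]

/-- Complex conjugation on a CM field. -/
abbrev conj : K →+* K := (NumberField.IsCMField.complexConj K : K →+* K)

/-- Complex conjugation on the ring of integers of a CM field. -/
abbrev conjInt : 𝓞 K ≃+* 𝓞 K :=
  NumberField.RingOfIntegers.mapRingEquiv (NumberField.IsCMField.complexConj K).toRingEquiv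

/-- The conjugate `v̄` of a finite place `v`. -/
def conjPlace (v : HeightOneSpectrum (𝓞 K)) : HeightOneSpectrum (𝓞 K) :=
  v.comap (conjInt K : 𝓞 K →+* 𝓞 K) (conjInt K).surjective

variable {K}

theorem conjInt_conjInt (r : 𝓞 K) : conjInt K (conjInt K r) = r := by
  apply NumberField.RingOfIntegers.ext
  exact NumberField.IsCMField.complexConj_apply_apply K (r : K)

theorem conjInt_mem_pow_iff (v : HeightOneSpectrum (𝓞 K)) (r : 𝓞 K) (n : ℕ) :
    conjInt K r ∈ (conjPlace K v).asIdeal ^ n ↔ r ∈ v.asIdeal ^ n := by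
  have h : (conjPlace K v).asIdeal = v.asIdeal.map (conjInt K).symm := by
    rw [Ideal.map_symm]; rfl
  rw [h, ← Ideal.map_pow, Ideal.map_symm, Ideal.mem_comap, conjInt_conjInt]

theorem absNorm_conjPlace (v : HeightOneSpectrum (𝓞 K)) :
    Ideal.absNorm (conjPlace K v).asIdeal = Ideal.absNorm v.asIdeal := by
  rw [Ideal.absNorm_apply, Ideal.absNorm_apply]
  refine Nat.card_congr (Ideal.quotientEquiv _ _ (conjInt K) ?_).toEquiv
  change v.asIdeal = Ideal.map (conjInt K) (Ideal.comap (conjInt K) v.asIdeal)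
  exact (Ideal.map_comap_of_surjective _ (conjInt K).surjective _).symm

theorem intValuation_conjPlace (v : HeightOneSpectrum (𝓞 K)) (r : 𝓞 K) :
    (conjPlace K v).intValuation (conjInt K r) = v.intValuation r := by
  by_cases hr : r = 0
  · simp [hr]
  · rw [HeightOneSpectrum.intValuation_eq_exp_neg_multiplicity _ hr,
      HeightOneSpectrum.intValuation_eq_exp_neg_multiplicity _ (by simpa using hr),
      multiplicity_eq_of_emultiplicity_eq (c := v.asIdeal) (d := Ideal.span {r})
        (emultiplicity_eq_emultiplicity_iff.2 fun n => ?_)]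
    rw [Ideal.dvd_span_singleton, Ideal.dvd_span_singleton, conjInt_mem_pow_iff]

/-- Complex conjugation carries the absolute value at `v` to the one at `v̄`. -/
theorem norm_conj_fin (v : HeightOneSpectrum (𝓞 K)) (x : K) :
    ‖algebraMap K ((conjPlace K v).adicCompletion K) (conj K x)‖ =
      ‖algebraMap K (v.adicCompletion K) x‖ := by
  have hint : ∀ r : 𝓞 K,
      ‖algebraMap K ((conjPlace K v).adicCompletion K) (conj K (algebraMap (𝓞 K) K r))‖ =
        ‖algebraMap K (v.adicCompletion K) (algebraMap (𝓞 K) K r)‖ := by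
    intro r
    have h1 := NumberField.FinitePlace.norm_embedding_int K (conjPlace K v) (conjInt K r)
    have h2 := NumberField.FinitePlace.norm_embedding_int K v r
    rw [intValuation_conjPlace] at h1
    simp only [absNorm_conjPlace] at h1
    exact h1.trans h2.symm
  obtain ⟨a, b, hb, rfl⟩ := IsFractionRing.div_surjective (A := 𝓞 K) x
  simp only [map_div₀, norm_div, hint]

/-- Complex conjugation preserves the absolute value at an infinite place. -/
theorem norm_conj_inf (v : NumberField.InfinitePlace K) (x : K) :
    ‖algebraMap K v.Completion (conj K x)‖ = ‖algebraMap K v.Completion x‖ := by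
  have h := fun y : K => NumberField.InfinitePlace.Completion.norm_coe v (WithAbs.toAbs v.1 y)
  exact (h _).trans ((NumberField.IsCMField.infinitePlace_complexConj K v x).trans (h x).symm)

/-- The continuous extension `K_v → K_v̄` of complex conjugation at a finite place. -/
def conjFin (v : HeightOneSpectrum (𝓞 K)) :
    v.adicCompletion K →+* (conjPlace K v).adicCompletion K :=
  extendHom (conj K) _ _ (HeightOneSpectrum.denseRange_algebraMap K v) (norm_conj_fin v)

/-- The continuous extension `K_v → K_v` of complex conjugation at an infinite place. -/
def conjInf (v : NumberField.InfinitePlace K) : v.Completion →+* v.Completion :=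
  extendHom (conj K) _ _ (denseRange_inf v) (norm_conj_inf v)

theorem conjFin_algebraMap (v : HeightOneSpectrum (𝓞 K)) (a : K) :
    conjFin v (algebraMap K _ a) = algebraMap K _ (conj K a) :=
  extendHom_algebraMap ..

theorem conjInf_algebraMap (v : NumberField.InfinitePlace K) (a : K) :
    conjInf v (algebraMap K _ a) = algebraMap K _ (conj K a) :=
  extendHom_algebraMap ..

/-- The conjugate of a `K`-vector space: the same group, with `a ⋆ x = ā x`. -/
def Conj (_K : Type*) (V : Type*) : Type _ := V

namespace Conj

variable {V : Type*} [AddCommGroup V] [Module K V]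

instance : AddCommGroup (Conj K V) := inferInstanceAs (AddCommGroup V)

instance : Module K (Conj K V) := Module.compHom V (conj K)

variable (K V) in
/-- The identity map from the conjugate space to the space. -/
def out : Conj K V ≃+ V := AddEquiv.refl V

theorem out_smul (a : K) (x : Conj K V) : out K V (a • x) = conj K a • out K V x := rfl

/-- The map `L ⊗ Conj V → L' ⊗ V`, `l ⊗ x ↦ c l ⊗ x`, induced by an extension `c : L → L'` of
complex conjugation. -/
def tensorMap (V : Type*) [AddCommGroup V] [Module K V] {L L' : Type*} [NormedField L]
    [NormedField L'] [Algebra K L] [Algebra K L'] (c : L →+* L')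
    (hc : ∀ a : K, c (algebraMap K L a) = algebraMap K L' (conj K a)) :
    L ⊗[K] Conj K V →+ L' ⊗[K] V :=
  TensorProduct.liftAddHom
    { toFun := fun l =>
        { toFun := fun x => c l ⊗ₜ[K] out K V x
          map_zero' := by simp
          map_add' := fun x y => by simp [TensorProduct.tmul_add] }
      map_zero' := by ext x; simp
      map_add' := fun l m => by ext x; simp [TensorProduct.add_tmul] }
    fun a l x => by
      simp only [AddMonoidHom.coe_mk, ZeroHom.coe_mk]
      rw [out_smul, ← TensorProduct.smul_tmul, Algebra.smul_def, Algebra.smul_def, map_mul, hc]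

end Conj

namespace AdelicSpace

variable {V : Type*} [AddCommGroup V] [Module K V]

/-- The conjugate of an adelic space: the norms are those of `X`, transported along
the canonical map from the localisation of `Conj V` at `v` to that of `V` at `v̄`. -/
def conjugate (X : AdelicSpace K V) : AdelicSpace K (Conj K V) where
  inf v z := X.inf v (Conj.tensorMap V (conjInf v) (conjInf_algebraMap v) z)
  fin v z := X.fin (conjPlace K v) (Conj.tensorMap V (conjFin v) (conjFin_algebraMap v) z)

/-- `X` is an anti-isodual rigid adelic space: it is similar to its conjugate dual. -/
def IsAntiIsodual (X : AdelicSpace K V) : Prop :=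
  X.IsRigid ∧ ∃ σ : V →ₗ[K] Conj K (Dual K V), X.IsSimilarity X.dual.conjugate σ

end AdelicSpace

end CM

/-! ### Forms

The form attached to a map `τ : V → Dual K V` is `b x y = τ x y`. -/

section Forms

variable {K} {V : Type*} [AddCommGroup V] [Module K V]

/-- The form `b_σ(x, y) = σ(x)(y)` of a linear map to the dual. -/
def form (σ : V →ₗ[K] Dual K V) (x y : V) : K := σ x y

/-- The sesquilinear form `b_σ(x, y) = σ(x)(y)` of a linear map to the conjugate dual. -/
def sesqForm [NumberField.IsCMField K] (σ : V →ₗ[K] Conj K (Dual K V)) (x y : V) : K :=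
  Conj.out K (Dual K V) (σ x) y

/-- `b` is symmetric (orthogonal type). -/
def IsOrthogonalForm (b : V → V → K) : Prop := ∀ x y, b x y = b y x

/-- `b` is alternating (symplectic type). -/
def IsSymplecticForm (b : V → V → K) : Prop := ∀ x, b x x = 0

/-- `b` is Hermitian (unitary type). -/
def IsUnitaryForm [NumberField.IsCMField K] (b : V → V → K) : Prop :=
  ∀ x y, b y x = conj K (b x y)

/-- `F` is totally isotropic: it is contained in its orthogonal. -/
def IsTotallyIsotropic (b : V → V → K) (F : Submodule K V) : Prop :=
  ∀ y ∈ F, ∀ x ∈ F, b x y = 0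

/-- `F` is coisotropic: it contains its orthogonal. -/
def IsCoisotropic (b : V → V → K) (F : Submodule K V) : Prop :=
  ∀ y, (∀ x ∈ F, b x y = 0) → y ∈ F

end Forms

end RigidAdelic

end

noncomputable section

namespace RigidAdelic

/-! Write `h(F) = log H(F)` for a subspace `F` of the ambient space. The height is multiplicative in
short exact sequences, and the natural isomorphism `F / (F ⊓ G) → (F ⊔ G) / G` does not increase
norms; hence `h` is submodular (`logHeight_submodular`). The Grayson–Stuhler filtration then
consists of the vertices of a convex polygon: the successive slopes `s i` increase strictly, and
whenever `t` separates the slopes before step `k` from those after it, `E k` is the only minimiser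
of `h(F) - t dim F` over all subspaces (`IsSlopeFiltration.lt_of_slopes`).

Let `p(F)` be the set of `x` such that `σ x` vanishes on `F`. It is an order-reversing bijection of
the lattice of subspaces. The map `σ` carries `p(F)` to the annihilator of `F`, scaling norms by
constants; this annihilator is isometric to the dual of the quotient by `F`; and dual spaces have
inverse heights. So `h(p(F)) = h(F) + α + β dim F` with `α` and `β` independent of `F`. Thus `p`
carries minimisers for the slope `t` to minimisers for the slope `-t - β`, hence permutes the flag,
and being order-reversing it must send `E (ℓ - i)` to `E i` (`IsSlopeFiltration.eq_of_duality`).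
This is the first assertion. Isotropy and coisotropy follow by comparing `E i` with `E (ℓ - i)`.

For the last two assertions, `σ` induces a map from `E j / E i` to the dual of `E (ℓ - i) / E (ℓ -
j)`. Duality exchanges restricted and quotient norms, so the induced map scales norms by the same
local factors as `σ` (`opNorm_subquotientMap`). The case `j = ℓ - i` gives the third assertion. For
the fourth, the induced maps in the two directions are crossed into one map from the product to its
dual; it is a similarity because their factors agree (`opNorm_crossMap`).

Two devices avoid duplication. `IsNormKind` lists what Euclidean, Hermitian and maximum norms have
in common, chiefly orthonormal bases adapted to a subspace, an attained duality inequality, and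
Hadamard's inequality; all local arguments use only these. `Twist` is a field automorphism with its
action on places and completions: a linear map to the conjugate dual is a semilinear map to the
dual, so the isodual and anti-isodual cases are the identity and the conjugation twists of one
argument. -/

/-- The Euclidean norm on real vectors. -/
def l2Norm {ι : Type} [Fintype ι] (x : ι → ℝ) : ℝ := √(∑ i, x i ^ 2)

/-- The supremum of a real vector. -/
def supNorm {ι : Type} [Fintype ι] (x : ι → ℝ) : ℝ := ⨆ i, x i

/-- The Euclidean combination of two numbers. -/
def l2Comb (a b : ℝ) : ℝ := √(a ^ 2 + b ^ 2)

/-- The coordinate norms `x ↦ ν (‖x i‖)_i` over `L` have the properties common to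
the Euclidean norm over `ℝ` and `ℂ` and the maximum norm over an ultrametric field. -/
structure IsNormKind (ν : ∀ (ι : Type) [Fintype ι], (ι → ℝ) → ℝ) (comb : ℝ → ℝ → ℝ)
    (L : Type*) [NormedField L] : Prop where
  reindex : ∀ {ι κ : Type} [Fintype ι] [Fintype κ] (e : ι ≃ κ) (x : κ → ℝ), ν _ (x ∘ e) = ν _ x
  mul : ∀ {ι : Type} [Fintype ι] (a : ℝ) (x : ι → ℝ), 0 ≤ a → ν _ (fun i => a * x i) = a * ν _ x
  nonneg : ∀ {ι : Type} [Fintype ι] (x : ι → ℝ), (∀ i, 0 ≤ x i) → 0 ≤ ν _ x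
  eq_zero : ∀ {ι : Type} [Fintype ι] (x : ι → ℝ), (∀ i, 0 ≤ x i) → ν _ x = 0 → x = 0
  single : ∀ {ι : Type} [Fintype ι] [DecidableEq ι] (i : ι), ν _ (Pi.single i (1 : ℝ)) = 1
  sum : ∀ {ι κ : Type} [Fintype ι] [Fintype κ] (x : ι → ℝ) (y : κ → ℝ),
    (∀ i, 0 ≤ x i) → (∀ i, 0 ≤ y i) → ν _ (Sum.elim x y) = comb (ν _ x) (ν _ y)
  comb_zero : ∀ a, 0 ≤ a → comb a 0 = a
  comb_comm : ∀ a b, comb a b = comb b a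
  le_comb : ∀ a b, 0 ≤ a → 0 ≤ b → a ≤ comb a b
  comb_mul : ∀ r a b, 0 ≤ r → comb (r * a) (r * b) = r * comb a b
  dual_le : ∀ {ι : Type} [Fintype ι] (φ x : ι → L),
    ‖∑ i, φ i * x i‖ ≤ ν _ (fun i => ‖φ i‖) * ν _ (fun i => ‖x i‖)
  dual_attained : ∀ {ι : Type} [Fintype ι] (φ : ι → L), φ ≠ 0 → ∃ x : ι → L, x ≠ 0 ∧
    ‖∑ i, φ i * x i‖ = ν _ (fun i => ‖φ i‖) * ν _ (fun i => ‖x i‖)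
  adapted : ∀ {n : ℕ} (W : Submodule L (Fin n → L)), ∃ (m k : ℕ)
    (e : Basis (Fin m ⊕ Fin k) L (Fin n → L)),
    (∀ x, ν _ (fun i => ‖x i‖) = ν _ (fun i => ‖e.repr x i‖)) ∧
      W = Submodule.span L (Set.range (e ∘ Sum.inl))
  hadamard : ∀ {n : ℕ} (A : Matrix (Fin n) (Fin n) L),
    ‖A.det‖ ≤ ∏ j, ν _ (fun i => ‖A i j‖)

/-! ### Maximum norms over ultrametric fields -/

section Ultra

variable {L : Type*} [NormedField L] [IsUltrametricDist L]

theorem le_supNorm {ι : Type} [Fintype ι] (x : ι → ℝ) (i : ι) : x i ≤ supNorm x :=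
  le_ciSup (Set.finite_range x).bddAbove i

theorem supNorm_nonneg {ι : Type} [Fintype ι] (x : ι → ℝ) (hx : ∀ i, 0 ≤ x i) : 0 ≤ supNorm x :=
  Real.iSup_nonneg hx

theorem supNorm_le {ι : Type} [Fintype ι] (x : ι → ℝ) {a : ℝ} (ha : 0 ≤ a) (h : ∀ i, x i ≤ a) :
    supNorm x ≤ a :=
  Real.iSup_le h ha

theorem exists_eq_supNorm {ι : Type} [Fintype ι] [Nonempty ι] (x : ι → ℝ) :
    ∃ i, x i = supNorm x :=
  exists_eq_ciSup_of_finite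

theorem norm_sum_le_of_ultrametric {ι : Type*} (s : Finset ι) (f : ι → L) {a : ℝ} (ha : 0 ≤ a)
    (h : ∀ i ∈ s, ‖f i‖ ≤ a) : ‖∑ i ∈ s, f i‖ ≤ a := by
  classical
  induction s using Finset.induction_on with
  | empty => simpa
  | insert i s hi ih =>
    rw [Finset.sum_insert hi]
    exact (IsUltrametricDist.norm_add_le_max _ _).trans
      (max_le (h _ (by simp)) (ih fun j hj => h j (by simp [hj])))

/-- Every term of the Leibniz expansion is bounded by the product of the column maxima, and an
ultrametric sum is no larger than its largest term. -/
theorem norm_det_le_of_ultrametric {n : ℕ} (A : Matrix (Fin n) (Fin n) L) :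
    ‖A.det‖ ≤ ∏ j, supNorm (fun i => ‖A i j‖) := by
  rw [Matrix.det_apply]
  have h0 : ∀ j, 0 ≤ supNorm (fun i => ‖A i j‖) := fun j =>
    supNorm_nonneg _ fun _ => norm_nonneg _
  refine norm_sum_le_of_ultrametric _ _ (Finset.prod_nonneg fun j _ => h0 j) fun σ _ => ?_
  have h1 : ‖∏ i, A (σ i) i‖ ≤ ∏ j, supNorm (fun i => ‖A i j‖) := by
    rw [norm_prod]
    exact Finset.prod_le_prod (fun _ _ => norm_nonneg _) fun j _ =>
      le_supNorm (fun i => ‖A i j‖) (σ j)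
  rcases Int.units_eq_one_or (Equiv.Perm.sign σ) with h2 | h2 <;> simpa [h2] using h1

/-- A basis whose change of coordinates to and from the standard one is integral. -/
theorem supNorm_repr_eq {ι : Type} [Fintype ι] {V : Type*} [AddCommGroup V] [Module L V]
    (b c : Basis ι L V) (h1 : ∀ i j, ‖b.repr (c j) i‖ ≤ 1)
    (h2 : ∀ i j, ‖c.repr (b j) i‖ ≤ 1) (x : V) :
    supNorm (fun i => ‖b.repr x i‖) = supNorm (fun i => ‖c.repr x i‖) := by
  have key : ∀ (b c : Basis ι L V), (∀ i j, ‖b.repr (c j) i‖ ≤ 1) →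
      supNorm (fun i => ‖b.repr x i‖) ≤ supNorm (fun i => ‖c.repr x i‖) := by
    intro b c h
    have h0 : 0 ≤ supNorm (fun i => ‖c.repr x i‖) := supNorm_nonneg _ fun _ => norm_nonneg _
    refine supNorm_le _ h0 fun i => ?_
    conv_lhs => rw [← c.sum_repr x]
    simp only [map_sum, map_smul, Finsupp.coe_finsetSum, Finset.sum_apply, Finsupp.smul_apply,
      smul_eq_mul]
    refine norm_sum_le_of_ultrametric _ _ h0 fun j _ => ?_
    rw [norm_mul]
    calc _ ≤ ‖c.repr x j‖ * 1 := by gcongr; exact h i j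
      _ ≤ _ := by rw [mul_one]; exact le_supNorm (fun i => ‖c.repr x i‖) j
  exact le_antisymm (key b c h1) (key c b h2)

/-- Gaussian elimination with pivots of maximal absolute value. -/
theorem exists_adapted_of_ultrametric {n : ℕ} (W : Submodule L (Fin n → L)) (d : ℕ) :
    ∀ (e : Basis (Fin n) L (Fin n → L)) (S : Finset (Fin n)), n - S.card = d →
    (∀ x : Fin n → L, supNorm (fun i => ‖x i‖) = supNorm (fun i => ‖e.repr x i‖)) →
    (∀ i ∈ S, e i ∈ W) →
    ∃ (e' : Basis (Fin n) L (Fin n → L)) (S' : Finset (Fin n)),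
      (∀ x : Fin n → L, supNorm (fun i => ‖x i‖) = supNorm (fun i => ‖e'.repr x i‖)) ∧
      W = Submodule.span L (e' '' S') := by
  induction d using Nat.strong_induction_on with
  | _ d ih =>
  intro e S hd he hS
  by_cases hW : W ≤ Submodule.span L (e '' S)
  · refine ⟨e, S, he, le_antisymm hW (Submodule.span_le.2 ?_)⟩
    rintro _ ⟨i, hi, rfl⟩
    exact hS i hi
  obtain ⟨w, hw, hwS⟩ := SetLike.not_le_iff_exists.1 hW
  -- the component of `w` outside `S`
  set u : Fin n → L := w - ∑ i ∈ S, e.repr w i • e i with hu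
  have huW : u ∈ W := W.sub_mem hw (W.sum_mem fun i hi => W.smul_mem _ (hS i hi))
  have hu0 : u ≠ 0 := by
    intro h0
    apply hwS
    rw [sub_eq_zero.1 h0]
    exact Submodule.sum_mem _ fun i hi => Submodule.smul_mem _ _
      (Submodule.subset_span ⟨i, hi, rfl⟩)
  have hcoord : ∀ i ∈ S, e.repr u i = 0 := by
    intro i hi
    simp [hu, Finsupp.single_apply, hi]
  have : Nonempty (Fin n) := by
    by_contra hne
    rw [not_nonempty_iff] at hne
    exact hu0 (Subsingleton.elim _ _)
  -- Choosing the largest coordinate as pivot makes all coordinates of the normalised vector `w'` at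
  -- most `1` in absolute value.
  obtain ⟨p, hp⟩ := exists_eq_supNorm (fun i => ‖e.repr u i‖)
  have hp0 : e.repr u p ≠ 0 := by
    intro h0
    apply hu0
    rw [← e.repr.map_eq_zero_iff]
    ext i
    have := le_supNorm (fun i => ‖e.repr u i‖) i
    simp only [← hp, h0, norm_zero, norm_le_zero_iff] at this
    simpa using this
  have hpS : p ∉ S := fun h => hp0 (hcoord p h)
  set w' : Fin n → L := (e.repr u p)⁻¹ • u with hw'
  have hw'W : w' ∈ W := W.smul_mem _ huW
  have hw'p : e.repr w' p = 1 := by simp [hw', hp0]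
  have hw'le : ∀ i, ‖e.repr w' i‖ ≤ 1 := by
    intro i
    have h1 := le_supNorm (fun i => ‖e.repr u i‖) i
    rw [← hp] at h1
    simp only [hw', map_smul, Finsupp.smul_apply, smul_eq_mul, norm_mul, norm_inv]
    rw [inv_mul_le_iff₀ (norm_pos_iff.2 hp0), mul_one]
    exact h1
  -- The transvection `T` replaces `e p` by `w'` and fixes the other basis vectors. Both `T` and its
  -- inverse have integral matrices, so the new basis is again orthonormal.
  have hf : e.coord p (w' - e p) = 0 := by simp [hw'p]
  let T := LinearEquiv.transvection hf
  have hT : ∀ x, T x = x + e.repr x p • (w' - e p) := fun x => by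
    simp [T, LinearEquiv.transvection, LinearMap.transvection]
  have hTs : ∀ x, T.symm x = x - e.repr x p • (w' - e p) := by
    intro x
    rw [LinearEquiv.symm_apply_eq, hT]
    simp [hw'p]
  have hTp : T (e p) = w' := by simp [hT]
  have hTi : ∀ i, i ≠ p → T (e i) = e i := fun i hi => by simp [hT, hi]
  have hent : ∀ j i, ‖e.repr (T (e j)) i‖ ≤ 1 := by
    intro j i
    by_cases hj : j = p
    · subst hj; rw [hTp]; exact hw'le i
    · rw [hTi j hj, e.repr_self, Finsupp.single_apply]; split_ifs <;> simp
  have hent' : ∀ j i, ‖e.repr (T.symm (e j)) i‖ ≤ 1 := by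
    intro j i
    by_cases hj : j = p
    · subst hj
      -- Here `j` is the pivot, where `w'` has coordinate `1`: the pivot coordinate is `2 - 1 = 1`
      -- and the others are those of `-w'`.
      have : T.symm (e j) = (2 : L) • e j - w' := by
        rw [hTs]; simp [two_smul]; abel
      by_cases hij : i = j
      · subst hij; rw [this]; simp [hw'p]; norm_num
      · rw [this]; simpa [Finsupp.single_apply, Ne.symm hij] using hw'le i
    · have : T.symm (e j) = e j := by rw [hTs]; simp [hj]
      rw [this, e.repr_self, Finsupp.single_apply]; split_ifs <;> simp
  refine ih (n - (insert p S).card) ?_ (e.map T) (insert p S) rfl ?_ ?_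
  · have h1 := Finset.card_insert_of_notMem hpS
    have h2 : (insert p S).card ≤ n := by simpa using Finset.card_le_univ (insert p S)
    omega
  · intro x
    rw [he x]
    refine supNorm_repr_eq _ _ (fun i j => ?_) (fun i j => ?_) x
    · simpa using hent j i
    · simpa using hent' j i
  · intro i hi
    rw [Basis.map_apply]
    by_cases h : i = p
    · subst h; rwa [hTp]
    · rw [hTi i h]; exact hS i ((Finset.mem_insert.1 hi).resolve_left h)

theorem isNormKind_sup : IsNormKind @supNorm max L where
  reindex e x := e.surjective.iSup_comp x
  mul a x ha := (Real.mul_iSup_of_nonneg ha x).symm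
  nonneg := supNorm_nonneg
  eq_zero x hx h := by
    ext i
    exact le_antisymm ((le_supNorm x i).trans_eq h) (hx i)
  single i := by
    refine le_antisymm (supNorm_le _ zero_le_one fun j => ?_) ?_
    · rw [Pi.single_apply]; split_ifs <;> simp
    · simpa using le_supNorm (Pi.single i (1 : ℝ)) i
  sum x y hx hy := by
    have h0 : 0 ≤ max (supNorm x) (supNorm y) := le_max_of_le_left (supNorm_nonneg _ hx)
    have h1 : ∀ i, 0 ≤ Sum.elim x y i := by rintro (i | i); exacts [hx i, hy i]
    refine le_antisymm (supNorm_le _ h0 ?_) (max_le ?_ ?_)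
    · rintro (i | i)
      · exact le_max_of_le_left (le_supNorm x i)
      · exact le_max_of_le_right (le_supNorm y i)
    · exact supNorm_le _ (supNorm_nonneg _ h1) fun i => le_supNorm (Sum.elim x y) (Sum.inl i)
    · exact supNorm_le _ (supNorm_nonneg _ h1) fun i => le_supNorm (Sum.elim x y) (Sum.inr i)
  comb_zero a ha := max_eq_left ha
  comb_comm := max_comm
  le_comb a b _ _ := le_max_left a b
  comb_mul r a b hr := (mul_max_of_nonneg a b hr).symm
  dual_le φ x := by
    have h1 := supNorm_nonneg (fun i => ‖φ i‖) fun _ => norm_nonneg _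
    have h2 := supNorm_nonneg (fun i => ‖x i‖) fun _ => norm_nonneg _
    refine norm_sum_le_of_ultrametric _ _ (mul_nonneg h1 h2) fun i _ => ?_
    rw [norm_mul]
    exact mul_le_mul (le_supNorm (fun i => ‖φ i‖) i) (le_supNorm (fun i => ‖x i‖) i)
      (norm_nonneg _) h1
  dual_attained {ι} _ φ hφ := by
    classical
    obtain ⟨j, -⟩ := Function.ne_iff.1 hφ
    have : Nonempty ι := ⟨j⟩
    obtain ⟨p, hp⟩ := exists_eq_supNorm (fun i => ‖φ i‖)
    -- The unit vector at the largest coefficient of `φ` attains the bound.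
    refine ⟨Pi.single p 1, by simp, ?_⟩
    have h1 : supNorm (fun i => ‖(Pi.single p (1 : L) : ι → L) i‖) = 1 := by
      refine le_antisymm (supNorm_le _ zero_le_one fun j => ?_) ?_
      · rw [Pi.single_apply]; split_ifs <;> simp
      · simpa using le_supNorm (fun i => ‖(Pi.single p (1 : L) : ι → L) i‖) p
    rw [h1, mul_one, ← hp]
    simp [Pi.single_apply]
  adapted {n} W := by
    obtain ⟨e, S, he, hS⟩ := exists_adapted_of_ultrametric W _ (Pi.basisFun L (Fin n)) ∅ rfl
      (by simp) (by simp)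
    let f : Fin S.card ⊕ Fin Sᶜ.card ≃ Fin n :=
      (Equiv.sumCongr S.equivFin.symm (Sᶜ.equivFin.symm.trans
        (Equiv.subtypeEquivRight fun i => by simp))).trans (Equiv.sumCompl (· ∈ S))
    refine ⟨S.card, Sᶜ.card, e.reindex f.symm, fun x => ?_, ?_⟩
    · rw [he x]
      have : (fun i => ‖(e.reindex f.symm).repr x i‖) = (fun i => ‖e.repr x i‖) ∘ f := by
        ext i; simp
      rw [this]
      exact (f.surjective.iSup_comp _).symm
    · rw [hS]
      congr 1
      ext y
      constructor
      · rintro ⟨i, hi, rfl⟩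
        exact ⟨S.equivFin ⟨i, hi⟩, by simp [f]⟩
      · rintro ⟨i, rfl⟩
        exact ⟨S.equivFin.symm i, by simp, by simp [f]⟩
  hadamard A := norm_det_le_of_ultrametric A

end Ultra

/-! ### Euclidean and Hermitian norms at the infinite places -/

section Arch

theorem l2Norm_norm_eq {𝕜 : Type*} [RCLike 𝕜] {ι : Type} [Fintype ι] (x : ι → 𝕜) :
    l2Norm (fun i => ‖x i‖) = ‖(WithLp.toLp 2 x : EuclideanSpace 𝕜 ι)‖ :=
  (EuclideanSpace.norm_eq _).symm

theorem l2Norm_sq {ι : Type} [Fintype ι] (x : ι → ℝ) : l2Norm x ^ 2 = ∑ i, x i ^ 2 :=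
  Real.sq_sqrt (Finset.sum_nonneg fun i _ => sq_nonneg (x i))

theorem isNormKind_l2 (𝕜 : Type*) [RCLike 𝕜] : IsNormKind @l2Norm l2Comb 𝕜 where
  reindex e x := by simp only [l2Norm, Function.comp]; rw [e.sum_comp (fun i => x i ^ 2)]
  mul a x ha := by
    simp only [l2Norm, mul_pow, ← Finset.mul_sum]
    rw [Real.sqrt_mul (sq_nonneg a), Real.sqrt_sq ha]
  nonneg x _ := Real.sqrt_nonneg _
  eq_zero {ι} _ x hx h := by
    rw [l2Norm, Real.sqrt_eq_zero (Finset.sum_nonneg fun i _ => sq_nonneg (x i)),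
      Finset.sum_eq_zero_iff_of_nonneg fun i _ => sq_nonneg (x i)] at h
    ext i
    simpa using h i (Finset.mem_univ i)
  single i := by simp [l2Norm, Pi.single_apply, ite_pow]
  sum x y _ _ := by
    simp only [l2Comb, l2Norm_sq]
    simp [l2Norm, Fintype.sum_sum_type]
  comb_zero a ha := by simp [l2Comb, Real.sqrt_sq ha]
  comb_comm a b := by simp [l2Comb, add_comm]
  le_comb a b _ _ := Real.le_sqrt_of_sq_le (by nlinarith [sq_nonneg b])
  comb_mul r a b hr := by
    simp only [l2Comb, mul_pow, ← mul_add]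
    rw [Real.sqrt_mul (sq_nonneg r), Real.sqrt_sq hr]
  dual_le {ι} _ φ x := by
    have h := norm_inner_le_norm (𝕜 := 𝕜) (WithLp.toLp 2 (star φ) : EuclideanSpace 𝕜 ι)
      (WithLp.toLp 2 x)
    rw [← l2Norm_norm_eq, ← l2Norm_norm_eq] at h
    simpa [PiLp.inner_apply, mul_comm] using h
  dual_attained {ι} _ φ hφ := by
    -- The equality case of Cauchy–Schwarz.
    refine ⟨star φ, by simpa using hφ, ?_⟩
    have h1 : ∀ i, φ i * star φ i = ((‖φ i‖ ^ 2 : ℝ) : 𝕜) := fun i => by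
      simp [RCLike.mul_conj]
    rw [Finset.sum_congr rfl fun i _ => h1 i, ← RCLike.ofReal_sum, RCLike.norm_ofReal,
      abs_of_nonneg]
    · simp only [Pi.star_apply, norm_star]
      rw [← sq, l2Norm_sq]
    exact Finset.sum_nonneg fun i _ => sq_nonneg _
  adapted {n} W := by
    let F := WithLp.linearEquiv 2 𝕜 (Fin n → 𝕜)
    let W' : Submodule 𝕜 (EuclideanSpace 𝕜 (Fin n)) := W.comap F.toLinearMap
    let a := stdOrthonormalBasis 𝕜 W'
    let b := stdOrthonormalBasis 𝕜 W'ᗮ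
    let f : Fin (finrank 𝕜 W') ⊕ Fin (finrank 𝕜 W'ᗮ) → EuclideanSpace 𝕜 (Fin n) :=
      Sum.elim (fun i => a i) (fun i => b i)
    have hf : Orthonormal 𝕜 f := by
      rw [orthonormal_iff_ite]
      rintro (i | i) (j | j)
      · simpa [f] using orthonormal_iff_ite.1 a.orthonormal i j
      · simpa [f] using W'.inner_right_of_mem_orthogonal (a i).2 (b j).2
      · simpa [f] using W'.inner_left_of_mem_orthogonal (a j).2 (b i).2
      · simpa [f] using orthonormal_iff_ite.1 b.orthonormal i j
    have hsp : ⊤ ≤ Submodule.span 𝕜 (Set.range f) := by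
      have hc : finrank 𝕜 (EuclideanSpace 𝕜 (Fin n)) =
          Fintype.card (Fin (finrank 𝕜 W') ⊕ Fin (finrank 𝕜 W'ᗮ)) := by
        simp only [Fintype.card_sum, Fintype.card_fin]
        exact (W'.finrank_add_finrank_orthogonal).symm
      exact (hf.linearIndependent.span_eq_top_of_card_eq_finrank' hc.symm).ge
    let B := OrthonormalBasis.mk hf hsp
    refine ⟨_, _, B.toBasis.map F, fun x => ?_, ?_⟩
    · rw [l2Norm_norm_eq, ← B.repr.norm_map, EuclideanSpace.norm_eq]
      rfl
    · have h1 : Set.range ((B.toBasis.map F) ∘ Sum.inl) =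
          (F.toLinearMap ∘ₗ W'.subtype) '' Set.range a := by
        rw [← Set.range_comp]
        congr 1
        ext i
        simp [B, f]
      rw [h1, Submodule.span_image, ← a.coe_toBasis, a.toBasis.span_eq, Submodule.map_top,
        LinearMap.range_comp, Submodule.range_subtype, Submodule.map_comap_eq_of_surjective]
      exact F.surjective
  hadamard {n} A := by
    let F : Fin n → EuclideanSpace 𝕜 (Fin n) := fun j => WithLp.toLp 2 (fun i => A i j)
    let b := InnerProductSpace.gramSchmidtOrthonormalBasis (𝕜 := 𝕜) (by simp) F
    let s := EuclideanSpace.basisFun (Fin n) 𝕜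
    -- In the Gram–Schmidt basis the columns form a triangular matrix, so the determinant is a
    -- product of inner products of each column with a unit vector. Passing between orthonormal
    -- bases does not change its absolute value.
    have h1 := InnerProductSpace.gramSchmidtOrthonormalBasis_det (𝕜 := 𝕜)
      (finrank_euclideanSpace (𝕜 := 𝕜) (ι := Fin n)) F
    have h2 : s.toBasis.det F = A.det := by
      rw [Basis.det_apply]
      congr 1
    have h3 : ‖s.toBasis.det F‖ = ‖b.toBasis.det F‖ := by
      have h4 := congrArg (fun g => ‖g F‖) (s.toBasis.det.eq_smul_basis_det b.toBasis)
      simp only [AlternatingMap.smul_apply, norm_smul] at h4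
      rw [h4]
      have h5 : ‖s.toBasis.det b.toBasis‖ = 1 := by
        exact s.det_to_matrix_orthonormalBasis b
      rw [h5, one_mul]
    rw [← h2, h3, h1, norm_prod]
    refine Finset.prod_le_prod (fun _ _ => norm_nonneg _) fun i _ => ?_
    refine (norm_inner_le_norm _ _).trans ?_
    rw [OrthonormalBasis.norm_eq_one, one_mul]
    exact (l2Norm_norm_eq (fun k => A k i)).ge

/-- The structure of `RCLike` on a normed field isometric to `ℝ` or `ℂ`. -/
@[reducible] def rclikeOfEquiv {L 𝕜 : Type*} [NormedField L] [RCLike 𝕜] (f : L ≃+* 𝕜)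
    (hf : ∀ x, ‖f x‖ = ‖x‖) : RCLike L where
  __ := ‹NormedField L›
  lt_norm_lt x y hx hxy := by
    obtain ⟨a, ha⟩ := DenselyNormedField.lt_norm_lt (α := 𝕜) x y hx hxy
    exact ⟨f.symm a, by rw [← hf, f.apply_symm_apply]; exact ha⟩
  star x := f.symm (star (f x))
  star_involutive x := by simp
  star_mul x y := by simp [mul_comm]
  star_add x y := by simp
  smul r x := f.symm (r • f x)
  algebraMap := f.symm.toRingHom.comp (algebraMap ℝ 𝕜)
  commutes' r x := mul_comm _ _
  smul_def' r x := by
    change f.symm _ = _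
    simp [Algebra.smul_def]
  norm_smul_le r x := by
    change ‖f.symm (r • f x)‖ ≤ _
    rw [← hf, f.apply_symm_apply, norm_smul, hf]
  complete := by
    have : Isometry f := AddMonoidHomClass.isometry_of_norm f hf
    have h : CompleteSpace L :=
      (IsometryEquiv.mk f.toEquiv this).completeSpace_iff.2 inferInstance
    intro l hl
    exact h.complete hl
  re := (RCLike.re : 𝕜 →+ ℝ).comp f.toAddMonoidHom
  im := (RCLike.im : 𝕜 →+ ℝ).comp f.toAddMonoidHom
  I := f.symm RCLike.I
  I_re_ax := by simp
  I_mul_I_ax := by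
    rcases RCLike.I_mul_I_ax (K := 𝕜) with h | h
    · left; simp [h]
    · right; rw [← map_mul, h]; simp
  re_add_im_ax z := by
    apply f.injective
    simp
  ofReal_re_ax r := by
    change RCLike.re (f (f.symm _)) = r
    rw [f.apply_symm_apply]; exact RCLike.ofReal_re_ax r
  ofReal_im_ax r := by
    change RCLike.im (f (f.symm _)) = 0
    rw [f.apply_symm_apply]; exact RCLike.ofReal_im_ax r
  mul_re_ax z w := by simp
  mul_im_ax z w := by simp
  conj_re_ax z := by
    change RCLike.re (f (f.symm _)) = _
    simp
  conj_im_ax z := by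
    change RCLike.im (f (f.symm _)) = _
    simp
  conj_I_ax := by
    change f.symm (star (f (f.symm _))) = _
    simp
  norm_sq_eq_def_ax z := by
    rw [← hf]; exact RCLike.norm_sq_eq_def_ax (f z)
  mul_im_I_ax z := by
    change RCLike.im (f z) * RCLike.im (f (f.symm _)) = _
    rw [f.apply_symm_apply]; exact RCLike.mul_im_I_ax (f z)
  toPartialOrder := @PartialOrder.lift L 𝕜 RCLike.toPartialOrder f f.injective
  le_iff_re_im := RCLike.le_iff_re_im (K := 𝕜)
  toDecidableEq := Classical.decEq _

/-- The completion is isometric to `ℝ` or `ℂ`. The transported `RCLike` structure keeps the given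
normed field structure, so the conclusion concerns the original absolute value. -/
theorem isNormKind_inf {K : Type*} [Field K] (v : NumberField.InfinitePlace K) :
    IsNormKind @l2Norm l2Comb v.Completion := by
  rcases v.isReal_or_isComplex with h | h
  · let _ := rclikeOfEquiv (NumberField.InfinitePlace.Completion.ringEquivRealOfIsReal h) fun x =>
      (AddMonoidHomClass.isometry_iff_norm _).1
        (NumberField.InfinitePlace.Completion.isometry_extensionEmbeddingOfIsReal h) x
    exact isNormKind_l2 v.Completion
  · let _ := rclikeOfEquiv (NumberField.InfinitePlace.Completion.ringEquivComplexOfIsComplex h)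
      fun x => (AddMonoidHomClass.isometry_iff_norm _).1
        (NumberField.InfinitePlace.Completion.isometry_extensionEmbedding v) x
    exact isNormKind_l2 v.Completion

theorem isNormKind_fin {K : Type*} [Field K] [NumberField K] (v : HeightOneSpectrum (𝓞 K)) :
    IsNormKind @supNorm max (v.adicCompletion K) :=
  isNormKind_sup

end Arch

/-! ### Orthonormal bases of subspaces, quotients and duals -/

section NormTheory

variable {ν : ∀ (ι : Type) [Fintype ι], (ι → ℝ) → ℝ} {comb : ℝ → ℝ → ℝ}
variable {L : Type*} [NormedField L]
variable {M₁ M M₂ : Type*} [AddCommGroup M₁] [Module L M₁] [AddCommGroup M] [Module L M]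
  [AddCommGroup M₂] [Module L M₂]
variable {ι κ : Type} [Fintype ι] [Fintype κ]

/-- `e` is an orthonormal basis for the norm `N`, with respect to the coordinate norms `ν`. -/
def IsON (ν : ∀ (ι : Type) [Fintype ι], (ι → ℝ) → ℝ) (N : M → ℝ) (e : Basis ι L M) : Prop :=
  ∀ x, N x = ν _ (fun i => ‖e.repr x i‖)

/-- The norm on the target of a surjection `π` given by infima over fibres. -/
def fibreNorm (N : M → ℝ) (π : M → M₂) (y : M₂) : ℝ := sInf {r : ℝ | ∃ x, π x = y ∧ N x = r}

/-- The operator norm of a linear form. -/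
def opNorm (N : M → ℝ) (φ : Dual L M) : ℝ := ⨆ x, ‖φ x‖ / N x

/-- A short exact sequence. -/
structure IsShortExact {R A B C : Type*} [Ring R] [AddCommGroup A] [Module R A] [AddCommGroup B]
    [Module R B] [AddCommGroup C] [Module R C] (i : A →ₗ[R] B) (π : B →ₗ[R] C) : Prop where
  inj : Function.Injective i
  surj : Function.Surjective π
  exact : Function.Exact i π

/-- Bases of the terms of a short exact sequence that are compatible with the maps. -/
structure ExactBases {R A B C : Type*} [Ring R] [AddCommGroup A] [Module R A] [AddCommGroup B]
    [Module R B] [AddCommGroup C] [Module R C] (i : A →ₗ[R] B) (π : B →ₗ[R] C)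
    {ι κ : Type*} (e₁ : Basis ι R A) (e : Basis (ι ⊕ κ) R B) (e₂ : Basis κ R C) : Prop where
  inl : ∀ a, e (Sum.inl a) = i (e₁ a)
  inr : ∀ c, π (e (Sum.inr c)) = e₂ c
  comp : ∀ x, π (i x) = 0

section Existence

variable {R A B C : Type*} [Ring R] [AddCommGroup A] [Module R A] [AddCommGroup B]
    [Module R B] [AddCommGroup C] [Module R C] {i : A →ₗ[R] B} {π : B →ₗ[R] C}
    {ι κ : Type*}

/-- The first block of `e` spans the image of `i`, which is the kernel of `π`. It therefore pulls
back to a basis of the left term, while the second block stays independent modulo the kernel and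
maps to a basis of the right term. -/
theorem IsShortExact.exists_bases (h : IsShortExact i π) (e : Basis (ι ⊕ κ) R B)
    (he : LinearMap.range i = Submodule.span R (Set.range (e ∘ Sum.inl))) :
    ∃ (e₁ : Basis ι R A) (e₂ : Basis κ R C), ExactBases i π e₁ e e₂ := by
  have hmem : ∀ a, ∃ y, i y = e (Sum.inl a) := fun a => by
    have : e (Sum.inl a) ∈ LinearMap.range i := he ▸ Submodule.subset_span ⟨a, rfl⟩
    exact this
  choose y hy using hmem
  have hiy : i ∘ y = e ∘ Sum.inl := funext hy
  have hker : LinearMap.ker π = Submodule.span R (Set.range (e ∘ Sum.inl)) := by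
    rw [← he]; exact LinearMap.exact_iff.1 h.exact
  have hli := e.linearIndependent
  have hdisj := (linearIndependent_sum.1 hli).2.2
  have h1 : LinearIndependent R y := by
    apply LinearIndependent.of_comp i
    rw [hiy]
    exact (linearIndependent_sum.1 hli).1
  have h2 : ⊤ ≤ Submodule.span R (Set.range y) := by
    intro x _
    have : i x ∈ (Submodule.span R (Set.range y)).map i := by
      rw [← Submodule.span_image, ← Set.range_comp, hiy, ← he]
      exact ⟨x, rfl⟩
    obtain ⟨z, hz, hzx⟩ := this
    rwa [← h.inj hzx]
  have h3 : LinearIndependent R (π ∘ (e ∘ Sum.inr)) := by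
    apply (linearIndependent_sum.1 hli).2.1.map
    rw [hker]
    exact hdisj.symm
  have h4 : ⊤ ≤ Submodule.span R (Set.range (π ∘ (e ∘ Sum.inr))) := by
    have h5 : (Submodule.span R (Set.range e)).map π = ⊤ := by
      rw [e.span_eq, Submodule.map_top, LinearMap.range_eq_top.2 h.surj]
    rw [← h5, Submodule.map_span, Submodule.span_le]
    rintro _ ⟨_, ⟨a | c, rfl⟩, rfl⟩
    · have : π (e (Sum.inl a)) = 0 := by rw [← hy]; exact h.exact.apply_apply_eq_zero _
      rw [this]; exact Submodule.zero_mem _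
    · exact Submodule.subset_span ⟨c, rfl⟩
  refine ⟨Basis.mk h1 h2, Basis.mk h3 h4, ⟨fun a => ?_, fun c => ?_, fun x => ?_⟩⟩
  · simp [hy]
  · simp
  · exact h.exact.apply_apply_eq_zero _

variable {e₁ : Basis ι R A} {e : Basis (ι ⊕ κ) R B} {e₂ : Basis κ R C}

theorem ExactBases.repr_left (H : ExactBases i π e₁ e e₂) (x : A) :
    e.repr (i x) = (Finsupp.sumFinsuppEquivProdFinsupp.symm (e₁.repr x, 0)) := by
  have : (e.repr.toLinearMap ∘ₗ i) = (Finsupp.lmapDomain R R Sum.inl) ∘ₗ e₁.repr.toLinearMap := by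
    apply e₁.ext
    intro a
    simp [← H.inl]
  have h := LinearMap.congr_fun this x
  simp only [LinearMap.comp_apply, LinearEquiv.coe_coe, Finsupp.lmapDomain_apply] at h
  rw [h]
  ext (a | c)
  · simp [Finsupp.mapDomain_apply Sum.inl_injective]
  · rw [Finsupp.mapDomain_of_notMem_range]
    · simp
    · simp

theorem ExactBases.repr_inl (H : ExactBases i π e₁ e e₂) (x : A) (a : ι) :
    e.repr (i x) (Sum.inl a) = e₁.repr x a := by
  rw [H.repr_left]; simp

theorem ExactBases.repr_inr (H : ExactBases i π e₁ e e₂) (x : A) (c : κ) :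
    e.repr (i x) (Sum.inr c) = 0 := by
  rw [H.repr_left]; simp

theorem ExactBases.repr_right (H : ExactBases i π e₁ e e₂) (x : B) (c : κ) :
    e₂.repr (π x) c = e.repr x (Sum.inr c) := by
  have : (Finsupp.lapply c) ∘ₗ e₂.repr.toLinearMap ∘ₗ π =
      (Finsupp.lapply (Sum.inr c)) ∘ₗ e.repr.toLinearMap := by
    apply e.ext
    rintro (a | d)
    · simp [H.inl, H.comp, H.repr_inr]
    · classical simp [H.inr, Finsupp.single_apply]
  exact LinearMap.congr_fun this x

end Existence

/-- The change of basis in the middle is block triangular, with the outer changes of basis as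
diagonal blocks. -/
theorem ExactBases.det_eq {R A B C : Type*} [CommRing R] [AddCommGroup A] [Module R A]
    [AddCommGroup B] [Module R B] [AddCommGroup C] [Module R C] {i : A →ₗ[R] B} {π : B →ₗ[R] C}
    [DecidableEq ι] [DecidableEq κ]
    {e₁ b₁ : Basis ι R A} {e b : Basis (ι ⊕ κ) R B} {e₂ b₂ : Basis κ R C}
    (H : ExactBases i π e₁ e e₂) (H' : ExactBases i π b₁ b b₂) :
    e.det b = e₁.det b₁ * e₂.det b₂ := by
  simp only [Basis.det_apply]
  rw [← Matrix.det_fromBlocks_zero₂₁ (e₁.toMatrix b₁)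
    (fun a c => e.repr (b (Sum.inr c)) (Sum.inl a)) (e₂.toMatrix b₂)]
  congr 1
  ext (a | c) (a' | c')
  · simp [Basis.toMatrix_apply, H'.inl, H.repr_inl, Matrix.fromBlocks]
  · simp [Basis.toMatrix_apply, Matrix.fromBlocks]
  · simp [Basis.toMatrix_apply, H'.inl, H.repr_inr, Matrix.fromBlocks]
  · simp [Basis.toMatrix_apply, ← H'.inr, H.repr_right, Matrix.fromBlocks]

/-- Dual bases change by the transpose of the inverse matrix. -/
theorem Basis.det_dualBasis_mul_det {R A : Type*} [CommRing R] [AddCommGroup A] [Module R A]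
    [DecidableEq ι] (e b : Basis ι R A) : e.dualBasis.det b.dualBasis * e.det b = 1 := by
  have h : e.dualBasis.toMatrix b.dualBasis = (b.toMatrix e).transpose := by
    ext i j
    simp [Basis.toMatrix_apply, Matrix.transpose_apply]
  rw [Basis.det_apply, Basis.det_apply, h, Matrix.det_transpose, ← Matrix.det_mul,
    Basis.toMatrix_mul_toMatrix_flip, Matrix.det_one]

namespace IsON

variable {N : M → ℝ} {e : Basis ι L M}

theorem nonneg (h : IsNormKind ν comb L) (he : IsON ν N e) (x : M) : 0 ≤ N x := by
  rw [he]; exact h.nonneg _ fun _ => norm_nonneg _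

theorem eq_zero (h : IsNormKind ν comb L) (he : IsON ν N e) {x : M} (hx : N x = 0) : x = 0 := by
  rw [he] at hx
  have := h.eq_zero _ (fun _ => norm_nonneg _) hx
  rw [← e.repr.map_eq_zero_iff]
  ext i
  simpa using congrFun this i

theorem self (h : IsNormKind ν comb L) (he : IsON ν N e) (i : ι) : N (e i) = 1 := by
  classical
  rw [he, ← h.single i]
  congr 1
  ext j
  simp only [Basis.repr_self, Finsupp.single_apply, Pi.single_apply, eq_comm]
  split_ifs <;> simp

theorem smul (h : IsNormKind ν comb L) (he : IsON ν N e) (a : L) (x : M) :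
    N (a • x) = ‖a‖ * N x := by
  rw [he, he, ← h.mul _ _ (norm_nonneg a)]
  simp

theorem reindex (h : IsNormKind ν comb L) (he : IsON ν N e) (f : ι ≃ κ) :
    IsON ν N (e.reindex f) := by
  intro x
  rw [he, ← h.reindex f.symm]
  congr 1

theorem ext {N' : M → ℝ} (he : IsON ν N e) (he' : IsON ν N' e) : N = N' :=
  funext fun x => (he x).trans (he' x).symm

/-- In coordinates the upper bound is `IsNormKind.dual_le`, and it is attained by the vector from
`IsNormKind.dual_attained`; the zero form is treated separately. -/
theorem opNorm (h : IsNormKind ν comb L) [DecidableEq ι] (he : IsON ν N e) :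
    IsON ν (opNorm N) e.dualBasis := by
  intro φ
  have hφ : ∀ x, φ x = ∑ i, φ (e i) * e.repr x i := fun x => by
    conv_lhs => rw [← e.sum_repr x]
    rw [map_sum]
    simp [mul_comm]
  have hr : (fun i => ‖e.dualBasis.repr φ i‖) = fun i => ‖φ (e i)‖ := by ext i; simp
  have hle : ∀ x, ‖φ x‖ / N x ≤ ν _ (fun i => ‖φ (e i)‖) := fun x => by
    refine div_le_of_le_mul₀ (he.nonneg h x) (h.nonneg _ fun _ => norm_nonneg _) ?_
    rw [hφ, he]
    exact h.dual_le _ _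
  rw [hr]
  refine le_antisymm (ciSup_le hle) ?_
  by_cases h0 : (fun i => φ (e i)) = 0
  · have : φ = 0 := e.ext fun i => congrFun h0 i
    subst this
    have h1 : ν _ (fun _ : ι => (0 : ℝ)) = 0 := by
      simpa using h.mul 0 (fun _ : ι => (0 : ℝ)) le_rfl
    simp only [LinearMap.zero_apply, norm_zero, h1]
    exact Real.iSup_nonneg fun x => by simp
  · obtain ⟨x, hx, hx'⟩ := h.dual_attained _ h0
    let z := e.equivFun.symm x
    have hz : ∀ i, e.repr z i = x i := fun i => by
      rw [← Basis.equivFun_apply, LinearEquiv.apply_symm_apply]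
    have hz0 : N z ≠ 0 := fun h1 => by
      have := he.eq_zero h h1
      exact hx (by simpa only [z, LinearEquiv.map_eq_zero_iff] using this)
    have : ‖φ z‖ / N z = ν _ (fun i => ‖φ (e i)‖) := by
      rw [div_eq_iff hz0, hφ, he]
      simp only [hz]
      exact hx'
    rw [← this]
    exact le_ciSup (f := fun x => ‖φ x‖ / N x)
      ⟨_, Set.forall_mem_range.2 hle⟩ z

variable {i : M₁ →ₗ[L] M} {π : M →ₗ[L] M₂}
  {e₁ : Basis ι L M₁} {b : Basis (ι ⊕ κ) L M} {e₂ : Basis κ L M₂}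

theorem left (h : IsNormKind ν comb L) (H : ExactBases i π e₁ b e₂) (hb : IsON ν N b) :
    IsON ν (fun x => N (i x)) e₁ := by
  intro x
  simp only [hb (i x)]
  have h0 : 0 ≤ ν _ (fun a => ‖e₁.repr x a‖) := h.nonneg _ fun _ => norm_nonneg _
  have h1 : ν _ (fun _ : κ => (0 : ℝ)) = 0 := by
    simpa using h.mul 0 (fun _ : κ => (0 : ℝ)) le_rfl
  have h2 := h.sum (fun a => ‖e₁.repr x a‖) (fun _ : κ => (0 : ℝ)) (fun _ => norm_nonneg _)
    (fun _ => le_rfl)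
  rw [h1, h.comb_zero _ h0] at h2
  rw [← h2]
  congr 1
  ext (a | c)
  · simp [H.repr_inl]
  · simp [H.repr_inr]

theorem comb_eq (h : IsNormKind ν comb L) (hb : IsON ν N b) (x : M) :
    N x = comb (ν _ fun a => ‖b.repr x (Sum.inl a)‖) (ν _ fun c => ‖b.repr x (Sum.inr c)‖) := by
  rw [hb, ← h.sum _ _ (fun _ => norm_nonneg _) (fun _ => norm_nonneg _)]
  congr 1
  ext (a | c) <;> rfl

/-- The coordinates in the second block are fixed on a fibre, and the norm is smallest when those in
the first block are zero. So the infimum defining the quotient norm is a minimum. -/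
theorem isLeast_fibre (h : IsNormKind ν comb L) (H : ExactBases i π e₁ b e₂) (hb : IsON ν N b)
    (y : M₂) : IsLeast {r : ℝ | ∃ x, π x = y ∧ N x = r} (ν _ fun c => ‖e₂.repr y c‖) := by
  have h0 : 0 ≤ ν _ (fun c => ‖e₂.repr y c‖) := h.nonneg _ fun _ => norm_nonneg _
  have h1 : ν _ (fun _ : ι => (0 : ℝ)) = 0 := by
    simpa using h.mul 0 (fun _ : ι => (0 : ℝ)) le_rfl
  constructor
  · let x := b.equivFun.symm (Sum.elim 0 (e₂.repr y))
    have hx : ∀ j, b.repr x j = Sum.elim (0 : ι → L) (e₂.repr y) j := fun j => by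
      rw [← Basis.equivFun_apply, LinearEquiv.apply_symm_apply]
    refine ⟨x, ?_, ?_⟩
    · apply e₂.repr.injective
      ext c
      rw [H.repr_right, hx]; rfl
    · rw [hb.comb_eq h]
      simp only [hx, Sum.elim_inl, Sum.elim_inr, Pi.zero_apply, norm_zero, h1]
      rw [h.comb_comm, h.comb_zero _ h0]
  · rintro r ⟨x, hx, rfl⟩
    rw [hb.comb_eq h, h.comb_comm]
    simp only [← hx, H.repr_right]
    exact h.le_comb _ _ (h.nonneg _ fun _ => norm_nonneg _) (h.nonneg _ fun _ => norm_nonneg _)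

theorem right (h : IsNormKind ν comb L) (H : ExactBases i π e₁ b e₂) (hb : IsON ν N b) :
    IsON ν (fibreNorm N π) e₂ :=
  fun y => (hb.isLeast_fibre h H y).csInf_eq

/-- Read in the coordinates of `e`, the image of `i` is a subspace of `L^n`, to which
`IsNormKind.adapted` applies. -/
theorem exists_adapted (h : IsNormKind ν comb L) {n : ℕ} {e : Basis (Fin n) L M}
    (he : IsON ν N e) (H : IsShortExact i π) :
    ∃ (m k : ℕ) (e₁ : Basis (Fin m) L M₁) (b : Basis (Fin m ⊕ Fin k) L M)
      (e₂ : Basis (Fin k) L M₂), ExactBases i π e₁ b e₂ ∧ IsON ν N b := by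
  obtain ⟨m, k, f, hf, hW⟩ := h.adapted ((LinearMap.range i).map e.equivFun.toLinearMap)
  let b := f.map e.equivFun.symm
  have hr : LinearMap.range i = Submodule.span L (Set.range (b ∘ Sum.inl)) := by
    have : b ∘ Sum.inl = e.equivFun.symm ∘ (f ∘ Sum.inl) := rfl
    rw [this, Set.range_comp]
    change _ = Submodule.span L (e.equivFun.symm.toLinearMap '' _)
    rw [Submodule.span_image, ← hW, ← Submodule.map_comp]
    simp
  obtain ⟨e₁, e₂, hE⟩ := H.exists_bases b hr
  refine ⟨m, k, e₁, b, e₂, hE, fun x => ?_⟩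
  have := hf (e.equivFun x)
  rw [he]
  exact this

end IsON

section Dual

variable [DecidableEq ι] [DecidableEq κ] {i : M₁ →ₗ[L] M} {π : M →ₗ[L] M₂}
  {e₁ : Basis ι L M₁} {b : Basis (ι ⊕ κ) L M} {e₂ : Basis κ L M₂}

/-- Dualising reverses the arrows, so the two blocks of the dual basis change places. -/
theorem ExactBases.dual (H : ExactBases i π e₁ b e₂) :
    ExactBases π.dualMap i.dualMap e₂.dualBasis
      (b.dualBasis.reindex (Equiv.sumComm ι κ)) e₁.dualBasis where
  inl c := by
    apply b.ext
    intro j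
    rcases j with a | d
    · simp [H.inl, H.comp]
      simp [← H.inl]
    · simp [H.inr, Finsupp.single_apply]
  inr a := by
    apply e₁.ext
    intro j
    simp [← H.inl, Finsupp.single_apply]
  comp φ := by
    ext x
    simp [H.comp]

end Dual

variable {N : M → ℝ} {i : M₁ →ₗ[L] M} {π : M →ₗ[L] M₂}

/-- The dual of a quotient norm is the restricted dual norm: for an adapted basis, both sides have
the same orthonormal basis. -/
theorem opNorm_fibreNorm (h : IsNormKind ν comb L) {n : ℕ} {e : Basis (Fin n) L M}
    (he : IsON ν N e) (H : IsShortExact i π) (φ : Dual L M₂) :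
    opNorm (fibreNorm N π) φ = opNorm N (φ ∘ₗ π) := by
  obtain ⟨m, k, e₁, b, e₂, hE, hb⟩ := he.exists_adapted h H
  have h1 := (hb.right h hE).opNorm h
  have h2 := ((hb.opNorm h).reindex h (Equiv.sumComm _ _)).left h hE.dual
  exact congrFun (h1.ext h2) φ

/-- The dual of a restricted norm is the quotient of the dual norm, a form of Hahn–Banach with exact
norms, by the same comparison of orthonormal bases. -/
theorem opNorm_comp (h : IsNormKind ν comb L) {n : ℕ} {e : Basis (Fin n) L M}
    (he : IsON ν N e) (H : IsShortExact i π) (ψ : Dual L M₁) :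
    opNorm (fun x => N (i x)) ψ = fibreNorm (opNorm N) i.dualMap ψ := by
  obtain ⟨m, k, e₁, b, e₂, hE, hb⟩ := he.exists_adapted h H
  have h1 := (hb.left h hE).opNorm h
  have h2 := ((hb.opNorm h).reindex h (Equiv.sumComm _ _)).right h hE.dual
  exact congrFun (h1.ext h2) ψ

/-- Hadamard's inequality for semilinear maps. -/
theorem norm_det_semilinear_le {L' : Type*} [NormedField L'] {M' : Type*} [AddCommGroup M']
    [Module L' M'] {ν' : ∀ (ι : Type) [Fintype ι], (ι → ℝ) → ℝ} {comb' : ℝ → ℝ → ℝ}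
    (h : IsNormKind ν comb L) (h' : IsNormKind ν' comb' L') {n : ℕ} {e : Basis (Fin n) L M}
    (he : IsON ν N e) {N' : M' → ℝ} {e' : Basis (Fin n) L' M'} (he' : IsON ν' N' e')
    (c : L →+* L') (hc : ∀ a, ‖c a‖ = ‖a‖) (f : M →+ M') (hf : ∀ a x, f (a • x) = c a • f x)
    {r : ℝ} (hr : ∀ x, N' (f x) ≤ r * N x) (b : Fin n → M) :
    ‖e'.det (f ∘ b)‖ ≤ r ^ n * ‖e.det b‖ := by
  -- Semilinearity factors the matrix of `f ∘ b` into the matrix of `f` on `e` and the `c`-conjugate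
  -- of the matrix of `b`. The columns of the first factor have norm at most `r`, and Hadamard
  -- applies to it.
  have hm : e'.toMatrix (f ∘ b) = e'.toMatrix (f ∘ e) * (e.toMatrix b).map c := by
    ext i j
    simp only [Basis.toMatrix_apply, Matrix.mul_apply, Function.comp, Matrix.map_apply]
    conv_lhs => rw [← e.sum_repr (b j)]
    rw [map_sum, map_sum, Finsupp.coe_finsetSum, Finset.sum_apply]
    simp [hf, mul_comm]
  rw [Basis.det_apply, Basis.det_apply, hm, Matrix.det_mul, norm_mul,
    ← RingHom.mapMatrix_apply, ← RingHom.map_det, hc]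
  gcongr
  refine (h'.hadamard _).trans ?_
  have : r ^ n = ∏ _j : Fin n, r := by simp
  rw [this]
  refine Finset.prod_le_prod (fun j _ => h'.nonneg _ fun _ => norm_nonneg _) fun j _ => ?_
  have h1 := hr (e j)
  rwa [he.self h, mul_one, he'] at h1

/-- Hadamard's inequality for the identity map with `r = 1`, in both directions. -/
theorem norm_det_eq_of_isON (h : IsNormKind ν comb L) {n : ℕ} {e e' : Basis (Fin n) L M}
    (he : IsON ν N e) (he' : IsON ν N e') (b : Fin n → M) : ‖e.det b‖ = ‖e'.det b‖ := by
  have key : ∀ {e e' : Basis (Fin n) L M}, IsON ν N e → IsON ν N e' → ‖e'.det b‖ ≤ ‖e.det b‖ := by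
    intro e e' he he'
    have := norm_det_semilinear_le h h he he' (RingHom.id L) (fun _ => rfl) (AddMonoidHom.id M)
      (fun _ _ => rfl) (r := 1) (fun x => by simp) b
    simpa using this
  exact le_antisymm (key he' he) (key he he')

/-- A map that does not increase norms induces one on quotients with the same property. -/
theorem fibreNorm_le {M M₂ M' M₂' : Type*} {N : M → ℝ} {N' : M' → ℝ} (hN' : ∀ x, 0 ≤ N' x)
    {π : M → M₂} (hπ : Function.Surjective π) {π' : M' → M₂'} (g : M → M') (f : M₂ → M₂')
    (hfg : ∀ x, f (π x) = π' (g x)) (hg : ∀ x, N' (g x) ≤ N x) (y : M₂) :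
    fibreNorm N' π' (f y) ≤ fibreNorm N π y := by
  obtain ⟨x, hx⟩ := hπ y
  refine le_csInf ⟨_, x, hx, rfl⟩ ?_
  rintro _ ⟨x, rfl, rfl⟩
  refine le_trans (csInf_le ⟨0, ?_⟩ ⟨g x, (hfg x).symm, rfl⟩) (hg x)
  rintro _ ⟨z, -, rfl⟩
  exact hN' z

end NormTheory

/-! ### Localising exact sequences and duals -/

section BaseChange

variable {ν : ∀ (ι : Type) [Fintype ι], (ι → ℝ) → ℝ} {comb : ℝ → ℝ → ℝ}
variable {K : Type*} [Field K] (L : Type*) [NormedField L] [Algebra K L]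
variable {A B C : Type*} [AddCommGroup A] [Module K A] [AddCommGroup B] [Module K B]
  [AddCommGroup C] [Module K C] {i : A →ₗ[K] B} {π : B →ₗ[K] C}

theorem IsShortExact.baseChange (h : IsShortExact i π) :
    IsShortExact (i.baseChange L) (π.baseChange L) where
  inj := Module.Flat.lTensor_preserves_injective_linearMap i h.inj
  surj := LinearMap.lTensor_surjective L h.surj
  exact := lTensor_exact L h.exact h.surj

theorem ExactBases.baseChange {ι κ : Type*} {e₁ : Basis ι K A} {e : Basis (ι ⊕ κ) K B}
    {e₂ : Basis κ K C} (h : ExactBases i π e₁ e e₂) :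
    ExactBases (i.baseChange L) (π.baseChange L) (Algebra.TensorProduct.basis L e₁)
      (Algebra.TensorProduct.basis L e) (Algebra.TensorProduct.basis L e₂) where
  inl a := by simp [h.inl]
  inr c := by simp [h.inr]
  comp x := by
    have : (π ∘ₗ i).baseChange L = 0 := by
      rw [show π ∘ₗ i = 0 from LinearMap.ext h.comp, LinearMap.baseChange_zero]
    rw [LinearMap.baseChange_comp] at this
    exact LinearMap.congr_fun this x

theorem IsShortExact.exists_basis {K A B C : Type*} [Field K] [AddCommGroup A] [Module K A]
    [AddCommGroup B] [Module K B] [AddCommGroup C] [Module K C] [Module.Finite K B]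
    {i : A →ₗ[K] B} {π : B →ₗ[K] C} (h : IsShortExact i π) :
    ∃ (m k : ℕ) (b₁ : Basis (Fin m) K A) (b : Basis (Fin m ⊕ Fin k) K B)
      (b₂ : Basis (Fin k) K C), ExactBases i π b₁ b b₂ := by
  have : Module.Finite K A := Module.Finite.of_injective i h.inj
  have : Module.Finite K C := Module.Finite.of_surjective π h.surj
  let b₁ := finBasis K A
  let b₂ := finBasis K C
  have hf := fun c => h.surj (b₂ c)
  choose y hy using hf
  have hli : LinearIndependent K (Sum.elim (i ∘ b₁) y) := by
    rw [Fintype.linearIndependent_iff]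
    intro g hg
    rw [Fintype.sum_sum_type] at hg
    simp only [Sum.elim_inl, Sum.elim_inr, Function.comp] at hg
    have h1 := congrArg π hg
    simp only [map_add, map_sum, map_smul, hy, h.exact.apply_apply_eq_zero, smul_zero,
      Finset.sum_const_zero, zero_add, map_zero] at h1
    have h2 := Fintype.linearIndependent_iff.1 b₂.linearIndependent _ h1
    simp only [h2, zero_smul, Finset.sum_const_zero, add_zero, ← map_smul, ← map_sum] at hg
    rw [map_eq_zero_iff i h.inj] at hg
    have h3 := Fintype.linearIndependent_iff.1 b₁.linearIndependent _ hg
    rintro (a | c)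
    exacts [h3 a, h2 c]
  have hsp : ⊤ ≤ Submodule.span K (Set.range (Sum.elim (i ∘ b₁) y)) := by
    intro x _
    have h1 : π (x - ∑ c, b₂.repr (π x) c • y c) = 0 := by
      simp [hy, b₂.sum_repr]
    obtain ⟨z, hz⟩ := (h.exact _).1 h1
    have h2 : x = ∑ a, b₁.repr z a • i (b₁ a) + ∑ c, b₂.repr (π x) c • y c := by
      simp only [← map_smul, ← map_sum, b₁.sum_repr, hz, sub_add_cancel]
    rw [h2]
    refine Submodule.add_mem _ (Submodule.sum_mem _ fun a _ => Submodule.smul_mem _ _ ?_)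
      (Submodule.sum_mem _ fun c _ => Submodule.smul_mem _ _ ?_)
    · exact Submodule.subset_span ⟨Sum.inl a, rfl⟩
    · exact Submodule.subset_span ⟨Sum.inr c, rfl⟩
  refine ⟨_, _, b₁, Basis.mk hli hsp, b₂, ⟨fun a => by simp, fun c => by simp [hy], fun x => ?_⟩⟩
  exact h.exact.apply_apply_eq_zero _

section Dual

variable {V : Type*} [AddCommGroup V] [Module K V] {W : Type*} [AddCommGroup W] [Module K W]

@[simp]
theorem evalDual_tmul (l m : L) (φ : Dual K V) (x : V) :
    evalDual L (l ⊗ₜ[K] φ) (m ⊗ₜ[K] x) = l * (m * algebraMap K L (φ x)) := by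
  simp [evalDual]

theorem evalDual_dualMap (f : V →ₗ[K] W) (φ : L ⊗[K] Dual K W) :
    evalDual L (f.dualMap.baseChange L φ) = (f.baseChange L).dualMap (evalDual L φ) := by
  induction φ with
  | zero => simp
  | add x y hx hy => simp [hx, hy]
  | tmul l φ =>
    ext x
    simp

theorem evalDual_basis {ι : Type*} [Fintype ι] [DecidableEq ι] (b : Basis ι K V) (j : ι) :
    evalDual L (1 ⊗ₜ[K] b.dualBasis j) = (Algebra.TensorProduct.basis L b).dualBasis j := by
  apply (Algebra.TensorProduct.basis L b).ext
  intro k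
  simp [Finsupp.single_apply]

variable (V) in
/-- The localised dual is the dual of the localisation. -/
def evalDualEquiv [Module.Finite K V] : L ⊗[K] Dual K V ≃ₗ[L] Dual L (L ⊗[K] V) :=
  LinearEquiv.ofBijective (evalDual L) <| by
    let b := finBasis K V
    let E := (Algebra.TensorProduct.basis L b.dualBasis).equiv
      (Algebra.TensorProduct.basis L b).dualBasis (Equiv.refl _)
    have : evalDual L = E.toLinearMap := by
      apply (Algebra.TensorProduct.basis L b.dualBasis).ext
      intro j
      rw [Algebra.TensorProduct.basis_apply, evalDual_basis, LinearEquiv.coe_coe,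
        ← Algebra.TensorProduct.basis_apply, Basis.equiv_apply]
      rfl
    rw [this]
    exact E.bijective

@[simp]
theorem evalDualEquiv_apply [Module.Finite K V] (φ : L ⊗[K] Dual K V) :
    evalDualEquiv L V φ = evalDual L φ := rfl

end Dual

end BaseChange

/-! ### Local determinants -/

section HasON

variable {ν : ∀ (ι : Type) [Fintype ι], (ι → ℝ) → ℝ} {comb : ℝ → ℝ → ℝ}

/-- The norm `N` admits an orthonormal basis. -/
def HasON (ν : ∀ (ι : Type) [Fintype ι], (ι → ℝ) → ℝ) (L : Type*) [NormedField L] {M : Type*}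
    [AddCommGroup M] [Module L M] (N : M → ℝ) : Prop :=
  ∃ (n : ℕ) (e : Basis (Fin n) L M), IsON ν N e

section General

variable {L : Type*} [NormedField L]
variable {M₁ M M₂ : Type*} [AddCommGroup M₁] [Module L M₁] [AddCommGroup M] [Module L M]
  [AddCommGroup M₂] [Module L M₂] {N : M → ℝ} {i : M₁ →ₗ[L] M} {π : M →ₗ[L] M₂}

theorem IsON.hasON (h : IsNormKind ν comb L) {ι : Type} [Fintype ι] {e : Basis ι L M}
    (he : IsON ν N e) : HasON ν L N :=
  ⟨_, _, he.reindex h (Fintype.equivFin ι)⟩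

theorem HasON.left (h : IsNormKind ν comb L) (hN : HasON ν L N) (H : IsShortExact i π) :
    HasON ν L (fun x => N (i x)) := by
  obtain ⟨n, e, he⟩ := hN
  obtain ⟨m, k, e₁, b, e₂, hE, hb⟩ := he.exists_adapted h H
  exact ⟨_, _, hb.left h hE⟩

theorem HasON.right (h : IsNormKind ν comb L) (hN : HasON ν L N) (H : IsShortExact i π) :
    HasON ν L (fibreNorm N π) := by
  obtain ⟨n, e, he⟩ := hN
  obtain ⟨m, k, e₁, b, e₂, hE, hb⟩ := he.exists_adapted h H
  exact ⟨_, _, hb.right h hE⟩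

theorem HasON.nonneg (h : IsNormKind ν comb L) (hN : HasON ν L N) (x : M) : 0 ≤ N x := by
  obtain ⟨n, e, he⟩ := hN
  exact he.nonneg h x

theorem HasON.eq_zero (h : IsNormKind ν comb L) (hN : HasON ν L N) {x : M} (hx : N x = 0) :
    x = 0 := by
  obtain ⟨n, e, he⟩ := hN
  exact he.eq_zero h hx

end General

section AbsDet

variable {K : Type*} [Field K] {L : Type*} [NormedField L] [Algebra K L]
variable {V : Type*} [AddCommGroup V] [Module K V] {N : L ⊗[K] V → ℝ}

theorem absDet_eq (h : IsNormKind ν comb L) {n : ℕ} {e : Basis (Fin n) L (L ⊗[K] V)}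
    (he : IsON ν N e) (b : Basis (Fin n) K V) :
    absDet L (IsON ν N) b = ‖e.det (Algebra.TensorProduct.basis L b)‖ := by
  have hex : ∃ e : Basis (Fin n) L (L ⊗[K] V), IsON ν N e := ⟨e, he⟩
  rw [absDet, dif_pos hex, norm_det_eq_of_isON h hex.choose_spec he]
  congr 2
  ext j
  simp

theorem absDet_pos {n : ℕ} (P : Basis (Fin n) L (L ⊗[K] V) → Prop)
    (b : Basis (Fin n) K V) : 0 < absDet L P b := by
  rw [absDet]
  split_ifs with h
  · rw [norm_pos_iff]
    have := (h.choose.isUnit_det (Algebra.TensorProduct.basis L b)).ne_zero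
    convert this using 2
    ext j
    simp
  · exact one_pos

theorem absDet_self (h : IsNormKind ν comb L) {n : ℕ} {b : Basis (Fin n) K V}
    (hb : IsON ν N (Algebra.TensorProduct.basis L b)) : absDet L (IsON ν N) b = 1 := by
  rw [absDet_eq h hb, Basis.det_self, norm_one]

theorem HasON.exists_fin (hN : HasON ν L N) {n : ℕ} (b : Basis (Fin n) K V) :
    ∃ e : Basis (Fin n) L (L ⊗[K] V), IsON ν N e := by
  obtain ⟨m, e, he⟩ := hN
  obtain rfl : m = n := by
    simpa using Fintype.card_congr (e.indexEquiv (Algebra.TensorProduct.basis L b))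
  exact ⟨e, he⟩

/-- The local factor by which a change of `K`-basis acts; over all places these factors cancel by
the product formula. -/
theorem absDet_change (h : IsNormKind ν comb L) (hN : HasON ν L N) {n : ℕ}
    (b b' : Basis (Fin n) K V) :
    absDet L (IsON ν N) b' = ‖algebraMap K L (b.det b')‖ * absDet L (IsON ν N) b := by
  obtain ⟨e, he⟩ := hN.exists_fin b
  rw [absDet_eq h he, absDet_eq h he, ← norm_mul]
  have h1 : e.toMatrix (Algebra.TensorProduct.basis L b') =
      e.toMatrix (Algebra.TensorProduct.basis L b) * (b.toMatrix b').map (algebraMap K L) := by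
    rw [← Basis.toMatrix_mul_toMatrix e (Algebra.TensorProduct.basis L b)]
    congr 1
    ext i j
    simp [Basis.toMatrix_apply]
  rw [Basis.det_apply, Basis.det_apply, Basis.det_apply, h1, Matrix.det_mul, mul_comm,
    ← RingHom.mapMatrix_apply, ← RingHom.map_det]

variable {A C : Type*} [AddCommGroup A] [Module K A] [AddCommGroup C] [Module K C]
  {i : A →ₗ[K] V} {π : V →ₗ[K] C}

/-- An orthonormal basis adapted to the localised sequence and a compatible `K`-basis differ by a
block triangular matrix. -/
theorem absDet_exact (h : IsNormKind ν comb L) (hN : HasON ν L N) (H : IsShortExact i π)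
    {m k : ℕ} {b₁ : Basis (Fin m) K A} {b : Basis (Fin m ⊕ Fin k) K V} {b₂ : Basis (Fin k) K C}
    (hb : ExactBases i π b₁ b b₂) :
    absDet L (IsON ν N) (b.reindex finSumFinEquiv) =
      absDet L (IsON ν fun x => N (i.baseChange L x)) b₁ *
        absDet L (IsON ν (fibreNorm N (π.baseChange L))) b₂ := by
  obtain ⟨n, e, he⟩ := hN
  obtain ⟨m', k', e₁, f, e₂, hE, hf⟩ := he.exists_adapted h (H.baseChange L)
  obtain rfl : m' = m := by
    simpa using Fintype.card_congr (e₁.indexEquiv (Algebra.TensorProduct.basis L b₁))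
  obtain rfl : k' = k := by
    simpa using Fintype.card_congr (e₂.indexEquiv (Algebra.TensorProduct.basis L b₂))
  rw [absDet_eq h (hf.left h hE), absDet_eq h (hf.right h hE),
    absDet_eq h (hf.reindex h finSumFinEquiv), ← norm_mul, ← hE.det_eq (hb.baseChange L),
    Basis.det_reindex]
  congr 2
  ext j
  simp

theorem absDet_dual [Module.Finite K V] (h : IsNormKind ν comb L) (hN : HasON ν L N) {n : ℕ}
    (b : Basis (Fin n) K V) :
    absDet L (IsON ν fun φ => opNorm N (evalDual L φ)) b.dualBasis *
      absDet L (IsON ν N) b = 1 := by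
  obtain ⟨e, he⟩ := hN.exists_fin b
  have h1 : IsON ν (fun φ => opNorm N (evalDual L φ))
      (e.dualBasis.map (evalDualEquiv L V).symm) := by
    intro φ
    exact he.opNorm h (evalDual L φ)
  rw [absDet_eq h he, absDet_eq h h1, ← norm_mul]
  have h2 : (e.dualBasis.map (evalDualEquiv L V).symm).det
      (Algebra.TensorProduct.basis L b.dualBasis) =
      e.dualBasis.det (Algebra.TensorProduct.basis L b).dualBasis := by
    rw [Basis.det_map]
    congr 1
    ext j : 1
    simp only [Function.comp, LinearEquiv.symm_symm, evalDualEquiv_apply,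
      Algebra.TensorProduct.basis_apply, evalDual_basis]
  rw [h2, Basis.det_dualBasis_mul_det, norm_one]

theorem HasON.dual [Module.Finite K V] (h : IsNormKind ν comb L) (hN : HasON ν L N) :
    HasON ν L (fun φ => RigidAdelic.opNorm N (evalDual L φ)) := by
  obtain ⟨n, e, he⟩ := hN
  refine ⟨n, e.dualBasis.map (evalDualEquiv L V).symm, fun φ => ?_⟩
  exact he.opNorm h (evalDual L φ)

end AbsDet

end HasON

/-! ### Semilinear maps and local determinants -/

section Semilinear

variable {ν : ∀ (ι : Type) [Fintype ι], (ι → ℝ) → ℝ} {comb : ℝ → ℝ → ℝ}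
variable {K : Type*} [Field K]
variable {L : Type*} [NormedField L] [Algebra K L] {L' : Type*} [NormedField L'] [Algebra K L']
variable {V : Type*} [AddCommGroup V] [Module K V] {W : Type*} [AddCommGroup W] [Module K W]

/-- The map `l ⊗ x ↦ c l ⊗ f x` for a semilinear map `f` and a compatible map `c`. -/
def semiMap {s : K →+* K} (c : L →+* L') (hc : ∀ a, c (algebraMap K L a) = algebraMap K L' (s a))
    (f : V →ₛₗ[s] W) : L ⊗[K] V →+ L' ⊗[K] W :=
  TensorProduct.liftAddHom
    { toFun := fun l =>
        { toFun := fun x => c l ⊗ₜ[K] f x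
          map_zero' := by simp
          map_add' := fun x y => by simp [TensorProduct.tmul_add] }
      map_zero' := by ext x; simp
      map_add' := fun l m => by ext x; simp [TensorProduct.add_tmul] }
    fun a l x => by
      simp only [AddMonoidHom.coe_mk, ZeroHom.coe_mk]
      rw [LinearMap.map_smulₛₗ, ← TensorProduct.smul_tmul, Algebra.smul_def, Algebra.smul_def,
        map_mul, hc]

variable {s : K →+* K} (c : L →+* L') (hc : ∀ a, c (algebraMap K L a) = algebraMap K L' (s a))
  (f : V →ₛₗ[s] W)

@[simp]
theorem semiMap_tmul (l : L) (x : V) : semiMap c hc f (l ⊗ₜ x) = c l ⊗ₜ f x := rfl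

theorem semiMap_smul (l : L) (x : L ⊗[K] V) :
    semiMap c hc f (l • x) = c l • semiMap c hc f x := by
  induction x with
  | zero => simp
  | add x y hx hy => simp [hx, hy]
  | tmul m x => simp [TensorProduct.smul_tmul']

theorem semiMap_surjective (hcs : Function.Surjective c) (hf : Function.Surjective f) :
    Function.Surjective (semiMap c hc f) := by
  intro y
  induction y with
  | zero => exact ⟨0, map_zero _⟩
  | add x y hx hy =>
    obtain ⟨a, rfl⟩ := hx
    obtain ⟨b, rfl⟩ := hy
    exact ⟨a + b, map_add _ _ _⟩
  | tmul m y =>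
    obtain ⟨l, rfl⟩ := hcs m
    obtain ⟨x, rfl⟩ := hf y
    exact ⟨l ⊗ₜ x, rfl⟩

/-- The image of a basis under a bijective semilinear map. -/
theorem exists_basis_semilinear {ι : Type*} [Fintype ι] (hs : Function.Surjective s)
    (hf : Function.Bijective f) (b : Basis ι K V) :
    ∃ b' : Basis ι K W, ∀ j, b' j = f (b j) := by
  have h1 : LinearIndependent K (fun j => f (b j)) := by
    have := b.linearIndependent.map_of_surjective_injective s f.toAddMonoidHom hs
      (by intro m hm; exact (map_eq_zero_iff f hf.1).1 hm) (fun r m => f.map_smulₛₗ r m)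
    exact this
  have h2 : ⊤ ≤ Submodule.span K (Set.range fun j => f (b j)) := by
    intro y _
    obtain ⟨x, rfl⟩ := hf.2 y
    rw [← b.sum_repr x, map_sum]
    refine Submodule.sum_mem _ fun j _ => ?_
    rw [f.map_smulₛₗ]
    exact Submodule.smul_mem _ _ (Submodule.subset_span ⟨j, rfl⟩)
  exact ⟨Basis.mk h1 h2, fun j => by simp⟩

variable {ν' : ∀ (ι : Type) [Fintype ι], (ι → ℝ) → ℝ} {comb' : ℝ → ℝ → ℝ}
  {N : L ⊗[K] V → ℝ} {N' : L' ⊗[K] W → ℝ}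

theorem absDet_semilinear_le (h : IsNormKind ν comb L) (h' : IsNormKind ν' comb' L')
    (hN : HasON ν L N) (hN' : HasON ν' L' N') (hcn : ∀ a, ‖c a‖ = ‖a‖) {r : ℝ}
    (hr : ∀ x, N' (semiMap c hc f x) ≤ r * N x) {n : ℕ} {b : Basis (Fin n) K V}
    {b' : Basis (Fin n) K W} (hb : ∀ j, b' j = f (b j)) :
    absDet L' (IsON ν' N') b' ≤ r ^ n * absDet L (IsON ν N) b := by
  obtain ⟨e, he⟩ := hN.exists_fin b
  obtain ⟨e', he'⟩ := hN'.exists_fin b'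
  rw [absDet_eq h he, absDet_eq h' he']
  have := norm_det_semilinear_le h h' he he' c hcn (semiMap c hc f) (semiMap_smul c hc f) hr
    (Algebra.TensorProduct.basis L b)
  convert this using 3
  ext j
  simp [hb]

theorem absDet_semilinear_eq {c : L ≃+* L'}
    {hc : ∀ a, (c : L →+* L') (algebraMap K L a) = algebraMap K L' (s a)}
    (h : IsNormKind ν comb L) (h' : IsNormKind ν' comb' L')
    (hN : HasON ν L N) (hN' : HasON ν' L' N') (hcn : ∀ a, ‖c a‖ = ‖a‖) {r : ℝ} (hr0 : 0 < r)
    (hr : ∀ x, N' (semiMap (c : L →+* L') hc f x) = r * N x)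
    (hf : Function.Surjective f) {n : ℕ} {b : Basis (Fin n) K V}
    {b' : Basis (Fin n) K W} (hb : ∀ j, b' j = f (b j)) :
    absDet L' (IsON ν' N') b' = r ^ n * absDet L (IsON ν N) b := by
  refine le_antisymm (absDet_semilinear_le _ hc f h h' hN hN' hcn (fun x => (hr x).le) hb) ?_
  have hinj : Function.Injective (semiMap (c : L →+* L') hc f) := by
    rw [injective_iff_map_eq_zero]
    intro x hx
    apply hN.eq_zero h
    have h1 := hr x
    rw [hx] at h1
    have h2 := hr 0
    rw [map_zero] at h2
    have h3 : N 0 = 0 := by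
      obtain ⟨n, e, he⟩ := hN
      have := he.smul h 0 0
      simpa using this
    rw [h3, mul_zero] at h2
    rw [h2] at h1
    exact (mul_eq_zero.1 h1.symm).resolve_left hr0.ne'
  let F : (L ⊗[K] V) ≃+ (L' ⊗[K] W) := AddEquiv.ofBijective (semiMap (c : L →+* L') hc f)
    ⟨hinj, semiMap_surjective _ hc f c.surjective hf⟩
  obtain ⟨e, he⟩ := hN.exists_fin b
  obtain ⟨e', he'⟩ := hN'.exists_fin b'
  rw [absDet_eq h he, absDet_eq h' he']
  -- The reverse inequality is Hadamard for the inverse map, which scales norms by `r⁻¹`.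
  have key := norm_det_semilinear_le h' h he' he (c.symm : L' →+* L)
    (fun a => by rw [← hcn]; simp) F.symm.toAddMonoidHom
    (fun a y => by
      apply F.injective
      have : ∀ l x, F (l • x) = c l • F x := fun l x => semiMap_smul _ hc f l x
      simp [this])
    (r := r⁻¹) (fun y => by
      have := hr (F.symm y)
      have h5 : semiMap (c : L →+* L') hc f (F.symm y) = y := F.apply_symm_apply y
      rw [h5] at this
      rw [this]
      simp [hr0.ne'])
    (Algebra.TensorProduct.basis L' b')
  have h6 : F.symm.toAddMonoidHom ∘ (Algebra.TensorProduct.basis L' b') =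
      Algebra.TensorProduct.basis L b := by
    ext j : 1
    simp only [Function.comp, Algebra.TensorProduct.basis_apply, hb]
    rw [AddEquiv.coe_toAddMonoidHom, AddEquiv.symm_apply_eq]
    change _ = semiMap (c : L →+* L') hc f (1 ⊗ₜ b j)
    simp
  rw [h6, inv_pow, le_inv_mul_iff₀ (pow_pos hr0 n)] at key
  exact key

end Semilinear

/-! ### Heights: change of basis, exact sequences, duals -/

namespace AdelicSpace

variable {K : Type*} [Field K] [NumberField K]
variable {V : Type*} [AddCommGroup V] [Module K V]

theorem isRigid_iff {X : AdelicSpace K V} : X.IsRigid ↔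
    (∀ v, HasON @l2Norm v.Completion (X.inf v)) ∧
    (∀ v, HasON @supNorm (v.adicCompletion K) (X.fin v)) ∧
    ∃ (n : ℕ) (b : Basis (Fin n) K V), {v : HeightOneSpectrum (𝓞 K) | ¬ IsON @supNorm (X.fin v)
      (Algebra.TensorProduct.basis (v.adicCompletion K) b)}.Finite := by
  constructor
  · rintro ⟨h1, h2, h3⟩
    exact ⟨fun v => ⟨_, h1 v⟩, fun v => ⟨_, h2 v⟩, _, h3⟩
  · rintro ⟨h1, h2, n, b, h3⟩
    refine ⟨fun v => ?_, fun v => ?_, ?_⟩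
    · obtain ⟨n, e, he⟩ := h1 v
      obtain rfl : finrank K V = n := by
        rw [← finrank_baseChange (R := v.Completion) (S := K), finrank_eq_card_basis e,
          Fintype.card_fin]
      exact ⟨e, he⟩
    · obtain ⟨n, e, he⟩ := h2 v
      obtain rfl : finrank K V = n := by
        rw [← finrank_baseChange (R := v.adicCompletion K) (S := K), finrank_eq_card_basis e,
          Fintype.card_fin]
      exact ⟨e, he⟩
    · obtain rfl : finrank K V = n := by
        rw [finrank_eq_card_basis b, Fintype.card_fin]
      exact ⟨b, h3⟩

theorem IsRigid.inf {X : AdelicSpace K V} (h : X.IsRigid) (v) :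
    HasON @l2Norm v.Completion (X.inf v) :=
  (isRigid_iff.1 h).1 v

theorem IsRigid.fin {X : AdelicSpace K V} (h : X.IsRigid) (v) :
    HasON @supNorm (v.adicCompletion K) (X.fin v) :=
  (isRigid_iff.1 h).2.1 v

theorem finite_norm_ne_one {x : K} (hx : x ≠ 0) :
    {v : HeightOneSpectrum (𝓞 K) | ‖algebraMap K (v.adicCompletion K) x‖ ≠ 1}.Finite := by
  have h := NumberField.FinitePlace.hasFiniteMulSupport hx
  have h2 : (Function.mulSupport fun w : NumberField.FinitePlace K => w x).Finite := h
  refine (h2.preimage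
    (NumberField.FinitePlace.equivHeightOneSpectrum.symm.injective.injOn)).subset ?_
  intro v hv
  rw [Set.mem_preimage, Function.mem_mulSupport,
    NumberField.FinitePlace.equivHeightOneSpectrum_symm_apply]
  exact hv

theorem finite_one_lt_norm (x : K) :
    {v : HeightOneSpectrum (𝓞 K) | ¬ ‖algebraMap K (v.adicCompletion K) x‖ ≤ 1}.Finite := by
  by_cases hx : x = 0
  · simp [hx]
  · refine (finite_norm_ne_one hx).subset fun v hv h => hv h.le

/-- Every basis is orthonormal at almost all places. -/
theorem IsRigid.finite_not_isON {X : AdelicSpace K V} (h : X.IsRigid) {ι : Type} [Fintype ι]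
    (b : Basis ι K V) : {v : HeightOneSpectrum (𝓞 K) | ¬ IsON @supNorm (X.fin v)
      (Algebra.TensorProduct.basis (v.adicCompletion K) b)}.Finite := by
  obtain ⟨-, -, n, b₁, hb₁⟩ := isRigid_iff.1 h
  let b₀ : Basis ι K V := b₁.reindex (b₁.indexEquiv b)
  have hfin := (hb₁.union (Set.finite_iUnion fun i : ι => Set.finite_iUnion fun j : ι =>
    (finite_one_lt_norm (b₀.repr (b j) i)).union (finite_one_lt_norm (b.repr (b₀ j) i))))
  -- Away from this finite set `b₁` is orthonormal, and the transition matrices between `b` and the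
  -- reindexed `b₁` are integral in both directions.
  refine hfin.subset fun v hv => ?_
  by_contra hcon
  simp only [Set.mem_union, Set.mem_iUnion, Set.mem_ofPred_eq, not_or, not_exists, not_not]
    at hcon
  apply hv
  intro x
  have h0 := hcon.1.reindex (isNormKind_fin v) (b₁.indexEquiv b)
  rw [h0 x]
  have h1 : (Algebra.TensorProduct.basis (v.adicCompletion K) b₁).reindex (b₁.indexEquiv b) =
      Algebra.TensorProduct.basis (v.adicCompletion K) b₀ := by
    ext j
    simp [b₀]
  rw [h1]
  refine supNorm_repr_eq _ _ (fun i j => ?_) (fun i j => ?_) x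
  · simpa using (hcon.2 i j).1
  · simpa using (hcon.2 i j).2

/-- The product over all places of the local determinants of a basis. -/
def detProd (X : AdelicSpace K V) {n : ℕ} (b : Basis (Fin n) K V) : ℝ :=
  (∏ v : NumberField.InfinitePlace K,
      absDet v.Completion (IsON @l2Norm (X.inf v)) b ^ v.mult) *
    ∏ᶠ v : HeightOneSpectrum (𝓞 K), absDet (v.adicCompletion K) (IsON @supNorm (X.fin v)) b

theorem height_def [Module.Finite K V] (X : AdelicSpace K V) :
    X.height = X.detProd (finBasis K V) ^ (1 / (finrank ℚ K : ℝ)) := rfl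

theorem finprod_pos_of_pos {ι : Type*} {f : ι → ℝ} (h : ∀ i, 0 < f i) : 0 < ∏ᶠ i, f i :=
  finprod_induction (0 < ·) one_pos (fun _ _ => mul_pos) h

theorem detProd_pos (X : AdelicSpace K V) {n : ℕ} (b : Basis (Fin n) K V) : 0 < X.detProd b :=
  mul_pos (Finset.prod_pos fun _ _ => pow_pos (absDet_pos _ _) _)
    (finprod_pos_of_pos fun _ => absDet_pos _ _)

theorem height_pos [Module.Finite K V] (X : AdelicSpace K V) : 0 < X.height :=
  Real.rpow_pos_of_pos (detProd_pos _ _) _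

theorem IsRigid.hasFiniteMulSupport {X : AdelicSpace K V} (h : X.IsRigid) {n : ℕ}
    (b : Basis (Fin n) K V) : (Function.mulSupport fun v : HeightOneSpectrum (𝓞 K) =>
      absDet (v.adicCompletion K) (IsON @supNorm (X.fin v)) b).Finite := by
  refine (h.finite_not_isON b).subset fun v hv hon => hv ?_
  exact absDet_self (isNormKind_fin v) hon

/-- The two products differ by the product of the absolute values of `b.det b'` over all places,
which is `1` by the product formula. -/
theorem IsRigid.detProd_eq {X : AdelicSpace K V} (h : X.IsRigid) {n : ℕ}
    (b b' : Basis (Fin n) K V) : X.detProd b' = X.detProd b := by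
  have hx : b.det b' ≠ 0 := (b.isUnit_det b').ne_zero
  have h1 := NumberField.prod_abs_eq_one hx
  rw [← finprod_comp_equiv NumberField.FinitePlace.equivHeightOneSpectrum.symm] at h1
  simp only [NumberField.FinitePlace.equivHeightOneSpectrum_symm_apply] at h1
  have h2 : ∀ v : NumberField.InfinitePlace K, ‖algebraMap K v.Completion (b.det b')‖ =
      v (b.det b') := fun v => NumberField.InfinitePlace.Completion.norm_coe v _
  simp only [detProd]
  rw [Finset.prod_congr rfl fun v _ => by
      rw [absDet_change (isNormKind_inf v) (h.inf v) b b', mul_pow, h2],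
    finprod_congr fun v => absDet_change (isNormKind_fin v) (h.fin v) b b',
    finprod_mul_distrib (finite_norm_ne_one hx) (h.hasFiniteMulSupport b),
    Finset.prod_mul_distrib, mul_mul_mul_comm]
  erw [h1]
  rw [one_mul]

theorem IsRigid.height_eq [Module.Finite K V] {X : AdelicSpace K V} (h : X.IsRigid) {n : ℕ}
    (b : Basis (Fin n) K V) : X.height = X.detProd b ^ (1 / (finrank ℚ K : ℝ)) := by
  obtain rfl : finrank K V = n := by rw [finrank_eq_card_basis b, Fintype.card_fin]
  rw [height_def, h.detProd_eq b]

section Exact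

variable {A B C : Type*} [AddCommGroup A] [Module K A] [AddCommGroup B] [Module K B]
  [AddCommGroup C] [Module K C] {i : A →ₗ[K] B} {π : B →ₗ[K] C}
  {X₁ : AdelicSpace K A} {X : AdelicSpace K B} {X₂ : AdelicSpace K C}

/-- A short exact sequence of adelic spaces: the outer terms carry the induced norms. -/
structure IsExact (X₁ : AdelicSpace K A) (X : AdelicSpace K B) (X₂ : AdelicSpace K C)
    (i : A →ₗ[K] B) (π : B →ₗ[K] C) : Prop extends IsShortExact i π where
  left_inf : ∀ v x, X₁.inf v x = X.inf v (i.baseChange v.Completion x)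
  left_fin : ∀ v x, X₁.fin v x = X.fin v (i.baseChange (v.adicCompletion K) x)
  right_inf : ∀ v x, X₂.inf v x = fibreNorm (X.inf v) (π.baseChange v.Completion) x
  right_fin : ∀ v x, X₂.fin v x = fibreNorm (X.fin v) (π.baseChange (v.adicCompletion K)) x

theorem IsExact.isRigid_left [Module.Finite K B] (H : IsExact X₁ X X₂ i π) (hX : X.IsRigid) :
    X₁.IsRigid := by
  obtain ⟨m, k, b₁, b, b₂, hb⟩ := H.toIsShortExact.exists_basis
  refine isRigid_iff.2 ⟨fun v => ?_, fun v => ?_, m, b₁, ?_⟩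
  · rw [funext (H.left_inf v)]
    exact (hX.inf v).left (isNormKind_inf v) (H.toIsShortExact.baseChange _)
  · rw [funext (H.left_fin v)]
    exact (hX.fin v).left (isNormKind_fin v) (H.toIsShortExact.baseChange _)
  · refine (hX.finite_not_isON b).subset fun v hv hon => hv ?_
    rw [funext (H.left_fin v)]
    exact hon.left (isNormKind_fin v) (hb.baseChange _)

theorem IsExact.isRigid_right [Module.Finite K B] (H : IsExact X₁ X X₂ i π) (hX : X.IsRigid) :
    X₂.IsRigid := by
  obtain ⟨m, k, b₁, b, b₂, hb⟩ := H.toIsShortExact.exists_basis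
  refine isRigid_iff.2 ⟨fun v => ?_, fun v => ?_, k, b₂, ?_⟩
  · rw [funext (H.right_inf v)]
    exact (hX.inf v).right (isNormKind_inf v) (H.toIsShortExact.baseChange _)
  · rw [funext (H.right_fin v)]
    exact (hX.fin v).right (isNormKind_fin v) (H.toIsShortExact.baseChange _)
  · refine (hX.finite_not_isON b).subset fun v hv hon => hv ?_
    rw [funext (H.right_fin v)]
    exact hon.right (isNormKind_fin v) (hb.baseChange _)

/-- Local determinants are multiplicative for compatible bases, and the height may be computed in
any `K`-basis. -/
theorem IsExact.height_eq [Module.Finite K A] [Module.Finite K B] [Module.Finite K C]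
    (H : IsExact X₁ X X₂ i π) (hX : X.IsRigid) : X.height = X₁.height * X₂.height := by
  obtain ⟨m, k, b₁, b, b₂, hb⟩ := H.toIsShortExact.exists_basis
  have h₁ := H.isRigid_left hX
  have h₂ := H.isRigid_right hX
  rw [hX.height_eq (b.reindex finSumFinEquiv), h₁.height_eq b₁, h₂.height_eq b₂,
    ← Real.mul_rpow (detProd_pos _ _).le (detProd_pos _ _).le]
  congr 1
  simp only [detProd]
  rw [mul_mul_mul_comm, ← Finset.prod_mul_distrib,
    ← finprod_mul_distrib (h₁.hasFiniteMulSupport b₁) (h₂.hasFiniteMulSupport b₂)]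
  congr 1
  · refine Finset.prod_congr rfl fun v _ => ?_
    rw [absDet_exact (isNormKind_inf v) (hX.inf v) H.toIsShortExact hb, mul_pow,
      ← funext (H.left_inf v), ← funext (H.right_inf v)]
  · refine finprod_congr fun v => ?_
    rw [absDet_exact (isNormKind_fin v) (hX.fin v) H.toIsShortExact hb,
      ← funext (H.left_fin v), ← funext (H.right_fin v)]

end Exact

section Dual

variable [Module.Finite K V] {X : AdelicSpace K V}

theorem IsRigid.dual (hX : X.IsRigid) : X.dual.IsRigid := by
  let b := finBasis K V
  refine isRigid_iff.2 ⟨fun v => (hX.inf v).dual (isNormKind_inf v),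
    fun v => (hX.fin v).dual (isNormKind_fin v), _, b.dualBasis, ?_⟩
  refine (hX.finite_not_isON b).subset fun v hv hon => hv fun φ => ?_
  change opNorm (X.fin v) (evalDual (v.adicCompletion K) φ) = _
  rw [hon.opNorm (isNormKind_fin v) (evalDual (v.adicCompletion K) φ)]
  have h : Algebra.TensorProduct.basis (v.adicCompletion K) b.dualBasis =
      (Algebra.TensorProduct.basis (v.adicCompletion K) b).dualBasis.map
        (evalDualEquiv (v.adicCompletion K) V).symm := by
    ext j : 1
    rw [Basis.map_apply, LinearEquiv.eq_symm_apply, Algebra.TensorProduct.basis_apply,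
      evalDualEquiv_apply, evalDual_basis]
  rw [h]
  rfl

/-- Place by place, the determinants of a basis and of its dual basis are inverse to each other. -/
theorem IsRigid.height_dual (hX : X.IsRigid) : X.dual.height * X.height = 1 := by
  let b := finBasis K V
  rw [hX.height_eq b, hX.dual.height_eq b.dualBasis,
    ← Real.mul_rpow (detProd_pos _ _).le (detProd_pos _ _).le]
  suffices h : X.dual.detProd b.dualBasis * X.detProd b = 1 by rw [h, Real.one_rpow]
  simp only [detProd]
  rw [mul_mul_mul_comm, ← Finset.prod_mul_distrib,
    ← finprod_mul_distrib (hX.dual.hasFiniteMulSupport b.dualBasis) (hX.hasFiniteMulSupport b),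
    Finset.prod_eq_one, finprod_eq_one_of_forall_eq_one, one_mul]
  · exact fun v => absDet_dual (isNormKind_fin v) (hX.fin v) b
  · intro v _
    rw [← mul_pow]
    have := absDet_dual (isNormKind_inf v) (hX.inf v) b
    exact (congrArg (· ^ v.mult) this).trans (one_pow _)

end Dual

end AdelicSpace

/-! ### Scaling maps along a field automorphism -/

variable (K : Type*) [Field K] [NumberField K]

/-- An automorphism of `K` with the isomorphisms it induces between the completions. -/
structure Twist where
  /-- the automorphism -/
  aut : K ≃+* K
  /-- the permutation of the finite places -/
  place : HeightOneSpectrum (𝓞 K) ≃ HeightOneSpectrum (𝓞 K)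
  /-- the isomorphisms between completions at infinite places -/
  inf : ∀ v : NumberField.InfinitePlace K, v.Completion ≃+* v.Completion
  /-- the isomorphisms between completions at finite places -/
  fin : ∀ v : HeightOneSpectrum (𝓞 K), v.adicCompletion K ≃+* (place v).adicCompletion K
  norm_inf : ∀ v x, ‖inf v x‖ = ‖x‖
  norm_fin : ∀ v x, ‖fin v x‖ = ‖x‖
  inf_algebraMap : ∀ v a,
    (inf v : v.Completion →+* v.Completion) (algebraMap K _ a) =
      algebraMap K _ ((aut : K →+* K) a)
  fin_algebraMap : ∀ v a,
    (fin v : v.adicCompletion K →+* (place v).adicCompletion K) (algebraMap K _ a) =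
      algebraMap K _ ((aut : K →+* K) a)

namespace AdelicSpace

variable {K} {V : Type*} [AddCommGroup V] [Module K V] {W : Type*} [AddCommGroup W] [Module K W]

/-- The localisation of a semilinear map at an infinite place. -/
def _root_.RigidAdelic.Twist.mapInf (T : Twist K) (f : V →ₛₗ[(T.aut : K →+* K)] W)
    (v : NumberField.InfinitePlace K) : v.Completion ⊗[K] V →+ v.Completion ⊗[K] W :=
  semiMap (T.inf v : v.Completion →+* v.Completion) (T.inf_algebraMap v) f

/-- The localisation of a semilinear map at a finite place. -/
def _root_.RigidAdelic.Twist.mapFin (T : Twist K) (f : V →ₛₗ[(T.aut : K →+* K)] W)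
    (v : HeightOneSpectrum (𝓞 K)) :
    v.adicCompletion K ⊗[K] V →+ (T.place v).adicCompletion K ⊗[K] W :=
  semiMap (T.fin v : v.adicCompletion K →+* (T.place v).adicCompletion K) (T.fin_algebraMap v) f

/-- The semilinear map `f` multiplies the norms by the factors `r` and `ρ`. -/
structure ScalesBy (X : AdelicSpace K V) (Y : AdelicSpace K W) (T : Twist K)
    (f : V →ₛₗ[(T.aut : K →+* K)] W) (r : NumberField.InfinitePlace K → ℝ)
    (ρ : HeightOneSpectrum (𝓞 K) → ℝ) : Prop where
  inf : ∀ v x, Y.inf v (T.mapInf f v x) = r v * X.inf v x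
  fin : ∀ v x, Y.fin (T.place v) (T.mapFin f v x) = ρ v * X.fin v x

theorem ScalesBy.height_eq [Module.Finite K V] [Module.Finite K W] {X : AdelicSpace K V}
    {Y : AdelicSpace K W} (hX : X.IsRigid) (hY : Y.IsRigid) {T : Twist K}
    {f : V →ₛₗ[(T.aut : K →+* K)] W} (hf : Function.Bijective f)
    {r : NumberField.InfinitePlace K → ℝ} {ρ : HeightOneSpectrum (𝓞 K) → ℝ}
    (hr : ∀ v, 0 < r v) (hρ : ∀ v, 0 < ρ v) (hρ' : {v | ρ v ≠ 1}.Finite)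
    (h : X.ScalesBy Y T f r ρ) :
    Y.height = (((∏ v, r v ^ v.mult) * ∏ᶠ v, ρ v) ^ (1 / (finrank ℚ K : ℝ))) ^ finrank K V *
      X.height := by
  let b := finBasis K V
  obtain ⟨b', hb'⟩ := exists_basis_semilinear f T.aut.surjective hf b
  have h0 : 0 < (∏ v, r v ^ v.mult) * ∏ᶠ v, ρ v :=
    mul_pos (Finset.prod_pos fun v _ => pow_pos (hr v) _) (finprod_pos_of_pos hρ)
  rw [hX.height_eq b, hY.height_eq b', ← Real.rpow_natCast, ← Real.rpow_mul h0.le, mul_comm (1 / _),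
    Real.rpow_mul h0.le, Real.rpow_natCast, ← Real.mul_rpow (pow_pos h0 _).le (detProd_pos _ _).le]
  congr 1
  simp only [detProd]
  -- The norm of `Y` at `T.place v` is compared with that of `X` at `v`, so the finite places of `Y`
  -- are reindexed first.
  rw [← finprod_comp_equiv T.place, mul_pow, finprod_pow hρ', mul_mul_mul_comm,
    ← Finset.prod_pow, ← Finset.prod_mul_distrib,
    ← finprod_mul_distrib _ (hX.hasFiniteMulSupport b)]
  · congr 1
    · refine Finset.prod_congr rfl fun v _ => ?_
      rw [absDet_semilinear_eq f (isNormKind_inf v) (isNormKind_inf v) (hX.inf v) (hY.inf v)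
        (T.norm_inf v) (hr v) (h.inf v) hf.2 hb', mul_pow, pow_right_comm]
    · refine finprod_congr fun v => ?_
      rw [absDet_semilinear_eq f (isNormKind_fin v) (isNormKind_fin _) (hX.fin v) (hY.fin _)
        (T.norm_fin v) (hρ v) (h.fin v) hf.2 hb']
  · refine hρ'.subset fun v hv h1 => hv ?_
    simp [h1]

variable (K) in
/-- The identity twist. -/
def _root_.RigidAdelic.Twist.id : Twist K where
  aut := RingEquiv.refl K
  place := Equiv.refl _
  inf _ := RingEquiv.refl _
  fin _ := RingEquiv.refl _
  norm_inf _ _ := rfl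
  norm_fin _ _ := rfl
  inf_algebraMap _ _ := rfl
  fin_algebraMap _ _ := rfl

/-- Hadamard with `r = 1` bounds each local determinant. This inequality is the source of
submodularity. -/
theorem height_le_of_norm_le [Module.Finite K V] [Module.Finite K W] {X : AdelicSpace K V}
    {Y : AdelicSpace K W} (hX : X.IsRigid) (hY : Y.IsRigid) (f : V →ₗ[K] W)
    (hf : Function.Bijective f)
    (hinf : ∀ (v : NumberField.InfinitePlace K) x,
      Y.inf v (f.baseChange v.Completion x) ≤ X.inf v x)
    (hfin : ∀ v x, Y.fin v (f.baseChange (v.adicCompletion K) x) ≤ X.fin v x) :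
    Y.height ≤ X.height := by
  let b := finBasis K V
  obtain ⟨b', hb'⟩ := exists_basis_semilinear f Function.surjective_id hf b
  have key : ∀ (L : Type _) [NormedField L] [Algebra K L]
      {ν : ∀ (ι : Type) [Fintype ι], (ι → ℝ) → ℝ} {comb : ℝ → ℝ → ℝ} (_ : IsNormKind ν comb L)
      {N : L ⊗[K] V → ℝ} {N' : L ⊗[K] W → ℝ} (_ : HasON ν L N) (_ : HasON ν L N')
      (_ : ∀ x, N' (f.baseChange L x) ≤ N x),
      absDet L (IsON ν N') b' ≤ absDet L (IsON ν N) b := by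
    intro L _ _ ν comb hk N N' hN hN' hle
    have := absDet_semilinear_le (s := RingHom.id K) (RingHom.id L) (fun _ => rfl) f hk hk hN hN'
      (fun _ => rfl) (r := 1) (fun x => ?_) hb'
    · simpa using this
    · rw [one_mul]
      convert hle x using 2
      induction x with
      | zero => simp
      | add x y hx hy => simp [hx, hy]
      | tmul l x => simp
  rw [hX.height_eq b, hY.height_eq b']
  refine Real.rpow_le_rpow (detProd_pos _ _).le ?_ (by positivity)
  refine mul_le_mul ?_ ?_ (finprod_pos_of_pos fun _ => absDet_pos _ _).le
    (Finset.prod_pos fun _ _ => pow_pos (absDet_pos _ _) _).le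
  · refine Finset.prod_le_prod (fun _ _ => (pow_pos (absDet_pos _ _) _).le) fun v _ => ?_
    exact pow_le_pow_left₀ (absDet_pos _ _).le
      (key _ (isNormKind_inf v) (hX.inf v) (hY.inf v) (hinf v)) _
  · have h1 := hX.hasFiniteMulSupport b
    have h2 := hY.hasFiniteMulSupport b'
    -- Both products are written over the union of their finite supports, so that they can be
    -- compared factor by factor.
    rw [finprod_eq_prod_of_mulSupport_subset (s := (h1.union h2).toFinset) _ (by simp),
      finprod_eq_prod_of_mulSupport_subset (s := (h1.union h2).toFinset) _ (by simp)]
    exact Finset.prod_le_prod (fun _ _ => (absDet_pos _ _).le) fun v _ =>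
      key _ (isNormKind_fin v) (hX.fin v) (hY.fin v) (hfin v)

end AdelicSpace

/-! ### Slope filtrations of a submodular function -/

/-- The combinatorial form of the Grayson–Stuhler filtration: for a function `h` on subspaces,
`E (i + 1)` is the largest among the subspaces of minimal slope over `E i`. -/
structure IsSlopeFiltration {K V : Type*} [Field K] [AddCommGroup V] [Module K V]
    (h : Submodule K V → ℝ) (ℓ : ℕ) (E : ℕ → Submodule K V) (s : ℕ → ℝ) : Prop where
  zero : E 0 = ⊥
  length : E ℓ = ⊤
  lt_succ : ∀ i < ℓ, E i < E (i + 1)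
  eq : ∀ i < ℓ, h (E (i + 1)) - h (E i) = s i * (finrank K (E (i + 1)) - finrank K (E i))
  minimal : ∀ i < ℓ, ∀ G, E i ≤ G → s i * (finrank K G - finrank K (E i)) ≤ h G - h (E i)
  maximum : ∀ i < ℓ, ∀ G, E i ≤ G → h G - h (E i) = s i * (finrank K G - finrank K (E i)) →
    G ≤ E (i + 1)

namespace IsSlopeFiltration

variable {K V : Type*} [Field K] [AddCommGroup V] [Module K V] [Module.Finite K V]
  {h : Submodule K V → ℝ} {ℓ : ℕ} {E : ℕ → Submodule K V} {s : ℕ → ℝ}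

omit [Module.Finite K V] in
theorem mono (H : IsSlopeFiltration h ℓ E s) {i j : ℕ} (hij : i ≤ j) (hj : j ≤ ℓ) :
    E i ≤ E j := by
  induction j, hij using Nat.le_induction with
  | base => exact le_rfl
  | succ j _ ih => exact (ih (by omega)).trans (H.lt_succ j (by omega)).le

omit [Module.Finite K V] in
theorem strictMono (H : IsSlopeFiltration h ℓ E s) {i j : ℕ} (hij : i < j) (hj : j ≤ ℓ) :
    E i < E j :=
  (H.lt_succ i (by omega)).trans_le (H.mono hij hj)

/-- The slope of `E (i + 2)` over `E i` is a weighted mean of `s i` and `s (i + 1)`. It exceeds `s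
i` because `E (i + 2)` is not contained in `E (i + 1)`, the largest subspace of minimal slope over
`E i`. -/
theorem slope_lt_succ (H : IsSlopeFiltration h ℓ E s) {i : ℕ} (hi : i + 1 < ℓ) :
    s i < s (i + 1) := by
  have h1 := H.eq i (by omega)
  have h2 := H.eq (i + 1) hi
  have h3 := H.minimal i (by omega) (E (i + 2)) (H.mono (by omega) (by omega))
  have h4 : h (E (i + 2)) - h (E i) ≠ s i * (finrank K (E (i + 2)) - finrank K (E i)) := fun h0 =>
    (H.lt_succ (i + 1) hi).not_ge (H.maximum i (by omega) _ (H.mono (by omega) (by omega)) h0)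
  have h5 := lt_of_le_of_ne h3 h4.symm
  have h6 : (finrank K (E (i + 1)) : ℝ) < finrank K (E (i + 2)) :=
    Nat.cast_lt.2 (Submodule.finrank_lt_finrank_of_lt (H.lt_succ (i + 1) hi))
  simp only [add_assoc, Nat.reduceAdd] at h2
  nlinarith

theorem slope_mono (H : IsSlopeFiltration h ℓ E s) {i j : ℕ} (hij : i ≤ j) (hj : j < ℓ) :
    s i ≤ s j := by
  induction j, hij using Nat.le_induction with
  | base => exact le_rfl
  | succ j _ ih => exact (ih (by omega)).trans (H.slope_lt_succ hj).le

/-- Minimality is applied to `F ⊓ E (i + 1) ⊔ E i`, and submodularity carries the bound to `F ⊓ E (i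
+ 1)` over `F ⊓ E i`. -/
theorem step_le (H : IsSlopeFiltration h ℓ E s)
    (hsub : ∀ F G, h (F ⊔ G) + h (F ⊓ G) ≤ h F + h G) {i : ℕ} (hi : i < ℓ) (F : Submodule K V) :
    s i * ((finrank K ↥(F ⊓ E (i + 1)) : ℝ) - finrank K ↥(F ⊓ E i)) ≤
      h (F ⊓ E (i + 1)) - h (F ⊓ E i) := by
  have h1 := hsub (F ⊓ E (i + 1)) (E i)
  have h2 : F ⊓ E (i + 1) ⊓ E i = F ⊓ E i := by
    rw [inf_assoc, inf_eq_right.2 (H.lt_succ i hi).le]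
  have h3 := H.minimal i hi (F ⊓ E (i + 1) ⊔ E i) le_sup_right
  have h4 : (finrank K ↥(F ⊓ E (i + 1) ⊔ E i) : ℝ) + finrank K ↥(F ⊓ E (i + 1) ⊓ E i) =
      finrank K ↥(F ⊓ E (i + 1)) + finrank K (E i) :=
    mod_cast Submodule.finrank_sup_add_finrank_inf_eq _ _
  rw [h2] at h1 h4
  have h5 : (finrank K ↥(F ⊓ E (i + 1) ⊔ E i) : ℝ) - finrank K (E i) =
    finrank K ↥(F ⊓ E (i + 1)) - finrank K ↥(F ⊓ E i) := by linarith
  rw [h5] at h3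
  linarith

theorem finrank_step_nonneg (H : IsSlopeFiltration h ℓ E s) {i : ℕ} (hi : i < ℓ)
    (F : Submodule K V) :
    0 ≤ (finrank K ↥(F ⊓ E (i + 1)) : ℝ) - finrank K ↥(F ⊓ E i) :=
  sub_nonneg.2 (Nat.cast_le.2
    (Submodule.finrank_mono (inf_le_inf_left F (H.lt_succ i hi).le)))

theorem finrank_step_le (H : IsSlopeFiltration h ℓ E s) {i : ℕ} (hi : i < ℓ)
    (F : Submodule K V) :
    (finrank K ↥(F ⊓ E (i + 1)) : ℝ) - finrank K ↥(F ⊓ E i) ≤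
      finrank K (E (i + 1)) - finrank K (E i) := by
  have h4 : (finrank K ↥(F ⊓ E (i + 1) ⊔ E i) : ℝ) + finrank K ↥(F ⊓ E (i + 1) ⊓ E i) =
      finrank K ↥(F ⊓ E (i + 1)) + finrank K (E i) :=
    mod_cast Submodule.finrank_sup_add_finrank_inf_eq _ _
  have h2 : F ⊓ E (i + 1) ⊓ E i = F ⊓ E i := by
    rw [inf_assoc, inf_eq_right.2 (H.lt_succ i hi).le]
  have h5 : (finrank K ↥(F ⊓ E (i + 1) ⊔ E i) : ℝ) ≤ finrank K (E (i + 1)) :=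
    Nat.cast_le.2 (Submodule.finrank_mono (sup_le inf_le_right (H.lt_succ i hi).le))
  rw [h2] at h4
  linarith

omit [Module.Finite K V] in
theorem sum_steps (H : IsSlopeFiltration h ℓ E s) (F : Submodule K V) (u : Submodule K V → ℝ) :
    ∑ i ∈ Finset.range ℓ, (u (F ⊓ E (i + 1)) - u (F ⊓ E i)) = u F - u ⊥ := by
  rw [Finset.sum_range_sub (fun i => u (F ⊓ E i)), H.length, H.zero, inf_top_eq, inf_bot_eq]

/-- Comparison of one step of the filtrations induced on `F` and on `E k`. -/
theorem step_compare (H : IsSlopeFiltration h ℓ E s)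
    (hsub : ∀ F G, h (F ⊔ G) + h (F ⊓ G) ≤ h F + h G) {k : ℕ} (hk : k ≤ ℓ) {t : ℝ}
    (h1 : ∀ i < k, s i ≤ t) (h2 : ∀ i < ℓ, k ≤ i → t ≤ s i) (F : Submodule K V) {i : ℕ}
    (hi : i < ℓ) :
    (h (E k ⊓ E (i + 1)) - t * finrank K ↥(E k ⊓ E (i + 1))) -
        (h (E k ⊓ E i) - t * finrank K ↥(E k ⊓ E i)) +
      |s i - t| * |((finrank K ↥(F ⊓ E (i + 1)) : ℝ) - finrank K ↥(F ⊓ E i)) -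
        (finrank K ↥(E k ⊓ E (i + 1)) - finrank K ↥(E k ⊓ E i))| ≤
      (h (F ⊓ E (i + 1)) - t * finrank K ↥(F ⊓ E (i + 1))) -
        (h (F ⊓ E i) - t * finrank K ↥(F ⊓ E i)) := by
  have hs := H.step_le hsub hi F
  -- Below `k`, the step of `E k` is the full step of the filtration, and the dimension missing from
  -- `F` costs `t - s i` per unit. From `k` on, the step of `E k` is zero, and each dimension gained
  -- by `F` costs `s i - t`.
  rcases lt_or_ge i k with hik | hik
  · rw [inf_eq_right.2 (H.mono (i := i + 1) hik hk), inf_eq_right.2 (H.mono hik.le hk)]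
    have ha := H.finrank_step_le hi F
    have he := H.eq i hi
    rw [abs_of_nonpos (sub_nonpos.2 (h1 i hik)), abs_of_nonpos (sub_nonpos.2 ha)]
    linarith
  · rw [inf_eq_left.2 (H.mono hik hi.le), inf_eq_left.2 (H.mono (hik.trans (Nat.le_succ i)) hi)]
    have ha := H.finrank_step_nonneg hi F
    rw [abs_of_nonneg (sub_nonneg.2 (h2 i hi hik)), sub_self, sub_self, sub_zero,
      abs_of_nonneg ha]
    linarith

/-- The comparison of single steps telescopes along the filtration. -/
theorem le_of_slopes (H : IsSlopeFiltration h ℓ E s)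
    (hsub : ∀ F G, h (F ⊔ G) + h (F ⊓ G) ≤ h F + h G) {k : ℕ} (hk : k ≤ ℓ) {t : ℝ}
    (h1 : ∀ i < k, s i ≤ t) (h2 : ∀ i < ℓ, k ≤ i → t ≤ s i) (F : Submodule K V) :
    h (E k) - t * finrank K (E k) ≤ h F - t * finrank K F := by
  have h3 := H.sum_steps F fun F => h F - t * finrank K F
  have h4 := H.sum_steps (E k) fun F => h F - t * finrank K F
  have h5 := Finset.sum_le_sum fun i (hi : i ∈ Finset.range ℓ) =>
    (le_add_of_nonneg_right (mul_nonneg (abs_nonneg _) (abs_nonneg _))).trans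
      (H.step_compare hsub hk h1 h2 F (Finset.mem_range.1 hi))
  linarith

/-- Equality would force equality in every step; as `s i ≠ t`, the filtrations induced on `F` and on
`E k` would then have equal dimensions throughout. -/
theorem lt_of_slopes (H : IsSlopeFiltration h ℓ E s)
    (hsub : ∀ F G, h (F ⊔ G) + h (F ⊓ G) ≤ h F + h G) {k : ℕ} (hk : k ≤ ℓ) {t : ℝ}
    (h1 : ∀ i < k, s i < t) (h2 : ∀ i < ℓ, k ≤ i → t < s i) (F : Submodule K V) (hF : F ≠ E k) :
    h (E k) - t * finrank K (E k) < h F - t * finrank K F := by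
  by_contra! hcon
  have h3 := H.sum_steps F fun F => h F - t * finrank K F
  have h4 := H.sum_steps (E k) fun F => h F - t * finrank K F
  have hc := fun i (hi : i ∈ Finset.range ℓ) =>
    H.step_compare hsub hk (fun i hi => (h1 i hi).le) (fun i hi hki => (h2 i hi hki).le) F
      (Finset.mem_range.1 hi)
  have hle := fun i (hi : i ∈ Finset.range ℓ) =>
    (le_add_of_nonneg_right (mul_nonneg (abs_nonneg _) (abs_nonneg _))).trans (hc i hi)
  have heq := (Finset.sum_eq_sum_iff_of_le hle).1
    (le_antisymm (Finset.sum_le_sum hle) (by linarith))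
  have ha : ∀ i < ℓ, ((finrank K ↥(F ⊓ E (i + 1)) : ℝ) - finrank K ↥(F ⊓ E i)) =
      finrank K ↥(E k ⊓ E (i + 1)) - finrank K ↥(E k ⊓ E i) := by
    intro i hi
    have h5 := hc i (Finset.mem_range.2 hi)
    rw [heq i (Finset.mem_range.2 hi)] at h5
    have h6 : 0 < |s i - t| := by
      rw [abs_pos, sub_ne_zero]
      rcases lt_or_ge i k with hik | hik
      exacts [(h1 i hik).ne, (h2 i hi hik).ne']
    by_contra hne
    have h7 := mul_pos h6 (abs_pos.2 (sub_ne_zero.2 hne))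
    linarith
  have hd : ∀ j ≤ ℓ, finrank K ↥(F ⊓ E j) = finrank K ↥(E k ⊓ E j) := by
    intro j
    induction j with
    | zero => intro _; rw [H.zero, inf_bot_eq, inf_bot_eq]
    | succ j ih =>
      intro hj
      have h8 := ha j hj
      rw [ih (by omega)] at h8
      exact_mod_cast sub_left_injective h8
  -- Equal dimensions at `k` give `E k ≤ F`; equal dimensions at `ℓ` then give `F = E k`.
  have h9 := hd k hk
  rw [inf_idem] at h9
  have h10 := Submodule.eq_of_le_of_finrank_eq (inf_le_right : F ⊓ E k ≤ E k) h9
  have h11 := hd ℓ le_rfl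
  rw [H.length, inf_top_eq, inf_top_eq] at h11
  exact hF (Submodule.eq_of_le_of_finrank_eq (inf_eq_right.1 h10) h11.symm).symm

/-- A value strictly between the two slopes adjacent to `k`; at either end of the filtration,
shifting the extreme slope by `1` is enough. -/
theorem exists_separating (H : IsSlopeFiltration h ℓ E s) {k : ℕ} :
    ∃ t, (∀ i < k, k ≤ ℓ → s i < t) ∧ ∀ i < ℓ, k ≤ i → t < s i := by
  rcases Nat.eq_zero_or_pos k with rfl | hk
  · refine ⟨s 0 - 1, by simp, fun i hi _ => ?_⟩
    have := H.slope_mono (Nat.zero_le i) hi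
    linarith
  obtain ⟨k, rfl⟩ := Nat.exists_eq_add_of_le' hk
  rcases lt_or_ge (k + 1) ℓ with hkl | hkl
  · obtain ⟨t, ht1, ht2⟩ := exists_between (H.slope_lt_succ hkl)
    exact ⟨t, fun i hi _ => (H.slope_mono (by omega) (by omega)).trans_lt ht1,
      fun i hi hki => ht2.trans_le (H.slope_mono hki hi)⟩
  · refine ⟨s k + 1, fun i hi hl => ?_, fun i hi hki => by omega⟩
    have := H.slope_mono (i := i) (j := k) (by omega) (by omega)
    linarith

/-- The index `k` is the first from which all slopes are at least `t`. Weak inequalities suffice to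
make `E k` a minimiser, though perhaps not the only one. -/
theorem exists_index (H : IsSlopeFiltration h ℓ E s) (t : ℝ) :
    ∃ k ≤ ℓ, (∀ i < k, s i ≤ t) ∧ ∀ i < ℓ, k ≤ i → t ≤ s i := by
  classical
  have hex : ∃ k, ∀ i < ℓ, k ≤ i → t ≤ s i := ⟨ℓ, fun i hi hi' => by omega⟩
  have hle : Nat.find hex ≤ ℓ := Nat.find_min' hex fun i hi hi' => by omega
  refine ⟨Nat.find hex, hle, fun i hi => ?_, Nat.find_spec hex⟩
  have hpred := Nat.find_min hex (m := Nat.find hex - 1) (by omega)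
  push Not at hpred
  obtain ⟨j, hj, hj', hjt⟩ := hpred
  have : i ≤ j := by omega
  exact (H.slope_mono this hj).trans hjt.le

/-- An order-reversing bijection of the lattice of subspaces that changes `h` by an affine
function of the dimension reverses the filtration. -/
theorem eq_of_duality (H : IsSlopeFiltration h ℓ E s)
    (hsub : ∀ F G, h (F ⊔ G) + h (F ⊓ G) ≤ h F + h G) (p : Submodule K V → Submodule K V)
    (hp : ∀ F G, F ≤ G → p G ≤ p F) (hps : Function.Bijective p)
    (hd : ∀ F, finrank K (p F) + finrank K F = finrank K V) {α β : ℝ}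
    (hh : ∀ F, h (p F) = h F + α + β * finrank K F) {i : ℕ} (hi : i ≤ ℓ) :
    p (E (ℓ - i)) = E i := by
  have hd' : ∀ F, (finrank K (p F) : ℝ) = finrank K V - finrank K F := fun F => by
    rw [eq_sub_iff_add_eq]
    exact_mod_cast hd F
  have key : ∀ k, ∃ j, k ≤ ℓ → j ≤ ℓ ∧ p (E k) = E j := by
    intro k
    by_cases hk : k ≤ ℓ
    swap
    · exact ⟨0, fun h => absurd h hk⟩
    obtain ⟨t, ht1, ht2⟩ := H.exists_separating (k := k)
    -- By `hh` and `hd`, the value of `h - (-t - β) dim` at `p F` is that of `h - t dim` at `F` plus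
    -- a constant. So the preimage under `p` of the minimiser `E j` minimises `h - t dim`, and
    -- uniqueness makes it `E k`.
    obtain ⟨j, hj, hj1, hj2⟩ := H.exists_index (-t - β)
    refine ⟨j, fun _ => ⟨hj, ?_⟩⟩
    obtain ⟨G, hG⟩ := hps.2 (E j)
    rw [← hG]
    congr 1
    by_contra hne
    have h1 := H.lt_of_slopes hsub hk (fun i hi => ht1 i hi hk) ht2 G (Ne.symm hne)
    have h2 := H.le_of_slopes hsub hj hj1 hj2 (p (E k))
    rw [← hG, hh, hh, hd', hd'] at h2
    linarith
  choose f hf using key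
  -- A strictly decreasing map of `{0, …, ℓ}` to itself is `k ↦ ℓ - k`; the bounds `hup` and `hlow`
  -- come from counting up from `0` and down from `ℓ`.
  have hanti : ∀ a b, a < b → b ≤ ℓ → f b < f a := by
    intro a b hab hb
    by_contra! hcon
    have h1 := H.strictMono hab hb
    have h2 := hp _ _ h1.le
    have h3 := H.mono hcon (hf b hb).1
    rw [← (hf a (by omega)).2, ← (hf b hb).2] at h3
    exact h1.ne (hps.1 (le_antisymm h3 h2))
  have hup : ∀ k, k ≤ ℓ → f k + k ≤ ℓ := by
    intro k
    induction k with
    | zero => intro h0; simpa using (hf 0 h0).1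
    | succ k ih =>
      intro hk
      have := hanti k (k + 1) (by omega) hk
      have := ih (by omega)
      omega
  have hlow : ∀ k, k ≤ ℓ → k ≤ f (ℓ - k) := by
    intro k
    induction k with
    | zero => intro _; omega
    | succ k ih =>
      intro hk
      have := hanti (ℓ - (k + 1)) (ℓ - k) (by omega) (by omega)
      have := ih (by omega)
      omega
  have hfi : f (ℓ - i) = i := by
    have := hup (ℓ - i) (by omega)
    have := hlow i hi
    omega
  rw [(hf (ℓ - i) (by omega)).2, hfi]

end IsSlopeFiltration

/-- The fibre of `q` over a point coming from `j` is the image under `g` of the fibre of `q'`,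
because the kernel of `q` comes from `i`. Both infima are therefore over the same set of values. -/
theorem fibreNorm_comp_eq {M M₁ M' Q Q' : Type*} [AddCommGroup M] [AddCommGroup M']
    [AddCommGroup Q] [AddCommGroup Q'] [AddCommGroup M₁] (N : M → ℝ) (i : M₁ →+ M') (g : M' →+ M)
    (q : M →+ Q) (q' : M' →+ Q') (j : Q' →+ Q) (hj : ∀ x, j (q' x) = q (g x))
    (hq : ∀ x, q x = 0 → ∃ y, x = g (i y)) (hi : ∀ x, q' (i x) = 0)
    (hs : Function.Surjective q') (y : Q') :
    fibreNorm N q (j y) = fibreNorm (fun x => N (g x)) q' y := by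
  rw [fibreNorm, fibreNorm]
  congr 1
  ext r
  constructor
  · rintro ⟨x, hx, rfl⟩
    obtain ⟨z, rfl⟩ := hs y
    obtain ⟨w, hw⟩ := hq (x - g z) (by rw [map_sub, hx, hj, sub_self])
    refine ⟨z + i w, by rw [map_add, hi, add_zero], ?_⟩
    rw [map_add, ← hw, add_sub_cancel]
  · rintro ⟨z, rfl, rfl⟩
    exact ⟨g z, (hj z).symm, rfl⟩

/-! ### Subquotients, submodularity and the passage to slopes -/

namespace AdelicSpace

section

variable {K : Type*} [Field K] {V : Type*} [AddCommGroup V] [Module K V]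
  {W : Type*} [AddCommGroup W] [Module K W]

theorem isShortExact_subtype_mkQ (F : Submodule K V) : IsShortExact F.subtype F.mkQ where
  inj := F.subtype_injective
  surj := F.mkQ_surjective
  exact := LinearMap.exact_subtype_mkQ F

theorem subtype_baseChange_inclusion {L : Type*} [NormedField L] [Algebra K L]
    {F G : Submodule K V} (h : F ≤ G) (x : L ⊗[K] F) :
    G.subtype.baseChange L ((Submodule.inclusion h).baseChange L x) = F.subtype.baseChange L x := by
  rw [← LinearMap.comp_apply, ← LinearMap.baseChange_comp, Submodule.subtype_comp_inclusion]

theorem finrank_map_mkQ [Module.Finite K V] {F G : Submodule K V} (h : F ≤ G) :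
    (finrank K (G.map F.mkQ) : ℝ) = finrank K G - finrank K F := by
  have h1 := LinearMap.finrank_range_add_finrank_ker (F.mkQ.domRestrict G)
  rw [LinearMap.range_domRestrict, LinearMap.ker_domRestrict, Submodule.ker_mkQ] at h1
  have h2 : finrank K (F.submoduleOf G) = finrank K F :=
    (Submodule.submoduleOfEquivOfLe h).finrank_eq
  rw [Submodule.submoduleOf] at h2
  rw [h2] at h1
  rw [eq_sub_iff_add_eq]
  exact_mod_cast h1

theorem semiMap_subtype {s : K →+* K} {L L' : Type*} [NormedField L] [Algebra K L] [NormedField L']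
    [Algebra K L'] (c : L →+* L') (hc : ∀ a, c (algebraMap K L a) = algebraMap K L' (s a))
    {f : V →ₛₗ[s] W} {A : Submodule K V} {B : Submodule K W} {g : A →ₛₗ[s] B}
    (h : ∀ x, (g x : W) = f x) (x : L ⊗[K] A) :
    B.subtype.baseChange L' (semiMap c hc g x) = semiMap c hc f (A.subtype.baseChange L x) := by
  induction x with
  | zero => simp
  | add x y hx hy => simp [hx, hy]
  | tmul l x => simp [h]

end

variable {K : Type*} [Field K] [NumberField K]
variable {V : Type*} [AddCommGroup V] [Module K V]

theorem isExact_sub_quotient (X : AdelicSpace K V) (F : Submodule K V) :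
    IsExact (X.sub F) X (X.quotient F) F.subtype F.mkQ where
  toIsShortExact := isShortExact_subtype_mkQ F
  left_inf _ _ := rfl
  left_fin _ _ := rfl
  right_inf _ _ := rfl
  right_fin _ _ := rfl

theorem isExact_subquotient (X : AdelicSpace K V) {F G : Submodule K V} (h : F ≤ G) :
    IsExact (X.sub F) (X.sub G) (X.subquotient F G) (Submodule.inclusion h)
      (F.submoduleOf G).mkQ where
  inj := Submodule.inclusion_injective h
  surj := Submodule.mkQ_surjective _
  exact := by
    intro x
    refine (Submodule.Quotient.mk_eq_zero _).trans ?_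
    change (x : V) ∈ F ↔ _
    exact ⟨fun hx => ⟨⟨x, hx⟩, rfl⟩, by rintro ⟨y, rfl⟩; exact y.2⟩
  left_inf v x := congrArg (X.inf v) (subtype_baseChange_inclusion h x).symm
  left_fin v x := congrArg (X.fin v) (subtype_baseChange_inclusion h x).symm
  right_inf _ _ := rfl
  right_fin _ _ := rfl

/-- All lifts to the ambient space of a class in `G / F` lie in `G`, so the norm induced from the
quotient by `F` is the quotient norm of `G` by `F`. -/
theorem isExact_quotient_sub (X : AdelicSpace K V) {F G : Submodule K V} (h : F ≤ G) :
    IsExact (X.sub F) (X.sub G) ((X.quotient F).sub (G.map F.mkQ)) (Submodule.inclusion h)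
      (F.mkQ.submoduleMap G) := by
  have hS : IsShortExact (Submodule.inclusion h) (F.mkQ.submoduleMap G) :=
    { inj := Submodule.inclusion_injective h
      surj := F.mkQ.submoduleMap_surjective G
      exact := by
        intro x
        rw [← Submodule.coe_eq_zero, LinearMap.submoduleMap_coe_apply, Submodule.mkQ_apply,
          Submodule.Quotient.mk_eq_zero]
        exact ⟨fun hx => ⟨⟨x, hx⟩, rfl⟩, by rintro ⟨y, rfl⟩; exact y.2⟩ }
  have key : ∀ (L : Type _) [NormedField L] [Algebra K L] (N : L ⊗[K] V → ℝ)
      (y : L ⊗[K] (G.map F.mkQ)),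
      fibreNorm N (F.mkQ.baseChange L) ((G.map F.mkQ).subtype.baseChange L y) =
      fibreNorm (fun x => N (G.subtype.baseChange L x))
        ((F.mkQ.submoduleMap G).baseChange L) y := by
    intro L _ _ N y
    refine fibreNorm_comp_eq N ((Submodule.inclusion h).baseChange L).toAddMonoidHom
      (G.subtype.baseChange L).toAddMonoidHom (F.mkQ.baseChange L).toAddMonoidHom
      ((F.mkQ.submoduleMap G).baseChange L).toAddMonoidHom
      ((G.map F.mkQ).subtype.baseChange L).toAddMonoidHom ?_ ?_ ?_ (hS.baseChange L).surj y
    · intro x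
      simp only [LinearMap.toAddMonoidHom_coe]
      rw [← LinearMap.comp_apply, ← LinearMap.comp_apply, ← LinearMap.baseChange_comp,
        ← LinearMap.baseChange_comp]
      rfl
    · intro x hx
      obtain ⟨w, rfl⟩ := (((isShortExact_subtype_mkQ F).baseChange L).exact x).1 hx
      exact ⟨w, (subtype_baseChange_inclusion h w).symm⟩
    · exact fun x => (hS.baseChange L).exact.apply_apply_eq_zero x
  exact
    { toIsShortExact := hS
      left_inf v x := congrArg (X.inf v) (subtype_baseChange_inclusion h x).symm
      left_fin v x := congrArg (X.fin v) (subtype_baseChange_inclusion h x).symm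
      right_inf v y := key _ (X.inf v) y
      right_fin v y := key _ (X.fin v) y }

section

variable [Module.Finite K V] {X : AdelicSpace K V}

theorem IsRigid.sub (hX : X.IsRigid) (F : Submodule K V) : (X.sub F).IsRigid :=
  (isExact_sub_quotient X F).isRigid_left hX

theorem IsRigid.quotient (hX : X.IsRigid) (F : Submodule K V) : (X.quotient F).IsRigid :=
  (isExact_sub_quotient X F).isRigid_right hX

theorem IsRigid.subquotient (hX : X.IsRigid) (F G : Submodule K V) :
    (X.subquotient F G).IsRigid :=
  (hX.sub G).quotient _

variable (X) in
/-- The logarithm of the height of a subspace. -/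
def logHeight (F : Submodule K V) : ℝ := Real.log (X.sub F).height

theorem logHeight_subquotient (hX : X.IsRigid) {F G : Submodule K V} (h : F ≤ G) :
    Real.log (X.subquotient F G).height = X.logHeight G - X.logHeight F := by
  rw [logHeight, logHeight, (isExact_subquotient X h).height_eq (hX.sub G),
    Real.log_mul (height_pos _).ne' (height_pos _).ne']
  ring

theorem logHeight_quotient_sub (hX : X.IsRigid) {F G : Submodule K V} (h : F ≤ G) :
    Real.log ((X.quotient F).sub (G.map F.mkQ)).height = X.logHeight G - X.logHeight F := by
  rw [logHeight, logHeight, (isExact_quotient_sub X h).height_eq (hX.sub G),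
    Real.log_mul (height_pos _).ne' (height_pos _).ne']
  ring

/-- The second isomorphism theorem does not increase norms. -/
theorem logHeight_submodular (hX : X.IsRigid) (F G : Submodule K V) :
    X.logHeight (F ⊔ G) + X.logHeight (F ⊓ G) ≤ X.logHeight F + X.logHeight G := by
  have h1 := logHeight_subquotient hX (inf_le_left : F ⊓ G ≤ F)
  have h2 := logHeight_subquotient hX (le_sup_right : G ≤ F ⊔ G)
  suffices h : (X.subquotient G (F ⊔ G)).height ≤ (X.subquotient (F ⊓ G) F).height by
    have := Real.log_le_log (height_pos _) h
    linarith
  -- A lift to `F` is also a lift to `F ⊔ G`, so the infimum defining the norm on the target runs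
  -- over more vectors.
  let f : (F ⧸ (F ⊓ G).submoduleOf F) →ₗ[K] (↥(F ⊔ G) ⧸ G.submoduleOf (F ⊔ G)) :=
    Submodule.mapQ _ _ (Submodule.inclusion (le_sup_left : F ≤ F ⊔ G)) fun x hx => hx.2
  have hf : Function.Bijective f := by
    constructor
    · rw [injective_iff_map_eq_zero]
      intro x
      obtain ⟨x, rfl⟩ := Submodule.mkQ_surjective _ x
      intro hx
      have hx' : (x : V) ∈ G :=
        (Submodule.Quotient.mk_eq_zero (G.submoduleOf (F ⊔ G))).1 hx
      exact (Submodule.Quotient.mk_eq_zero _).2 ⟨x.2, hx'⟩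
    · intro y
      obtain ⟨⟨y, hy⟩, rfl⟩ := Submodule.mkQ_surjective _ y
      obtain ⟨a, ha, b, hb, rfl⟩ := Submodule.mem_sup.1 hy
      refine ⟨Submodule.mkQ _ ⟨a, ha⟩, ?_⟩
      refine (Submodule.Quotient.eq _).2 ?_
      change a - (a + b) ∈ G
      simpa using hb
  have key : ∀ (L : Type _) [NormedField L] [Algebra K L] (N : L ⊗[K] V → ℝ) (_ : ∀ x, 0 ≤ N x)
      (y : L ⊗[K] (F ⧸ (F ⊓ G).submoduleOf F)),
      fibreNorm (fun x => N ((F ⊔ G).subtype.baseChange L x))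
        ((G.submoduleOf (F ⊔ G)).mkQ.baseChange L) (f.baseChange L y) ≤
      fibreNorm (fun x => N (F.subtype.baseChange L x))
        (((F ⊓ G).submoduleOf F).mkQ.baseChange L) y := by
    intro L _ _ N hN y
    refine fibreNorm_le (fun x => hN _) ((isShortExact_subtype_mkQ _).baseChange L).surj
      ((Submodule.inclusion (le_sup_left : F ≤ F ⊔ G)).baseChange L) (f.baseChange L) ?_ ?_ y
    · intro x
      rw [← LinearMap.comp_apply, ← LinearMap.comp_apply, ← LinearMap.baseChange_comp,
        ← LinearMap.baseChange_comp]
      rfl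
    · intro x
      rw [subtype_baseChange_inclusion]
  exact height_le_of_norm_le (hX.subquotient _ _) (hX.subquotient _ _) f hf
    (fun v => key _ (X.inf v) ((hX.inf v).nonneg (isNormKind_inf v)))
    (fun v => key _ (X.fin v) ((hX.fin v).nonneg (isNormKind_fin v)))

theorem log_reducedHeight (hX : X.IsRigid) {F G : Submodule K V} (h : F ≤ G) :
    Real.log ((X.quotient F).sub (G.map F.mkQ)).reducedHeight =
      (X.logHeight G - X.logHeight F) / (finrank K G - finrank K F) := by
  rw [reducedHeight, Real.log_rpow (height_pos _), logHeight_quotient_sub hX h, finrank_map_mkQ h,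
    one_div, inv_mul_eq_div]

theorem reducedHeight_pos (Y : AdelicSpace K V) : 0 < Y.reducedHeight :=
  Real.rpow_pos_of_pos (height_pos _) _

/-- Nonzero subspaces of the quotient by `E i` correspond to subspaces strictly containing `E i`,
and their log reduced heights are slopes over `E i`. The slope conditions also allow `E i` itself,
where they hold trivially. -/
theorem IsGSFiltration.isSlopeFiltration (hX : X.IsRigid) {ℓ : ℕ} {E : ℕ → Submodule K V}
    (H : X.IsGSFiltration ℓ E) :
    IsSlopeFiltration X.logHeight ℓ E fun i => (X.logHeight (E (i + 1)) - X.logHeight (E i)) /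
      (finrank K (E (i + 1)) - finrank K (E i)) := by
  have hlt : ∀ i < ℓ, E i < E (i + 1) := by
    intro i hi
    refine lt_of_le_of_ne (H.le_succ i hi) fun h => (H.destabilizing i hi).ne_bot ?_
    rw [← h, ← LinearMap.range_domRestrict, LinearMap.range_eq_bot]
    ext x
    simp
  have hne : ∀ i G, E i ≤ G → G ≠ E i → G.map (E i).mkQ ≠ ⊥ := by
    intro i G hG hne h
    rw [← LinearMap.le_ker_iff_map, Submodule.ker_mkQ] at h
    exact hne (le_antisymm h hG)
  have hfr : ∀ {F G : Submodule K V}, F < G → (0 : ℝ) < finrank K G - finrank K F := fun h =>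
    sub_pos.2 (Nat.cast_lt.2 (Submodule.finrank_lt_finrank_of_lt h))
  refine ⟨H.zero, H.length, hlt, fun i hi => ?_, fun i hi G hG => ?_, fun i hi G hG heq => ?_⟩
  · rw [div_mul_cancel₀ _ (hfr (hlt i hi)).ne']
  · by_cases hGE : G = E i
    · rw [hGE, sub_self, sub_self, mul_zero]
    have h1 := (H.destabilizing i hi).minimal _ (hne i G hG hGE)
    have h2 := Real.log_le_log (reducedHeight_pos _) h1
    rw [log_reducedHeight hX hG, log_reducedHeight hX (H.le_succ i hi)] at h2
    exact (le_div_iff₀ (hfr (lt_of_le_of_ne hG (Ne.symm hGE)))).1 h2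
  · by_cases hGE : G = E i
    · rw [hGE]; exact H.le_succ i hi
    have h0 := hfr (lt_of_le_of_ne hG (Ne.symm hGE))
    have h1 := (H.destabilizing i hi).maximum _ (hne i G hG hGE) (by
      apply Real.log_injOn_pos (reducedHeight_pos _) (reducedHeight_pos _)
      rw [log_reducedHeight hX hG, log_reducedHeight hX (H.le_succ i hi), heq,
        mul_div_cancel_right₀ _ h0.ne'])
    rw [Submodule.map_le_iff_le_comap, Submodule.comap_map_mkQ] at h1
    exact h1.trans (sup_le (H.le_succ i hi) le_rfl)

end

/-! ### Orthogonals and the duality of heights -/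

section Twist

variable {W : Type*} [AddCommGroup W] [Module K W]

theorem _root_.RigidAdelic.Twist.mapInf_id (f : V →ₗ[K] W) (v : NumberField.InfinitePlace K)
    (x : v.Completion ⊗[K] V) : (Twist.id K).mapInf f v x = f.baseChange v.Completion x := by
  induction x with
  | zero => simp
  | add x y hx hy => rw [map_add, map_add, hx, hy]
  | tmul l x => rfl

theorem _root_.RigidAdelic.Twist.mapFin_id (f : V →ₗ[K] W) (v : HeightOneSpectrum (𝓞 K))
    (x : v.adicCompletion K ⊗[K] V) :
    (Twist.id K).mapFin f v x = f.baseChange (v.adicCompletion K) x := by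
  induction x with
  | zero => exact (map_zero _).trans (map_zero _).symm
  | add x y hx hy => exact (map_add _ x y).trans ((congrArg₂ (· + ·) hx hy).trans
      (map_add (f.baseChange (v.adicCompletion K)) x y).symm)
  | tmul l x => rfl

variable [Module.Finite K V] {X : AdelicSpace K V}

theorem height_eq_of_norm_eq [Module.Finite K W] {Y : AdelicSpace K W} (hX : X.IsRigid)
    (hY : Y.IsRigid) (f : V ≃ₗ[K] W)
    (hinf : ∀ (v : NumberField.InfinitePlace K) x,
      Y.inf v (f.toLinearMap.baseChange v.Completion x) = X.inf v x)
    (hfin : ∀ v x, Y.fin v (f.toLinearMap.baseChange (v.adicCompletion K) x) = X.fin v x) :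
    Y.height = X.height := by
  have key : ∀ (L : Type _) [NormedField L] [Algebra K L] (y : L ⊗[K] W),
      f.toLinearMap.baseChange L (f.symm.toLinearMap.baseChange L y) = y := by
    intro L _ _ y
    rw [← LinearMap.comp_apply, ← LinearMap.baseChange_comp, LinearEquiv.comp_symm,
      LinearMap.baseChange_id, LinearMap.id_apply]
  refine le_antisymm
    (height_le_of_norm_le hX hY f.toLinearMap f.bijective (fun v x => (hinf v x).le)
      fun v x => (hfin v x).le)
    (height_le_of_norm_le hY hX f.symm.toLinearMap f.symm.bijective (fun v y => ?_) fun v y => ?_)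
  · rw [← hinf, key]
  · rw [← hfin, key]

/-- The annihilator of `F` is isometric to the dual of the quotient by `F`. -/
theorem IsRigid.height_dualAnnihilator (hX : X.IsRigid) (F : Submodule K V) :
    (X.dual.sub F.dualAnnihilator).height * (X.quotient F).height = 1 := by
  rw [← (hX.quotient F).height_dual]
  congr 1
  have hf : F.dualAnnihilator.subtype ∘ₗ F.dualQuotEquivDualAnnihilator.toLinearMap =
      F.mkQ.dualMap := by
    ext φ x
    rfl
  have key : ∀ {ν : ∀ (ι : Type) [Fintype ι], (ι → ℝ) → ℝ} {comb : ℝ → ℝ → ℝ} (L : Type _)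
      [NormedField L] [Algebra K L] (_ : IsNormKind ν comb L) (N : L ⊗[K] V → ℝ)
      (_ : HasON ν L N) (φ : L ⊗[K] Dual K (V ⧸ F)),
      opNorm N (evalDual L (F.dualAnnihilator.subtype.baseChange L
        (F.dualQuotEquivDualAnnihilator.toLinearMap.baseChange L φ))) =
      opNorm (fibreNorm N (F.mkQ.baseChange L)) (evalDual L φ) := by
    intro ν comb L _ _ hk N hN φ
    obtain ⟨n, e, he⟩ := hN
    have h1 := LinearMap.congr_fun (congrArg (LinearMap.baseChange L) hf) φ
    rw [LinearMap.baseChange_comp, LinearMap.comp_apply] at h1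
    rw [opNorm_fibreNorm hk he ((isShortExact_subtype_mkQ F).baseChange L), h1, evalDual_dualMap]
    rfl
  exact height_eq_of_norm_eq (hX.quotient F).dual (hX.dual.sub _) F.dualQuotEquivDualAnnihilator
    (fun v φ => key _ (isNormKind_inf v) _ (hX.inf v) φ)
    (fun v φ => key _ (isNormKind_fin v) _ (hX.fin v) φ)

variable {T : Twist K} {σ : V →ₛₗ[(T.aut : K →+* K)] Dual K V}
  {r : NumberField.InfinitePlace K → ℝ} {ρ : HeightOneSpectrum (𝓞 K) → ℝ}

/-- Injectivity follows from definiteness of the norm at one infinite place. A basis then maps to an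
independent family of full cardinality, and the image is a subspace because the automorphism is
onto. -/
theorem ScalesBy.bijective (hX : X.IsRigid) (hr : ∀ v, 0 < r v)
    (h : X.ScalesBy X.dual T σ r ρ) : Function.Bijective σ := by
  have hinj : Function.Injective σ := by
    rw [injective_iff_map_eq_zero]
    intro x hx
    obtain ⟨v⟩ : Nonempty (NumberField.InfinitePlace K) := inferInstance
    have h1 := h.inf v (1 ⊗ₜ x)
    have h2 := h.inf v 0
    have h3 : T.mapInf σ v (1 ⊗ₜ x) = 0 := by
      change (T.inf v 1) ⊗ₜ σ x = _
      rw [hx, TensorProduct.tmul_zero]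
    have h4 : X.inf v 0 = 0 := by
      obtain ⟨n, e, he⟩ := hX.inf v
      simpa using he.smul (isNormKind_inf v) 0 0
    rw [h3] at h1
    rw [map_zero, h4, mul_zero] at h2
    rw [h2] at h1
    have h5 := (hX.inf v).eq_zero (isNormKind_inf v)
      ((mul_eq_zero.1 h1.symm).resolve_left (hr v).ne')
    exact Module.FaithfullyFlat.tensorProduct_mk_injective (A := K) (B := v.Completion) V
      (by simpa using h5)
  refine ⟨hinj, fun y => ?_⟩
  let b := finBasis K V
  have h1 : LinearIndependent K (fun j => σ (b j)) :=
    b.linearIndependent.map_of_surjective_injective (T.aut : K →+* K) σ.toAddMonoidHom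
      T.aut.surjective (by intro m hm; exact (map_eq_zero_iff σ hinj).1 hm)
      (fun r m => σ.map_smulₛₗ r m)
  have h2 := h1.span_eq_top_of_card_eq_finrank' (by simp [Subspace.dual_finrank_eq])
  have h3 : y ∈ Submodule.span K (Set.range fun j => σ (b j)) := h2 ▸ Submodule.mem_top
  induction h3 using Submodule.span_induction with
  | mem y hy => obtain ⟨j, rfl⟩ := hy; exact ⟨_, rfl⟩
  | zero => exact ⟨0, map_zero _⟩
  | add y z _ _ hy hz =>
    obtain ⟨a, rfl⟩ := hy
    obtain ⟨b, rfl⟩ := hz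
    exact ⟨a + b, map_add _ _ _⟩
  | smul a y _ hy =>
    obtain ⟨x, rfl⟩ := hy
    exact ⟨T.aut.symm a • x, by rw [σ.map_smulₛₗ]; simp⟩

variable (σ) in
/-- The orthogonal of `F` on the left: the `x` such that `σ x` vanishes on `F`. -/
def leftOrthogonal (F : Submodule K V) : Submodule K V := F.dualAnnihilator.comap σ

variable (σ) in
/-- The restriction of `σ` to the orthogonal of `F`. -/
def restrictOrthogonal (F : Submodule K V) :
    leftOrthogonal σ F →ₛₗ[(T.aut : K →+* K)] F.dualAnnihilator :=
  (σ.domRestrict (leftOrthogonal σ F)).codRestrict F.dualAnnihilator fun x => x.2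

omit [Module.Finite K V] in
theorem restrictOrthogonal_bijective (hσ : Function.Bijective σ) (F : Submodule K V) :
    Function.Bijective (restrictOrthogonal σ F) := by
  constructor
  · intro x y hxy
    exact Subtype.ext (hσ.1 (congrArg Subtype.val hxy))
  · rintro ⟨φ, hφ⟩
    obtain ⟨x, rfl⟩ := hσ.2 φ
    exact ⟨⟨x, hφ⟩, rfl⟩

theorem finrank_leftOrthogonal (hσ : Function.Bijective σ) (F : Submodule K V) :
    finrank K (leftOrthogonal σ F) + finrank K F = finrank K V := by
  obtain ⟨b', -⟩ := exists_basis_semilinear (V := leftOrthogonal σ F) (W := F.dualAnnihilator)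
    (restrictOrthogonal σ F) T.aut.surjective (restrictOrthogonal_bijective hσ F)
    (finBasis K (leftOrthogonal σ F))
  have h := finrank_eq_card_basis b'
  rw [Fintype.card_fin] at h
  rw [← h, add_comm]
  exact Subspace.finrank_add_finrank_dualAnnihilator_eq F

/-- Taking annihilators is injective, and each subspace of the dual is an annihilator; given `G`,
its preimage under `leftOrthogonal σ` is the subspace killed by `σ '' G`. -/
theorem leftOrthogonal_bijective (hσ : Function.Bijective σ) :
    Function.Bijective (leftOrthogonal σ) := by
  constructor
  · intro F G hFG
    apply (Subspace.dualAnnihilator_inj).1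
    ext φ
    obtain ⟨x, rfl⟩ := hσ.2 φ
    exact SetLike.ext_iff.1 hFG x
  · intro G
    let W : Submodule K (Dual K V) :=
      { carrier := σ '' G
        add_mem' := by
          rintro _ _ ⟨x, hx, rfl⟩ ⟨y, hy, rfl⟩
          exact ⟨x + y, G.add_mem hx hy, map_add _ _ _⟩
        zero_mem' := ⟨0, G.zero_mem, map_zero _⟩
        smul_mem' := by
          rintro a _ ⟨x, hx, rfl⟩
          exact ⟨T.aut.symm a • x, G.smul_mem _ hx, by rw [σ.map_smulₛₗ]; simp⟩ }
    refine ⟨W.dualCoannihilator, ?_⟩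
    rw [leftOrthogonal, Subspace.dualCoannihilator_dualAnnihilator_eq]
    ext x
    exact hσ.1.mem_set_image

/-- Duality for the Grayson–Stuhler filtration. -/
theorem IsGSFiltration.leftOrthogonal_eq (hX : X.IsRigid) {ℓ : ℕ} {E : ℕ → Submodule K V}
    (H : X.IsGSFiltration ℓ E) (hr : ∀ v, 0 < r v) (hρ : ∀ v, 0 < ρ v)
    (hρ' : {v | ρ v ≠ 1}.Finite) (h : X.ScalesBy X.dual T σ r ρ) {i : ℕ} (hi : i ≤ ℓ) :
    leftOrthogonal σ (E (ℓ - i)) = E i := by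
  have hσ := h.bijective hX hr
  set C : ℝ := ((∏ v, r v ^ v.mult) * ∏ᶠ v, ρ v) ^ (1 / (finrank ℚ K : ℝ)) with hC
  have hC0 : 0 < C := Real.rpow_pos_of_pos
    (mul_pos (Finset.prod_pos fun v _ => pow_pos (hr v) _) (finprod_pos_of_pos hρ)) _
  -- With `p F` the orthogonal, `F°` the annihilator and `n` the dimension of `V`: `H(F°) = C ^ (n -
  -- dim F) * H(p F)`, `H(F°) * H(V / F) = 1` and `H(V) = H(F) * H(V / F)`. Taking logarithms yields
  -- `α` and `β`.
  refine (H.isSlopeFiltration hX).eq_of_duality (logHeight_submodular hX) (leftOrthogonal σ)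
    (fun F G hFG => Submodule.comap_mono (Submodule.dualAnnihilator_anti hFG))
    (leftOrthogonal_bijective hσ) (finrank_leftOrthogonal hσ)
    (α := -Real.log X.height - finrank K V * Real.log C) (β := Real.log C) (fun F => ?_) hi
  have hs : (X.sub (leftOrthogonal σ F)).ScalesBy (X.dual.sub F.dualAnnihilator) T
      (restrictOrthogonal σ F) r ρ := by
    constructor
    · intro v x
      refine Eq.trans ?_ (h.inf v _)
      exact congrArg (X.dual.inf v) (semiMap_subtype _ _ (fun _ => rfl) x)
    · intro v x
      refine Eq.trans ?_ (h.fin v _)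
      exact congrArg (X.dual.fin (T.place v)) (semiMap_subtype _ _ (fun _ => rfl) x)
  have h1 := hs.height_eq (hX.sub _) (hX.dual.sub _) (restrictOrthogonal_bijective hσ F) hr hρ hρ'
  rw [← hC] at h1
  have h2 := hX.height_dualAnnihilator F
  have h3 := (isExact_sub_quotient X F).height_eq hX
  have h4 : (finrank K (leftOrthogonal σ F) : ℝ) = finrank K V - finrank K F := by
    rw [eq_sub_iff_add_eq]
    exact_mod_cast finrank_leftOrthogonal hσ F
  have l1 := congrArg Real.log h1
  have l2 := congrArg Real.log h2
  have l3 := congrArg Real.log h3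
  rw [Real.log_mul (pow_pos hC0 _).ne' (height_pos _).ne', Real.log_pow, h4] at l1
  rw [Real.log_mul (height_pos _).ne' (height_pos _).ne', Real.log_one] at l2
  rw [Real.log_mul (height_pos _).ne' (height_pos _).ne'] at l3
  simp only [logHeight]
  linarith

end Twist

end AdelicSpace

/-! ### The maps induced on subquotients -/

section Subquotient

variable {K : Type*} [Field K] {V : Type*} [AddCommGroup V] [Module K V] {s : K →+* K}

/-- The semilinear map `G / F → (G' / F')^∨` induced by `σ : V → V^∨`. -/
def subquotientMap (σ : V →ₛₗ[s] Dual K V) (F G F' G' : Submodule K V)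
    (h₁ : ∀ x ∈ G, ∀ y ∈ F', σ x y = 0) (h₂ : ∀ x ∈ F, ∀ y ∈ G', σ x y = 0) :
    (G ⧸ F.submoduleOf G) →ₛₗ[s] Dual K (G' ⧸ F'.submoduleOf G') :=
  (F.submoduleOf G).liftQ
    { toFun := fun x => (F'.submoduleOf G').liftQ (σ x ∘ₗ G'.subtype) fun y hy => h₁ x x.2 y hy
      map_add' := fun x y => by
        ext z
        exact LinearMap.congr_fun (map_add σ (x : V) y) z
      map_smul' := fun a x => by
        ext z
        exact LinearMap.congr_fun (map_smulₛₗ σ a (x : V)) z }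
    fun x hx => by
      rw [LinearMap.mem_ker]
      ext z
      exact h₂ x hx z z.2

variable {L L' : Type*} [NormedField L] [Algebra K L] [NormedField L'] [Algebra K L']
  {ν : ∀ (ι : Type) [Fintype ι], (ι → ℝ) → ℝ} {comb : ℝ → ℝ → ℝ}

/-- Pulled back to `G'`, the induced form is the restriction of the original one; this relates its
norm to norms of forms on all of `V`. -/
theorem evalDual_subquotientMap (c : L →+* L')
    (hc : ∀ a, c (algebraMap K L a) = algebraMap K L' (s a)) {σ : V →ₛₗ[s] Dual K V}
    {F G F' G' : Submodule K V}
    (h₁ : ∀ x ∈ G, ∀ y ∈ F', σ x y = 0) (h₂ : ∀ x ∈ F, ∀ y ∈ G', σ x y = 0) (x : L ⊗[K] G) :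
    evalDual L' (semiMap c hc (subquotientMap σ F G F' G' h₁ h₂)
        ((F.submoduleOf G).mkQ.baseChange L x)) ∘ₗ (F'.submoduleOf G').mkQ.baseChange L' =
      evalDual L' (semiMap c hc σ (G.subtype.baseChange L x)) ∘ₗ G'.subtype.baseChange L' := by
  induction x with
  | zero => simp
  | add x y hx hy => simp only [map_add, LinearMap.add_comp, hx, hy]
  | tmul l x =>
    ext y
    simp only [LinearMap.baseChange_tmul, semiMap_tmul,
      TensorProduct.AlgebraTensorModule.curry_apply, TensorProduct.curry_apply, LinearMap.coe_restrictScalars, LinearMap.comp_apply,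
      evalDual_tmul]
    rfl

theorem isShortExact_dualAnnihilator (G : Submodule K V) :
    IsShortExact (A := G.dualAnnihilator) (B := Dual K V) (C := Dual K G)
      G.dualAnnihilator.subtype G.subtype.dualMap where
  inj := Subtype.val_injective
  surj := LinearMap.dualMap_surjective_of_injective G.subtype_injective
  exact := by
    intro φ
    rw [Submodule.coe_subtype, Subtype.range_coe, SetLike.mem_coe, Submodule.mem_dualAnnihilator]
    exact ⟨fun h x hx => LinearMap.congr_fun h ⟨x, hx⟩, fun h => by ext x; exact h x x.2⟩

/-- The map induced on subquotients scales norms by the same factor. -/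
theorem opNorm_subquotientMap [Module.Finite K V] (hk : IsNormKind ν comb L') {c : L →+* L'}
    {hc : ∀ a, c (algebraMap K L a) = algebraMap K L' (s a)} (hcs : Function.Surjective c)
    {σ : V →ₛₗ[s] Dual K V} (hσ : Function.Surjective σ) {F G F' G' : Submodule K V} (hFG : F ≤ G)
    (h₁ : ∀ x ∈ G, ∀ y ∈ F', σ x y = 0) (h₂ : ∀ x ∈ F, ∀ y ∈ G', σ x y = 0)
    (h₃ : ∀ x, (∀ y ∈ G', σ x y = 0) → x ∈ F)
    {N : L ⊗[K] V → ℝ} {N' : L' ⊗[K] V → ℝ} (hN' : HasON ν L' N') {r : ℝ} (hr0 : 0 ≤ r)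
    (hr : ∀ x, opNorm N' (evalDual L' (semiMap c hc σ x)) = r * N x)
    (z : L ⊗[K] (G ⧸ F.submoduleOf G)) :
    opNorm (fibreNorm (fun x => N' (G'.subtype.baseChange L' x))
        ((F'.submoduleOf G').mkQ.baseChange L'))
        (evalDual L' (semiMap c hc (subquotientMap σ F G F' G' h₁ h₂) z)) =
      r * fibreNorm (fun x => N (G.subtype.baseChange L x))
        ((F.submoduleOf G).mkQ.baseChange L) z := by
  have hG' := (AdelicSpace.isShortExact_subtype_mkQ G').baseChange L'
  have hQ' := (AdelicSpace.isShortExact_subtype_mkQ (F'.submoduleOf G')).baseChange L'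
  obtain ⟨m, e', he'⟩ := hN'.left hk hG'
  obtain ⟨n, e, he⟩ := hN'
  -- The left side becomes an infimum of dual norms over the extensions to `V` of a form on `G'`. It
  -- remains to see that `σ` matches these extensions with the lifts of `z`.
  rw [opNorm_fibreNorm hk he' hQ', opNorm_comp hk he hG', fibreNorm, fibreNorm, ← smul_eq_mul,
    ← Real.sInf_smul_of_nonneg hr0]
  congr 1
  obtain ⟨x₀, rfl⟩ :=
    ((AdelicSpace.isShortExact_subtype_mkQ (F.submoduleOf G)).baseChange L).surj z
  rw [evalDual_subquotientMap]
  ext t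
  constructor
  · rintro ⟨φ, hφ, rfl⟩
    obtain ⟨φ, rfl⟩ := (evalDualEquiv L' V).surjective φ
    obtain ⟨w, rfl⟩ := semiMap_surjective c hc σ hcs hσ φ
    rw [evalDualEquiv_apply] at hφ ⊢
    have h4 : G'.subtype.dualMap.baseChange L'
        (semiMap c hc σ (w - G.subtype.baseChange L x₀)) = 0 := by
      apply (evalDualEquiv L' G').injective
      rw [evalDualEquiv_apply, evalDualEquiv_apply, evalDual_dualMap, map_sub, map_sub, map_sub,
        map_zero, hφ, sub_eq_zero]
      rfl
    obtain ⟨y, hy⟩ := (((isShortExact_dualAnnihilator G').baseChange L').exact _).1 h4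
    -- Two extensions differ by a form vanishing on `G'`. By `h₃` such forms come from `F`, so
    -- modifying the lift by an element of localised `F` accounts for the difference.
    let σ' : F →ₛₗ[s] G'.dualAnnihilator := (σ.domRestrict F).codRestrict G'.dualAnnihilator
      fun x => (Submodule.mem_dualAnnihilator _).2 (h₂ x x.2)
    have hσ' : Function.Surjective σ' := by
      rintro ⟨φ, hφ⟩
      obtain ⟨x, rfl⟩ := hσ φ
      exact ⟨⟨x, h₃ x ((Submodule.mem_dualAnnihilator _).1 hφ)⟩, rfl⟩
    obtain ⟨u, rfl⟩ :=
      semiMap_surjective (W := G'.dualAnnihilator) c hc σ' hcs hσ' y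
    rw [AdelicSpace.semiMap_subtype c hc (f := σ) (fun _ => rfl), map_sub, eq_sub_iff_add_eq,
      ← map_add, ← AdelicSpace.subtype_baseChange_inclusion hFG u, ← map_add] at hy
    rw [← hy, hr]
    refine ⟨_, ⟨_, ?_, rfl⟩, rfl⟩
    rw [map_add, add_eq_right, ← LinearMap.comp_apply, ← LinearMap.baseChange_comp]
    have : (F.submoduleOf G).mkQ ∘ₗ Submodule.inclusion hFG = 0 := by
      ext x
      exact (Submodule.Quotient.mk_eq_zero _).2 x.2
    rw [this, LinearMap.baseChange_zero, LinearMap.zero_apply]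
  · rintro ⟨_, ⟨x, hx, rfl⟩, rfl⟩
    refine ⟨_, ?_, hr _⟩
    have h5 := evalDual_subquotientMap c hc h₁ h₂ x
    rw [hx, evalDual_subquotientMap] at h5
    exact h5.symm

end Subquotient

/-! ### Products and crossed maps -/

section Prod

variable {K : Type*} [Field K] {A B : Type*} [AddCommGroup A] [Module K A] [AddCommGroup B]
  [Module K B] {s : K →+* K}
variable {L : Type*} [NormedField L] [Algebra K L]
  {ν : ∀ (ι : Type) [Fintype ι], (ι → ℝ) → ℝ} {comb : ℝ → ℝ → ℝ}

/-- The norm on a localised product. -/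
def prodNorm (comb : ℝ → ℝ → ℝ) (N₁ : L ⊗[K] A → ℝ) (N₂ : L ⊗[K] B → ℝ) (z : L ⊗[K] (A × B)) : ℝ :=
  comb (N₁ ((LinearMap.fst K A B).baseChange L z)) (N₂ ((LinearMap.snd K A B).baseChange L z))

theorem prodRight_eq (z : L ⊗[K] (A × B)) : TensorProduct.prodRight K L L A B z =
    ((LinearMap.fst K A B).baseChange L z, (LinearMap.snd K A B).baseChange L z) := by
  induction z with
  | zero => simp only [map_zero, Prod.mk_zero_zero]
  | add x y hx hy => simp [hx, hy]
  | tmul l x => simp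

/-- The basis of a localised product given by bases of the factors. -/
def prodBasis {ι κ : Type*} (e₁ : Basis ι L (L ⊗[K] A)) (e₂ : Basis κ L (L ⊗[K] B)) :
    Basis (ι ⊕ κ) L (L ⊗[K] (A × B)) :=
  (e₁.prod e₂).map (TensorProduct.prodRight K L L A B).symm

variable {ι κ : Type} [Fintype ι] [Fintype κ]

theorem isON_prod (hk : IsNormKind ν comb L) {N₁ : L ⊗[K] A → ℝ} {N₂ : L ⊗[K] B → ℝ}
    {e₁ : Basis ι L (L ⊗[K] A)} {e₂ : Basis κ L (L ⊗[K] B)} (h₁ : IsON ν N₁ e₁)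
    (h₂ : IsON ν N₂ e₂) : IsON ν (prodNorm comb N₁ N₂) (prodBasis e₁ e₂) := by
  intro z
  rw [prodNorm, h₁, h₂, ← hk.sum _ _ (fun _ => norm_nonneg _) (fun _ => norm_nonneg _)]
  congr 1
  ext (a | b)
  · simp [prodBasis, prodRight_eq]
  · simp [prodBasis, prodRight_eq]

theorem prodBasis_inl {ι κ : Type*} (e₁ : Basis ι L (L ⊗[K] A)) (e₂ : Basis κ L (L ⊗[K] B))
    (a : ι) : prodBasis e₁ e₂ (Sum.inl a) = (LinearMap.inl K A B).baseChange L (e₁ a) := by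
  rw [prodBasis, Basis.map_apply, LinearEquiv.symm_apply_eq, prodRight_eq,
    ← LinearMap.comp_apply, ← LinearMap.comp_apply, ← LinearMap.baseChange_comp,
    ← LinearMap.baseChange_comp, LinearMap.fst_comp_inl, LinearMap.snd_comp_inl]
  simp

theorem prodBasis_inr {ι κ : Type*} (e₁ : Basis ι L (L ⊗[K] A)) (e₂ : Basis κ L (L ⊗[K] B))
    (b : κ) : prodBasis e₁ e₂ (Sum.inr b) = (LinearMap.inr K A B).baseChange L (e₂ b) := by
  rw [prodBasis, Basis.map_apply, LinearEquiv.symm_apply_eq, prodRight_eq,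
    ← LinearMap.comp_apply, ← LinearMap.comp_apply, ← LinearMap.baseChange_comp,
    ← LinearMap.baseChange_comp, LinearMap.fst_comp_inr, LinearMap.snd_comp_inr]
  simp

theorem prodBasis_basis {ι κ : Type*} (b₁ : Basis ι K A) (b₂ : Basis κ K B) :
    prodBasis (Algebra.TensorProduct.basis L b₁) (Algebra.TensorProduct.basis L b₂) =
      Algebra.TensorProduct.basis L (b₁.prod b₂) := by
  ext (a | b)
  · rw [prodBasis_inl]; simp
  · rw [prodBasis_inr]; simp

/-- The dual of a product norm. -/
theorem opNorm_prodNorm (hk : IsNormKind ν comb L) {N₁ : L ⊗[K] A → ℝ} {N₂ : L ⊗[K] B → ℝ}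
    (h₁ : HasON ν L N₁) (h₂ : HasON ν L N₂) (φ : Dual L (L ⊗[K] (A × B))) :
    opNorm (prodNorm comb N₁ N₂) φ =
      comb (opNorm N₁ (φ ∘ₗ (LinearMap.inl K A B).baseChange L))
        (opNorm N₂ (φ ∘ₗ (LinearMap.inr K A B).baseChange L)) := by
  obtain ⟨m, e₁, h₁⟩ := h₁
  obtain ⟨k, e₂, h₂⟩ := h₂
  rw [(isON_prod hk h₁ h₂).opNorm hk φ,
    h₁.opNorm hk (φ ∘ₗ (LinearMap.inl K A B).baseChange L),
    h₂.opNorm hk (φ ∘ₗ (LinearMap.inr K A B).baseChange L),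
    ← hk.sum _ _ (fun _ => norm_nonneg _) (fun _ => norm_nonneg _)]
  congr 1
  ext (a | b)
  · simp [prodBasis_inl]
  · simp [prodBasis_inr]

/-- The map `A × B → (A × B)^∨` given by maps `A → B^∨` and `B → A^∨`. -/
def crossMap (τ₁ : A →ₛₗ[s] Dual K B) (τ₂ : B →ₛₗ[s] Dual K A) :
    A × B →ₛₗ[s] Dual K (A × B) where
  toFun z := (τ₁ z.1) ∘ₗ LinearMap.snd K A B + (τ₂ z.2) ∘ₗ LinearMap.fst K A B
  map_add' x y := by
    simp only [Prod.fst_add, Prod.snd_add, map_add, LinearMap.add_comp]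
    abel
  map_smul' a x := by
    simp only [Prod.smul_fst, Prod.smul_snd, LinearMap.map_smulₛₗ, LinearMap.smul_comp, smul_add]

/-- On each factor the crossed map is the scaling map from the other factor. The common factor `r`
comes out of `comb`, whose symmetry undoes the exchange. -/
theorem opNorm_crossMap {L' : Type*} [NormedField L'] [Algebra K L'] (hk : IsNormKind ν comb L')
    {c : L →+* L'} {hc : ∀ a, c (algebraMap K L a) = algebraMap K L' (s a)}
    {τ₁ : A →ₛₗ[s] Dual K B} {τ₂ : B →ₛₗ[s] Dual K A}
    {N₁ : L ⊗[K] A → ℝ} {N₂ : L ⊗[K] B → ℝ} {N₁' : L' ⊗[K] A → ℝ} {N₂' : L' ⊗[K] B → ℝ}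
    (h₁ : HasON ν L' N₁') (h₂ : HasON ν L' N₂') {r : ℝ} (hr0 : 0 ≤ r)
    (hτ₁ : ∀ x, opNorm N₂' (evalDual L' (semiMap c hc τ₁ x)) = r * N₁ x)
    (hτ₂ : ∀ x, opNorm N₁' (evalDual L' (semiMap c hc τ₂ x)) = r * N₂ x) (z : L ⊗[K] (A × B)) :
    opNorm (prodNorm comb N₁' N₂') (evalDual L' (semiMap c hc (crossMap τ₁ τ₂) z)) =
      r * prodNorm comb N₁ N₂ z := by
  have e₁ : ∀ z, evalDual L' (semiMap c hc (crossMap τ₁ τ₂) z) ∘ₗ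
      (LinearMap.inl K A B).baseChange L' =
      evalDual L' (semiMap c hc τ₂ ((LinearMap.snd K A B).baseChange L z)) := by
    intro z
    induction z with
    | zero => simp
    | add x y hx hy => simp only [map_add, LinearMap.add_comp, hx, hy]
    | tmul l x => ext y; simp [crossMap]
  have e₂ : ∀ z, evalDual L' (semiMap c hc (crossMap τ₁ τ₂) z) ∘ₗ
      (LinearMap.inr K A B).baseChange L' =
      evalDual L' (semiMap c hc τ₁ ((LinearMap.fst K A B).baseChange L z)) := by
    intro z
    induction z with
    | zero => simp
    | add x y hx hy => simp only [map_add, LinearMap.add_comp, hx, hy]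
    | tmul l x => ext y; simp [crossMap]
  rw [opNorm_prodNorm hk h₁ h₂, e₁, e₂, hτ₁, hτ₂, hk.comb_comm, hk.comb_mul _ _ _ hr0]
  rfl

end Prod

theorem le_of_forall_le_succ {α : Type*} [Preorder α] {ℓ : ℕ} {E : ℕ → α}
    (H : ∀ i < ℓ, E i ≤ E (i + 1)) {i j : ℕ} (hij : i ≤ j) (hj : j ≤ ℓ) : E i ≤ E j := by
  induction j, hij using Nat.le_induction with
  | base => exact le_rfl
  | succ j _ ih => exact (ih (by omega)).trans (H j (by omega))

/-! ### The four assertions for a twisted similarity -/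

namespace AdelicSpace

variable {K : Type*} [Field K] [NumberField K]

theorem IsRigid.prod {A B : Type*} [AddCommGroup A] [Module K A] [AddCommGroup B] [Module K B]
    [Module.Finite K A] [Module.Finite K B] {X : AdelicSpace K A} {Y : AdelicSpace K B}
    (hX : X.IsRigid) (hY : Y.IsRigid) : (X.prod Y).IsRigid := by
  refine isRigid_iff.2 ⟨fun v => ?_, fun v => ?_, _,
    ((finBasis K A).prod (finBasis K B)).reindex finSumFinEquiv, ?_⟩
  · obtain ⟨m, e₁, h₁⟩ := hX.inf v
    obtain ⟨k, e₂, h₂⟩ := hY.inf v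
    exact (isON_prod (isNormKind_inf v) h₁ h₂).hasON (isNormKind_inf v)
  · obtain ⟨m, e₁, h₁⟩ := hX.fin v
    obtain ⟨k, e₂, h₂⟩ := hY.fin v
    exact (isON_prod (isNormKind_fin v) h₁ h₂).hasON (isNormKind_fin v)
  · refine ((hX.finite_not_isON (finBasis K A)).union
      (hY.finite_not_isON (finBasis K B))).subset fun v hv => ?_
    by_contra hcon
    simp only [Set.mem_union, Set.mem_ofPred_eq, not_or, not_not] at hcon
    apply hv
    have h1 := (isON_prod (isNormKind_fin v) hcon.1 hcon.2).reindex (isNormKind_fin v)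
      finSumFinEquiv
    rw [prodBasis_basis] at h1
    have h2 : Algebra.TensorProduct.basis (v.adicCompletion K)
        (((finBasis K A).prod (finBasis K B)).reindex finSumFinEquiv) =
        (Algebra.TensorProduct.basis (v.adicCompletion K)
          ((finBasis K A).prod (finBasis K B))).reindex finSumFinEquiv := by
      ext j
      simp
    rw [h2]
    exact h1

variable {V : Type*} [AddCommGroup V] [Module K V] [Module.Finite K V] {X : AdelicSpace K V}
  {T : Twist K} {σ : V →ₛₗ[(T.aut : K →+* K)] Dual K V}
  {r : NumberField.InfinitePlace K → ℝ} {ρ : HeightOneSpectrum (𝓞 K) → ℝ}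

theorem ScalesBy.subquotientMap (hX : X.IsRigid) (hr : ∀ v, 0 < r v) (hρ : ∀ v, 0 < ρ v)
    (h : X.ScalesBy X.dual T σ r ρ) {F G F' G' : Submodule K V} (hFG : F ≤ G)
    (h₁ : ∀ x ∈ G, ∀ y ∈ F', σ x y = 0) (h₂ : ∀ x ∈ F, ∀ y ∈ G', σ x y = 0)
    (h₃ : ∀ x, (∀ y ∈ G', σ x y = 0) → x ∈ F) :
    (X.subquotient F G).ScalesBy (X.subquotient F' G').dual T
      (subquotientMap σ F G F' G' h₁ h₂) r ρ where
  inf v := opNorm_subquotientMap (isNormKind_inf v) (T.inf v).surjective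
    (h.bijective hX hr).2 hFG h₁ h₂ h₃ (hX.inf v) (hr v).le (h.inf v)
  fin v := opNorm_subquotientMap (isNormKind_fin _) (T.fin v).surjective
    (h.bijective hX hr).2 hFG h₁ h₂ h₃ (hX.fin _) (hρ v).le (h.fin v)

theorem ScalesBy.crossMap {A B : Type*} [AddCommGroup A] [Module K A] [AddCommGroup B] [Module K B]
    {Y : AdelicSpace K A} {Z : AdelicSpace K B} (hY : Y.IsRigid) (hZ : Z.IsRigid)
    {τ₁ : A →ₛₗ[(T.aut : K →+* K)] Dual K B} {τ₂ : B →ₛₗ[(T.aut : K →+* K)] Dual K A}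
    (hr : ∀ v, 0 < r v) (hρ : ∀ v, 0 < ρ v) (h₁ : Y.ScalesBy Z.dual T τ₁ r ρ)
    (h₂ : Z.ScalesBy Y.dual T τ₂ r ρ) :
    (Y.prod Z).ScalesBy (Y.prod Z).dual T (crossMap τ₁ τ₂) r ρ where
  inf v := opNorm_crossMap (isNormKind_inf v) (hY.inf v) (hZ.inf v) (hr v).le (h₁.inf v) (h₂.inf v)
  fin v := opNorm_crossMap (isNormKind_fin _) (hY.fin _) (hZ.fin _) (hρ v).le (h₁.fin v) (h₂.fin v)

/-- `X` is similar to its dual along the twist `T`. -/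
def IsTwistedIsodual (X : AdelicSpace K V) (T : Twist K) : Prop :=
  X.IsRigid ∧ ∃ (τ : V →ₛₗ[(T.aut : K →+* K)] Dual K V) (r : NumberField.InfinitePlace K → ℝ)
    (ρ : HeightOneSpectrum (𝓞 K) → ℝ), (∀ v, 0 < r v) ∧ (∀ v, 0 < ρ v) ∧ {v | ρ v ≠ 1}.Finite ∧
    X.ScalesBy X.dual T τ r ρ

section Conclusions

variable {ℓ : ℕ} {E : ℕ → Submodule K V}

variable (hX : X.IsRigid) (H : X.IsGSFiltration ℓ E) (hr : ∀ v, 0 < r v) (hρ : ∀ v, 0 < ρ v)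
  (hρ' : {v | ρ v ≠ 1}.Finite) (h : X.ScalesBy X.dual T σ r ρ)

include hX H hr hρ hρ' h

theorem IsGSFiltration.mem_iff {i : ℕ} (hi : i ≤ ℓ) (x : V) :
    x ∈ E i ↔ ∀ y ∈ E (ℓ - i), σ x y = 0 := by
  rw [← H.leftOrthogonal_eq hX hr hρ hρ' h hi]
  exact Submodule.mem_dualAnnihilator _

theorem IsGSFiltration.image_eq {i : ℕ} (hi : i ≤ ℓ) :
    σ '' (E i : Set V) = {φ : Dual K V | ∀ x ∈ E (ℓ - i), φ x = 0} := by
  ext φ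
  obtain ⟨x, rfl⟩ := (h.bijective hX hr).2 φ
  rw [(h.bijective hX hr).1.mem_set_image]
  exact H.mem_iff hX hr hρ hρ' h hi x

theorem IsGSFiltration.isotropic {i : ℕ} (hi : 2 * i ≤ ℓ) {x y : V} (hx : x ∈ E i)
    (hy : y ∈ E i) : σ x y = 0 :=
  (H.mem_iff hX hr hρ hρ' h (by omega) x).1 hx y
    (le_of_forall_le_succ H.le_succ (by omega) (by omega) hy)

/-- The forms `σ x` with `x ∈ E i` fill the annihilator of `E (ℓ - i)`, so by biduality `y` lies in
`E (ℓ - i)`, which is contained in `E i`. -/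
theorem IsGSFiltration.coisotropic {i : ℕ} (hi : i ≤ ℓ) (hi' : ℓ ≤ 2 * i) {y : V}
    (hy : ∀ x ∈ E i, σ x y = 0) : y ∈ E i := by
  refine le_of_forall_le_succ H.le_succ (i := ℓ - i) (by omega) hi ?_
  rw [← Subspace.dualAnnihilator_dualCoannihilator_eq (W := E (ℓ - i)),
    Submodule.mem_dualCoannihilator]
  intro φ hφ
  obtain ⟨x, rfl⟩ := (h.bijective hX hr).2 φ
  exact hy x ((H.mem_iff hX hr hρ hρ' h hi x).2 ((Submodule.mem_dualAnnihilator _).1 hφ))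

/-- Here `i' = ℓ - j` and `j' = ℓ - i`. The orthogonality of `E j` to `E i'`, and of `E i` to `E
j'`, is what lets `σ` descend. -/
theorem IsGSFiltration.scalesBy_subquotient {i j i' j' : ℕ} (hij : i ≤ j) (hi : i + j' = ℓ)
    (hj : j + i' = ℓ) :
    ∃ τ, (X.subquotient (E i) (E j)).ScalesBy (X.subquotient (E i') (E j')).dual T τ r ρ := by
  have h1 := fun x => (H.mem_iff hX hr hρ hρ' h (i := i) (by omega) x)
  have h2 := fun x => (H.mem_iff hX hr hρ hρ' h (i := j) (by omega) x)
  rw [show ℓ - i = j' by omega] at h1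
  rw [show ℓ - j = i' by omega] at h2
  exact ⟨_, h.subquotientMap hX hr hρ (le_of_forall_le_succ H.le_succ hij (by omega))
    (fun x hx => (h2 x).1 hx) (fun x hx => (h1 x).1 hx) fun x hx => (h1 x).2 hx⟩

theorem IsGSFiltration.isTwistedIsodual_subquotient {i : ℕ} (hi : 2 * i ≤ ℓ) :
    (X.subquotient (E i) (E (ℓ - i))).IsTwistedIsodual T := by
  obtain ⟨τ, hτ⟩ := H.scalesBy_subquotient hX hr hρ hρ' h (i := i) (j := ℓ - i) (i' := i)
    (j' := ℓ - i) (by omega) (by omega) (by omega)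
  exact ⟨hX.subquotient _ _, τ, r, ρ, hr, hρ, hρ', hτ⟩

theorem IsGSFiltration.isTwistedIsodual_prod {i j : ℕ} (hij : i ≤ j) (hj : 2 * j ≤ ℓ) :
    ((X.subquotient (E i) (E j)).prod
      (X.subquotient (E (ℓ - j)) (E (ℓ - i)))).IsTwistedIsodual T := by
  obtain ⟨τ₁, h₁⟩ := H.scalesBy_subquotient hX hr hρ hρ' h (i' := ℓ - j) (j' := ℓ - i) hij
    (by omega) (by omega)
  obtain ⟨τ₂, h₂⟩ := H.scalesBy_subquotient hX hr hρ hρ' h (i := ℓ - j) (j := ℓ - i) (i' := i)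
    (j' := j) (by omega) (by omega) (by omega)
  have hY := hX.subquotient (E i) (E j)
  have hZ := hX.subquotient (E (ℓ - j)) (E (ℓ - i))
  exact ⟨hY.prod hZ, _, r, ρ, hr, hρ, hρ', h₁.crossMap hY hZ hr hρ h₂⟩

end Conclusions

end AdelicSpace

/-! ### The identity twist: isodual spaces -/

namespace AdelicSpace

section Identity

variable {K : Type*} [Field K] [NumberField K] {V : Type*} [AddCommGroup V] [Module K V]
  {X : AdelicSpace K V}

theorem isSimilarity_iff_scalesBy {W : Type*} [AddCommGroup W] [Module K W] {Y : AdelicSpace K W}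
    {σ : V →ₗ[K] W} :
    X.IsSimilarity Y σ ↔ ∃ (r : NumberField.InfinitePlace K → ℝ)
      (ρ : HeightOneSpectrum (𝓞 K) → ℝ), (∀ v, 0 < r v) ∧ (∀ v, 0 < ρ v) ∧
      {v | ρ v ≠ 1}.Finite ∧ X.ScalesBy Y (Twist.id K) σ r ρ := by
  constructor
  · rintro ⟨h₁, ρ, hρ, hρ', h₂⟩
    choose r hr h₁ using h₁
    refine ⟨r, ρ, hr, hρ, hρ', fun v x => ?_, fun v x => ?_⟩
    · exact (congrArg (Y.inf v) (Twist.mapInf_id σ v x)).trans (h₁ v x)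
    · exact (congrArg (Y.fin v) (Twist.mapFin_id σ v x)).trans (h₂ v x)
  · rintro ⟨r, ρ, hr, hρ, hρ', h⟩
    refine ⟨fun v => ⟨r v, hr v, fun x => ?_⟩, ρ, hρ, hρ', fun v x => ?_⟩
    · exact (congrArg (Y.inf v) (Twist.mapInf_id σ v x)).symm.trans (h.inf v x)
    · exact (congrArg (Y.fin v) (Twist.mapFin_id σ v x)).symm.trans (h.fin v x)

theorem IsTwistedIsodual.isIsodual [Module.Finite K V] (h : X.IsTwistedIsodual (Twist.id K)) :
    X.IsIsodual := by
  obtain ⟨hX, τ, h⟩ := h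
  exact ⟨hX, τ, isSimilarity_iff_scalesBy.2 h⟩

end Identity

end AdelicSpace

/-! ### Complex conjugation on completions -/

section ExtendHom

variable {K : Type*} [Field K] (c : K →+* K) {L L' : Type*} [NormedField L] [NormedField L']
    [CompleteSpace L'] [Algebra K L] [Algebra K L'] (hd : DenseRange (algebraMap K L))
    (hc : ∀ x, ‖algebraMap K L' (c x)‖ = ‖algebraMap K L x‖)

theorem norm_extendHom (x : L) : ‖extendHom c L L' hd hc x‖ = ‖x‖ := by
  have hcont : Continuous (extendHom c L L' hd hc) := by
    let _ : NormedField K := NormedField.induced K L (algebraMap K L) (algebraMap K L).injective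
    exact (uniformContinuous_uniformly_extend
      (Isometry.isUniformInducing
        (AddMonoidHomClass.isometry_of_norm (algebraMap K L) fun _ => rfl))
      hd (Isometry.uniformContinuous
        (AddMonoidHomClass.isometry_of_norm ((algebraMap K L').comp c) hc))).continuous
  refine congrFun (hd.equalizer (continuous_norm.comp hcont) continuous_norm ?_) x
  ext a
  simp [extendHom_algebraMap, hc]

/-- An isometry from a complete space has closed range, and this range contains the dense image of
`K`. -/
theorem extendHom_bijective [CompleteSpace L] (hd' : DenseRange (algebraMap K L'))
    (hcs : Function.Surjective c) : Function.Bijective (extendHom c L L' hd hc) := by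
  have hi : Isometry (extendHom c L L' hd hc) :=
    AddMonoidHomClass.isometry_of_norm _ (norm_extendHom c hd hc)
  refine ⟨hi.injective, fun y => ?_⟩
  have : y ∈ closure (Set.range (extendHom c L L' hd hc)) :=
    closure_mono (by
      rintro _ ⟨a, rfl⟩
      obtain ⟨a, rfl⟩ := hcs a
      exact ⟨_, extendHom_algebraMap c L L' hd hc a⟩) (hd' y)
  rwa [hi.isClosedEmbedding.isClosed_range.closure_eq] at this

end ExtendHom

/-! ### The conjugation twist: anti-isodual spaces -/

section CM

variable (K : Type*) [Field K] [NumberField K] [NumberField.IsCMField K]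

theorem conjPlace_conjPlace (v : HeightOneSpectrum (𝓞 K)) : conjPlace K (conjPlace K v) = v := by
  ext r
  change conjInt K (conjInt K r) ∈ v.asIdeal ↔ _
  rw [conjInt_conjInt]

/-- Complex conjugation, as a twist. -/
def Twist.conj : Twist K where
  aut := (NumberField.IsCMField.complexConj K).toRingEquiv
  place := ⟨conjPlace K, conjPlace K, conjPlace_conjPlace K, conjPlace_conjPlace K⟩
  inf v := RingEquiv.ofBijective (conjInf v) (extendHom_bijective _ (denseRange_inf v)
    (norm_conj_inf v) (denseRange_inf v)
    (NumberField.IsCMField.complexConj K).surjective)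
  fin v := RingEquiv.ofBijective (conjFin v) (extendHom_bijective _
    (HeightOneSpectrum.denseRange_algebraMap K v) (norm_conj_fin v)
    (HeightOneSpectrum.denseRange_algebraMap K (conjPlace K v))
    (NumberField.IsCMField.complexConj K).surjective)
  norm_inf v := norm_extendHom _ (denseRange_inf v) (norm_conj_inf v)
  norm_fin v := norm_extendHom _ (HeightOneSpectrum.denseRange_algebraMap K v) (norm_conj_fin v)
  inf_algebraMap v := conjInf_algebraMap v
  fin_algebraMap v := conjFin_algebraMap v

variable {K} {V W : Type*} [AddCommGroup V] [Module K V] [AddCommGroup W] [Module K W]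

/-- A linear map to a conjugate space, as a semilinear map. -/
def Conj.semilinear (σ : V →ₗ[K] Conj K W) : V →ₛₗ[((Twist.conj K).aut : K →+* K)] W where
  toFun x := Conj.out K W (σ x)
  map_add' x y := by rw [map_add, map_add]
  map_smul' a x := by rw [map_smul, Conj.out_smul]; rfl

/-- A semilinear map, as a linear map to the conjugate space. -/
def Conj.linear (τ : V →ₛₗ[((Twist.conj K).aut : K →+* K)] W) : V →ₗ[K] Conj K W where
  toFun x := (Conj.out K W).symm (τ x)
  map_add' x y := by rw [map_add, map_add]
  map_smul' a x := by
    apply (Conj.out K W).injective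
    rw [LinearMap.map_smulₛₗ]
    rfl

theorem Conj.tensorMap_inf (σ : V →ₗ[K] Conj K W) (v : NumberField.InfinitePlace K)
    (x : v.Completion ⊗[K] V) :
    Conj.tensorMap W (conjInf v) (conjInf_algebraMap v) (σ.baseChange v.Completion x) =
      (Twist.conj K).mapInf (Conj.semilinear σ) v x := by
  induction x with
  | zero => simp
  | add x y hx hy => rw [map_add, map_add, map_add, hx, hy]
  | tmul l x => rfl

theorem Conj.tensorMap_fin (σ : V →ₗ[K] Conj K W) (v : HeightOneSpectrum (𝓞 K))
    (x : v.adicCompletion K ⊗[K] V) :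
    Conj.tensorMap W (conjFin v) (conjFin_algebraMap v) (σ.baseChange (v.adicCompletion K) x) =
      (Twist.conj K).mapFin (Conj.semilinear σ) v x := by
  induction x with
  | zero => exact ((congrArg _ (map_zero _)).trans (map_zero _)).trans (map_zero _).symm
  | add x y hx hy =>
    rw [map_add, map_add, hx, hy]
    exact (map_add ((Twist.conj K).mapFin (Conj.semilinear σ) v) x y).symm
  | tmul l x => rfl

namespace AdelicSpace

variable {X : AdelicSpace K V}

theorem isSimilarity_conjugate_iff_scalesBy {Y : AdelicSpace K W} {σ : V →ₗ[K] Conj K W} :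
    X.IsSimilarity Y.conjugate σ ↔ ∃ (r : NumberField.InfinitePlace K → ℝ)
      (ρ : HeightOneSpectrum (𝓞 K) → ℝ), (∀ v, 0 < r v) ∧ (∀ v, 0 < ρ v) ∧
      {v | ρ v ≠ 1}.Finite ∧ X.ScalesBy Y (Twist.conj K) (Conj.semilinear σ) r ρ := by
  constructor
  · rintro ⟨h₁, ρ, hρ, hρ', h₂⟩
    choose r hr h₁ using h₁
    refine ⟨r, ρ, hr, hρ, hρ', fun v x => ?_, fun v x => ?_⟩
    · exact (congrArg (Y.inf v) (Conj.tensorMap_inf σ v x)).symm.trans (h₁ v x)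
    · exact (congrArg (Y.fin (conjPlace K v)) (Conj.tensorMap_fin σ v x)).symm.trans (h₂ v x)
  · rintro ⟨r, ρ, hr, hρ, hρ', h⟩
    refine ⟨fun v => ⟨r v, hr v, fun x => ?_⟩, ρ, hρ, hρ', fun v x => ?_⟩
    · exact (congrArg (Y.inf v) (Conj.tensorMap_inf σ v x)).trans (h.inf v x)
    · exact (congrArg (Y.fin (conjPlace K v)) (Conj.tensorMap_fin σ v x)).trans (h.fin v x)

theorem IsTwistedIsodual.isAntiIsodual [Module.Finite K V]
    (h : X.IsTwistedIsodual (Twist.conj K)) : X.IsAntiIsodual := by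
  obtain ⟨hX, τ, h⟩ := h
  exact ⟨hX, Conj.linear τ, isSimilarity_conjugate_iff_scalesBy.2 h⟩

end AdelicSpace

end CM

end RigidAdelic

end

open RigidAdelic in
theorem proposition4p2 (K : Type*) [Field K] [NumberField K]
    (V : Type*) [AddCommGroup V] [Module K V] [Module.Finite K V]
    (X : AdelicSpace K V) (hX : X.IsRigid)
    (ℓ : ℕ) (E : ℕ → Submodule K V) (hE : X.IsGSFiltration ℓ E) :
    (∀ σ : V →ₗ[K] Dual K V, X.IsSimilarity X.dual σ →
      IsOrthogonalForm (form σ) ∨ IsSymplecticForm (form σ) →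
      (∀ i ≤ ℓ, σ '' (E i : Set V) = {φ : Dual K V | ∀ x ∈ E (ℓ - i), φ x = 0}) ∧
      (∀ i ≤ ℓ, 2 * i ≤ ℓ → IsTotallyIsotropic (form σ) (E i)) ∧
      (∀ i ≤ ℓ, ℓ ≤ 2 * i → IsCoisotropic (form σ) (E i)) ∧
      (∀ i, 2 * i ≤ ℓ → (X.subquotient (E i) (E (ℓ - i))).IsIsodual) ∧
      (∀ i j, i ≤ j → 2 * j ≤ ℓ →
        ((X.subquotient (E i) (E j)).prod
          (X.subquotient (E (ℓ - j)) (E (ℓ - i)))).IsIsodual)) ∧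
    (∀ [NumberField.IsCMField K] (σ : V →ₗ[K] Conj K (Dual K V)),
      X.IsSimilarity X.dual.conjugate σ → IsUnitaryForm (sesqForm σ) →
      (∀ i ≤ ℓ, Conj.out K (Dual K V) '' (σ '' (E i : Set V)) =
        {φ : Dual K V | ∀ x ∈ E (ℓ - i), φ x = 0}) ∧
      (∀ i ≤ ℓ, 2 * i ≤ ℓ → IsTotallyIsotropic (sesqForm σ) (E i)) ∧
      (∀ i ≤ ℓ, ℓ ≤ 2 * i → IsCoisotropic (sesqForm σ) (E i)) ∧
      (∀ i, 2 * i ≤ ℓ → (X.subquotient (E i) (E (ℓ - i))).IsAntiIsodual) ∧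
      (∀ i j, i ≤ j → 2 * j ≤ ℓ →
        ((X.subquotient (E i) (E j)).prod
          (X.subquotient (E (ℓ - j)) (E (ℓ - i)))).IsAntiIsodual)) := by
  refine ⟨fun σ hσ _ => ?_, fun σ hσ _ => ?_⟩
  · obtain ⟨r, ρ, hr, hρ, hρ', h⟩ := AdelicSpace.isSimilarity_iff_scalesBy.1 hσ
    exact ⟨fun i hi => hE.image_eq hX hr hρ hρ' h hi,
      fun i _ hi y hy x hx => hE.isotropic hX hr hρ hρ' h hi hx hy,
      fun i hi hi' y hy => hE.coisotropic hX hr hρ hρ' h hi hi' hy,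
      fun i hi => (hE.isTwistedIsodual_subquotient hX hr hρ hρ' h hi).isIsodual,
      fun i j hij hj => (hE.isTwistedIsodual_prod hX hr hρ hρ' h hij hj).isIsodual⟩
  · obtain ⟨r, ρ, hr, hρ, hρ', h⟩ := AdelicSpace.isSimilarity_conjugate_iff_scalesBy.1 hσ
    refine ⟨fun i hi => ?_,
      fun i _ hi y hy x hx => hE.isotropic hX hr hρ hρ' h hi hx hy,
      fun i hi hi' y hy => hE.coisotropic hX hr hρ hρ' h hi hi' hy,
      fun i hi => (hE.isTwistedIsodual_subquotient hX hr hρ hρ' h hi).isAntiIsodual,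
      fun i j hij hj => (hE.isTwistedIsodual_prod hX hr hρ hρ' h hij hj).isAntiIsodual⟩
    -- The composite of `σ` with `Conj.out` is the semilinear map to which the twisted statement
    -- applies.
    rw [← Set.image_comp]
    exact hE.image_eq hX hr hρ hρ' h hi
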